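/- **Setting.** A two-player lossy channel arena consists of finite sets $L$ (locations), $M$ (messages), $\mathrm{Act}_1,\mathrm{Act}_2$ (actions), an initial location, and a map $\mathrm{Tab}\colon L\times \mathrm{Act}_1\times\mathrm{Act}_2\to\mathrm{Dist}(L\times \mathrm{op}_M)$, where $\mathrm{op}_M$ contains the partial maps $nop$, $!m$ ($\mu\mapsto m\mu$) and $?m$ ($\mu m\mapsto\mu$, undefined on words not ending in $m$) on $M^*$. States are the words $s=l\mu\in S=L\cdot M^*$. An action of a player is allowed in $l\mu$ (the set $\mathrm{Act}_i(s)$) if no operation that has positive probability under it, for some action of the other player, is undefined on $\mu$; every player is assumed to have an allowed action in every state. In a round both players choose, concurrently and independently, a distribution of allowed actions as a function of the history of states; $\mathrm{Tab}$ yields a new location and an operation; the operation is applied; then every message is lost independently with a fixed probability $\lambda\in(0,1)$. This defines $\Pr_s^{\sigma_1,\sigma_2}$ on $S^\omega$. $\mathrm{AS}(\varphi)$ means $\Pr(\varphi)=1$ and $\mathrm{NZ}(\varphi)$ means $\Pr(\varphi)>0$. A strategy is winning for an objective from $s$ if the objective holds from $s$ against every strategy of the opponent; $[\![\Phi]\!]_i$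 is the set of states from which player $i$ has a winning strategy. $\mathrm{Stay}_i(D)(s)$ is the set of actions in $\mathrm{Act}_i(s)$ that, against every strategy of the opponent, keep the next state in $D$ almost surely. A strategy is PFM if it depends only on the last state, uses finitely many distributions of actions, and uses each of them on a regular set of histories. A strategy $\tau$ is counting if there are PFM strategies $u,v$ with $\tau(\alpha\mid h)=p_k\,u(\alpha\mid h)+(1-p_k)\,v(\alpha\mid h)$ for all histories $h$ of length $k$, where $p_k=2^{-1/2^k}$. **Algorithm.** Let $R\subseteq S$ be regular and $i$ a player with opponent $-i$. Let $\mathcal H$ be the game with $R$ made absorbing: transitions from states in $R$ are changed in any way such that $R$ cannot be left under allowed actions (not at all, if $R$ already is absorbing), and nothing else is changed. Put $D_0=S$, $\mathcal A_0=\mathcal H$ and, for $k\ge0$, with all winning regions taken in $\mathcal A_k$, $$C_k=[\![\mathrm{AS}(\Box(D_k\setminus R))]\!]_{-i},\qquad Y_k=[\![\mathrm{NZ}(\Diamond R)]\!]_i,\qquad D_{k+1}=[\![\mathrm{AS}(\Box Y_k)]\!]_i,$$ and let $\mathcal A_{k+1}$ be $\mathcal A_k$ restricted to the states in $D_{k+1}$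 and, for player $i$, to the actions in $\mathrm{Stay}_i(D_{k+1})$ (computed in $\mathcal A_k$). Stop as soon as $D_k=D_{k+1}$ and return $D_k$. **Theorem.** Let $W=[\![\mathrm{AS}(\Diamond R)]\!]_i$ in the original game. 1. The algorithm terminates, and $D_k=W$ for every $k$ with $D_k=D_{k+1}$. All the sets $C_k,Y_k,D_k$, and $W$, are regular. There are computable functions that, given $i$, an automaton for $R$, and the finite data of the arena (its sizes, its initial location, and the support of $\mathrm{Tab}$), return automata for $C_k,Y_k,D_k$ (given also $k$), and an automaton for $W$. 2. Every strategy $\sigma_i$ of player $i$ such that $\sigma_i(hs)$ is the uniform distribution over $\mathrm{Stay}_i(W)(s)$ (taken in $\mathcal H$) for all $h\in S^*$, $s\in W$, is winning for $\mathrm{AS}(\Diamond R)$ from every state in $W$. A PFM strategy of this form exists, and a finite representation of it is computable from the same data. 3. The opponent $-i$ has a counting strategy that is winning for $\mathrm{NZ}(\Box\overline R)$ from every state in $S\setminus W$. Finite representations of two PFM strategies that define it are computable from the same data. -/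

import Mathlib

open scoped ENNReal NNReal

namespace LossyGame

open MeasureTheory ProbabilityTheory

/-! ## Concurrent stochastic two-player games on a countable state space -/

/-- The two players are the two Booleans, the opponent of `i` is `!i`.  A game has a set `dom` of
states (the states of `S` outside `dom` have been removed from the game), a set of allowed actions
of every player in every state, and a stochastic transition function. -/
structure Game (S : Type) (Act : Bool → Type) where
  dom : Set S
  allowed : (i : Bool) → S → Set (Act i)
  trans : S → ((i : Bool) → Act i) → PMF S

/-- A randomised history-dependent choice of actions of one player. A nonempty history `h · s` is
given by the list `h` of the past states, in chronological order, and the current state `s`. -/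
abbrev Strat (S : Type) (B : Type) := List S → S → PMF B

/-- The pair of actions with given components. -/
def pairAct {Act : Bool → Type} (a : Act false) (b : Act true) : (i : Bool) → Act i
  | false => a
  | true => b

/-- The joint distribution of the actions of the two players, who randomise independently. -/
noncomputable def jointAct {S : Type} {Act : Bool → Type} (σ : (i : Bool) → Strat S (Act i))
    (h : List S) (s : S) : PMF ((i : Bool) → Act i) :=
  (σ false h s).bind fun a => (σ true h s).map fun b => pairAct a b

/-- The set of paths that eventually visit `X`. -/
def eventually {S : Type} (X : Set S) : Set (ℕ → S) := {ω | ∃ n, ω n ∈ X}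

/-- The set of paths that always stay in `X`. -/
def always {S : Type} (X : Set S) : Set (ℕ → S) := {ω | ∀ n, ω n ∈ X}

/-- The set of paths whose second state is in `X`. -/
def next {S : Type} (X : Set S) : Set (ℕ → S) := {ω | ω 1 ∈ X}

/-- The qualitative objective "with probability one". -/
def AS {S : Type} [MeasurableSpace S] (φ : Set (ℕ → S)) (μ : Measure (ℕ → S)) : Prop := μ φ = 1

/-- The qualitative objective "with positive probability". -/
def NZ {S : Type} [MeasurableSpace S] (φ : Set (ℕ → S)) (μ : Measure (ℕ → S)) : Prop := 0 < μ φ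

namespace Game

variable {S : Type} {Act : Bool → Type} (G : Game S Act)

/-- `σ` is a strategy of player `i`: it only plays allowed actions. -/
def IsStrategy (i : Bool) (σ : Strat S (Act i)) : Prop :=
  ∀ h, ∀ s ∈ G.dom, ∀ a ∈ (σ h s).support, a ∈ G.allowed i s

/-- `σ` is a strategy profile. -/
def IsProfile (σ : (i : Bool) → Strat S (Act i)) : Prop := ∀ i, G.IsStrategy i (σ i)

/-- The distribution of the next state after the history `h · s`. -/
noncomputable def step (σ : (i : Bool) → Strat S (Act i)) (h : List S) (s : S) : PMF S :=
  (jointAct σ h s).bind fun a => G.trans s a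

section measure

variable [MeasurableSpace S] [DiscreteMeasurableSpace S] [Countable S]

/-- The transition kernel from the first `n + 1` states of a path to its next state. -/
noncomputable def stepKernel (σ : (i : Bool) → Strat S (Act i)) (n : ℕ) :
    Kernel ((k : Finset.Iic n) → (fun _ : ℕ => S) k) S :=
  Kernel.ofFunOfCountable fun x =>
    (G.step σ (List.ofFn fun k : Fin n => x ⟨k, Finset.mem_Iic.2 k.isLt.le⟩)
      (x ⟨n, Finset.mem_Iic.2 le_rfl⟩)).toMeasure

instance (σ : (i : Bool) → Strat S (Act i)) (n : ℕ) : IsMarkovKernel (G.stepKernel σ n) :=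
  ⟨fun x => by
    change IsProbabilityMeasure (PMF.toMeasure _)
    infer_instance⟩

/-- The law of the path that starts in `s` when the players follow `σ`. -/
noncomputable def pathMeasure (σ : (i : Bool) → Strat S (Act i)) (s : S) : Measure (ℕ → S) :=
  Kernel.traj (X := fun _ => S) (G.stepKernel σ) 0 fun _ => s

/-- The strategy `σ` of player `i` enforces the objective `Φ` from `s`, against every behaviour of
the opponent. -/
def Wins (i : Bool) (σ : Strat S (Act i)) (Φ : Measure (ℕ → S) → Prop) (s : S) : Prop :=
  ∀ σ' : (j : Bool) → Strat S (Act j), G.IsProfile σ' →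
    Φ (G.pathMeasure (Function.update σ' i σ) s)

/-- The winning region of the objective `Φ` for player `i`. -/
def winRegion (i : Bool) (Φ : Measure (ℕ → S) → Prop) : Set S :=
  {s | s ∈ G.dom ∧ ∃ σ, G.IsStrategy i σ ∧ G.Wins i σ Φ s}

/-- The allowed actions of player `i` in `s` that keep the play in `D` for one step, almost surely
and whatever the opponent does. -/
def stay (i : Bool) (D : Set S) (s : S) : Set (Act i) :=
  {a | a ∈ G.allowed i s ∧ ∀ σ : (j : Bool) → Strat S (Act j), G.IsProfile σ →
    σ i [] s = PMF.pure a → AS (next D) (G.pathMeasure σ s)}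

/-- The game restricted to the states in `D`, where player `i` only plays actions that stay
in `D`. -/
def restrict (i : Bool) (D : Set S) : Game S Act where
  dom := D
  allowed := Function.update G.allowed i (G.stay i D)
  trans := G.trans

/-- The set `D k` and the arena `𝒜 k` of the almost-sure reachability algorithm for player `i` and
target `R`. -/
def asRound (i : Bool) (R : Set S) : ℕ → Set S × Game S Act
  | 0 => (G.dom, G)
  | k + 1 =>
    let A := (asRound i R k).2
    let Y := A.winRegion i (NZ (eventually R))
    let D := A.winRegion i (AS (always Y))
    (D, A.restrict i D)

/-- The set `D k` of the algorithm. -/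
def asD (i : Bool) (R : Set S) (k : ℕ) : Set S := (G.asRound i R k).1

/-- The arena `𝒜 k` of the algorithm. -/
def asArena (i : Bool) (R : Set S) (k : ℕ) : Game S Act := (G.asRound i R k).2

/-- The set `Y k` of the algorithm. -/
def asY (i : Bool) (R : Set S) (k : ℕ) : Set S :=
  (G.asArena i R k).winRegion i (NZ (eventually R))

/-- The set `C k` of the algorithm. -/
def asC (i : Bool) (R : Set S) (k : ℕ) : Set S :=
  (G.asArena i R k).winRegion (!i) (AS (always (G.asD i R k \ R)))

end measure

/-- Once in `R`, the game cannot leave `R`, whatever allowed actions the players take. -/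
def Absorbing (R : Set S) : Prop :=
  ∀ s ∈ G.dom ∩ R, ∀ a : (i : Bool) → Act i, (∀ i, a i ∈ G.allowed i s) →
    ∀ t ∈ (G.trans s a).support, t ∈ R

/-- `H` arises from `G` by making `R` absorbing: the transitions from the states in `R` have been
changed in an arbitrary way that makes `R` absorbing, and nothing else has been changed.
If `R` is absorbing in `G`, then `H = G` is a possible choice. -/
structure IsAbsorbingVersion (H G : Game S Act) (R : Set S) : Prop where
  dom_eq : H.dom = G.dom
  allowed_eq : H.allowed = G.allowed
  trans_eq : ∀ s ∉ R, H.trans s = G.trans s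
  absorbing : H.Absorbing R

end Game

/-! ## Lossy channel arenas -/

/-- Channel operations over the message alphabet `M`: no action, enqueue, dequeue. -/
inductive ChanOp (M : Type) where
  | nop : ChanOp M
  | send : M → ChanOp M
  | recv : M → ChanOp M

/-- The effect of an operation on a channel content. Messages are enqueued at the front and dequeued
at the end of the word; `none` means that the operation is not possible. -/
def ChanOp.apply {M : Type} [DecidableEq M] : ChanOp M → List M → Option (List M)
  | .nop, μ => some μ
  | .send m, μ => some (m :: μ)
  | .recv m, μ => if μ.getLast? = some m then some μ.dropLast else none

/-- A coin that shows `true` with probability `p`. -/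
noncomputable def coin (p : ℝ≥0) (hp : p ≤ 1) : PMF Bool :=
  PMF.ofFintype (fun b => cond b (p : ℝ≥0∞) (1 - p)) (by
    have : (p : ℝ≥0∞) ≤ 1 := by exact_mod_cast hp
    simp [this])

/-- Message losses: every message is lost with probability `p`, independently of the others. -/
noncomputable def lossy {M : Type} (p : ℝ≥0) (hp : p ≤ 1) : List M → PMF (List M)
  | [] => PMF.pure []
  | m :: μ => (coin p hp).bind fun lost =>
      (lossy p hp μ).map fun μ' => if lost then μ' else m :: μ'

/-- A configuration: a location and a channel content. -/
structure Config (L M : Type) where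
  loc : L
  chan : List M

instance (L M : Type) : MeasurableSpace (Config L M) := ⊤

instance (L M : Type) : DiscreteMeasurableSpace (Config L M) := ⟨fun _ => trivial⟩

instance (L M : Type) [Countable L] [Countable M] : Countable (Config L M) :=
  Function.Injective.countable (f := fun s : Config L M => (s.loc, s.chan))
    (by rintro ⟨_, _⟩ ⟨_, _⟩ h; simpa using h)

/-- Two-player concurrent stochastic lossy channel arenas. The finite sets of locations, messages and
actions are numbered. -/
structure Arena where
  numLoc : ℕ
  numMsg : ℕ
  numAct : Bool → ℕ
  tab : Fin numLoc → ((i : Bool) → Fin (numAct i)) → PMF (Fin numLoc × ChanOp (Fin numMsg))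
  init : Fin numLoc

namespace Arena

variable (A : Arena)

abbrev State := Config (Fin A.numLoc) (Fin A.numMsg)

abbrev Act (i : Bool) := Fin (A.numAct i)

/-- An action is allowed if it never triggers an impossible channel operation. -/
def allowedAct (i : Bool) (s : A.State) : Set (A.Act i) :=
  {a | ∀ b : (j : Bool) → A.Act j, ∀ o ∈ (A.tab s.loc (Function.update b i a)).support,
    o.2.apply s.chan ≠ none}

/-- In every configuration, every player has an allowed action. -/
def NonBlocking : Prop := ∀ (i : Bool) (s : A.State), (A.allowedAct i s).Nonempty

/-- The concurrent stochastic game described by the arena, with message loss probability `p`: sample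
a new location and an operation, apply the operation, then lose messages. (The channel is left
unchanged by an impossible operation; this is irrelevant, as allowed actions exclude it.) -/
noncomputable def game (p : ℝ≥0) (hp : p ≤ 1) : Game A.State A.Act where
  dom := Set.univ
  allowed := A.allowedAct
  trans s a := (A.tab s.loc a).bind fun o =>
    (lossy p hp ((o.2.apply s.chan).getD s.chan)).map fun μ => ⟨o.1, μ⟩

/-- Locations and messages form one alphabet. -/
abbrev Letter := Fin A.numLoc ⊕ Fin A.numMsg

/-- A configuration as a word. -/
def word (s : A.State) : List A.Letter := Sum.inl s.loc :: s.chan.map Sum.inr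

/-- A set of configurations is regular. -/
def RegularSet (X : Set A.State) : Prop :=
  Language.IsRegular ({w | ∃ s ∈ X, w = A.word s} : Language A.Letter)

variable {A}

/-- The choice of actions depends on the last state only. -/
def IsPositional {i : Bool} (σ : Strat A.State (A.Act i)) : Prop := ∀ h h' s, σ h s = σ h' s

/-- Finitely many distributions of actions are used, each of them on a regular set of histories. -/
def IsFiniteMemory {i : Bool} (σ : Strat A.State (A.Act i)) : Prop :=
  (Set.range fun x : List A.State × A.State => σ x.1 x.2).Finite ∧
  ∀ δ : PMF (A.Act i), Language.IsRegular
    ({w | ∃ h s, σ h s = δ ∧ w = (h ++ [s]).flatMap A.word} : Language A.Letter)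

/-- Positional and finite memory. -/
def IsPFM {i : Bool} (σ : Strat A.State (A.Act i)) : Prop := IsPositional σ ∧ IsFiniteMemory σ

/-- The weight `2 ^ (-1 / 2 ^ k)` of counting strategies. -/
noncomputable def countWeight (k : ℕ) : ℝ := (2 : ℝ) ^ (-(1 : ℝ) / 2 ^ k)

/-- On histories `h · s` of length `k`, the strategy `σ` plays `u` with probability
`countWeight k`, and `v` otherwise. -/
def IsCountingMix {i : Bool} (σ u v : Strat A.State (A.Act i)) : Prop :=
  ∀ h s a, (σ h s a).toReal =
    countWeight (h.length + 1) * (u h s a).toReal +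
      (1 - countWeight (h.length + 1)) * (v h s a).toReal

end Arena

/-- `p` is the uniform distribution over the set `X`, which has to be finite and nonempty. -/
def IsUniformOn {B : Type} (p : PMF B) (X : Set B) : Prop :=
  ∃ (F : Finset B) (hF : F.Nonempty), (F : Set B) = X ∧ p = PMF.uniformOfFinset F hF

/-! ## Finite representations of arenas, regular sets and strategies -/

/-- A nondeterministic finite automaton: transitions, initial states, accepting states. Letters are
pairs of a sort (location or message) and a number. -/
abbrev AutCode := List (ℕ × (ℕ ⊕ ℕ) × ℕ) × List ℕ × List ℕ

/-- The automaton given by a code. -/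
def AutCode.nfa (c : AutCode) : NFA (ℕ ⊕ ℕ) ℕ where
  step q x := {q' | (q, x, q') ∈ c.1}
  start := {q | q ∈ c.2.1}
  accept := {q | q ∈ c.2.2}

/-- The set of configurations accepted by an automaton. -/
def AutCode.states (c : AutCode) (A : Arena) : Set A.State :=
  {s | (A.word s).map (Sum.map Fin.val Fin.val) ∈ (AutCode.nfa c).accepts}

/-- A channel operation as a finite object. -/
def ChanOp.code {n : ℕ} : ChanOp (Fin n) → Option (Bool × ℕ)
  | .nop => none
  | .send m => some (false, m)
  | .recv m => some (true, m)

/-- The finite data of an arena: the numbers of locations, messages and actions of the two players,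
the list of all `(l, a, b, l', f)` such that `tab l (a, b)` gives positive probability to `(l', f)`,
and the initial location. -/
abbrev ArenaCode :=
  (ℕ × ℕ × ℕ × ℕ) × List (ℕ × ℕ × ℕ × ℕ × Option (Bool × ℕ)) × ℕ

/-- The code `c` presents the arena `A`. The exact values of the positive probabilities are not part
of the presentation. -/
def ArenaCode.Presents (c : ArenaCode) (A : Arena) : Prop :=
  c.1 = (A.numLoc, A.numMsg, A.numAct false, A.numAct true) ∧
  (∀ (l : Fin A.numLoc) (a : (i : Bool) → A.Act i) (o : Fin A.numLoc × ChanOp (Fin A.numMsg)),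
    o ∈ (A.tab l a).support ↔
      ((l : ℕ), (a false : ℕ), (a true : ℕ), (o.1 : ℕ), o.2.code) ∈ c.2.1) ∧
  c.2.2 = A.init

/-- A PFM strategy as a finite list of regular sets of states, each with a distribution of actions,
given by natural weights. -/
abbrev StratCode := List (AutCode × List ℕ)

/-- The sets listed in `c` cover all states, and on each of them `σ` plays the listed distribution,
whatever the past. -/
def StratCode.Represents (c : StratCode) {A : Arena} {i : Bool} (σ : Strat A.State (A.Act i)) :
    Prop :=
  (∀ s : A.State, ∃ e ∈ c, s ∈ AutCode.states e.1 A) ∧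
  ∀ e ∈ c, ∀ h, ∀ s ∈ AutCode.states e.1 A, ∀ a : A.Act i,
    σ h s a = (e.2.getD a 0 : ℝ≥0∞) / (e.2.sum : ℝ≥0∞)

end LossyGame

open LossyGame

/-! All objectives are qualitative, so a round of the algorithm depends on supports only; numerical
probabilities matter in two limit arguments, one for each player.

One round. With finitely many actions, player `j` reaches `T` with positive probability exactly from
the attractor of `T`. Inside it, the uniform distribution over the allowed actions contains the
right answer to whatever the opponent draws. Outside it, a single opponent action is safe against
all answers, so a pure positional strategy avoids `T` surely (`winRegion_NZ_eventually`,
`winRegion_AS_always`). Hence `C` is the complement of `Y` in `D`, and the next `D` is obtained by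
removing the opponent's attractor of `C`. What happens inside `R` is irrelevant, and the rounds
become the iteration of an operator `roundD` on the original game (`asD_eq_iterate_roundD`).

Player `i` wins on a fixed point `W`. There `C` is empty, so from every state of `W` uniform play
over the actions that stay in `W` reaches `R` with a positive probability bounded below
independently of the past. Message losses make the expected channel length contract once the channel
is long, so the finite set of configurations with short channels is met almost surely. If `Q` is the
supremum of the probabilities of missing `R`, these two facts give `Q ≤ Q - ε * Q`, hence `Q = 0`
(`safeForever_eq_zero`).

The opponent wins elsewhere. In `C k` one action keeps the play in `C k`, as long as player `i` uses
actions that stay in `D k`; the strategy `u` plays such actions. The strategy `v` plays everything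
allowed, so it punishes any other action of player `i` by leaving `D k` with positive probability,
and induction on `k` applies. Mixing the two works because the weights satisfy `w (k + 1) * w (k +
1) = w k`: all finite products of the weights after `k` are at least `w k`, so `u` is drawn forever
with positive probability (`safeForever_pos_of_counting`).

Termination and regularity. Successors are closed under further losses, so a transition can hit a
set if and only if it can hit the upward closure of that set for the subword order. By Higman's
lemma the upward closures of an increasing sequence become stable (`exists_upLe`). This stops the
layers of each attractor, and it also stops the rounds: once the removed states have a stable upward
closure, the staying actions no longer change, and the next round is the last (`roundD_roundD_eq`).
Every step preserves regularity, because membership of a channel content depends on its last letter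
and on the runs of finitely many automata after at most one added or removed message, a right
congruence of finite index.

Computability. Automata and strategies are not constructed by hand. Their existence follows from the
congruence, the correctness of a candidate is decidable (`computablePred_forall`), and unbounded
search finds a correct one (`exists_computable_choice`). -/

namespace LossyGame

open MeasureTheory ProbabilityTheory

/-! ## Expectations with respect to a probability mass function -/

/-- The expectation of `f`. -/
noncomputable def expect {α : Type} (μ : PMF α) (f : α → ℝ≥0∞) : ℝ≥0∞ := ∑' t, μ t * f t

section expect

variable {α β : Type} (μ : PMF α) {f g : α → ℝ≥0∞}

theorem expect_bind (k : α → PMF β) (f : β → ℝ≥0∞) :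
    expect (μ.bind k) f = expect μ fun a => expect (k a) f := by
  simp only [expect, PMF.bind_apply, ← ENNReal.tsum_mul_right, ← ENNReal.tsum_mul_left]
  rw [ENNReal.tsum_comm]
  simp only [mul_assoc]

theorem expect_pure (a : α) (f : α → ℝ≥0∞) : expect (PMF.pure a) f = f a := by
  rw [expect, tsum_eq_single a]
  · simp
  · intro b hb
    simp [hb]

theorem expect_map (k : α → β) (f : β → ℝ≥0∞) :
    expect (μ.map k) f = expect μ fun a => f (k a) := by
  rw [← PMF.bind_pure_comp, expect_bind]
  simp only [Function.comp_apply, expect_pure]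

theorem expect_mono (h : ∀ t ∈ μ.support, f t ≤ g t) : expect μ f ≤ expect μ g := by
  refine ENNReal.tsum_le_tsum fun t => ?_
  by_cases ht : t ∈ μ.support
  · exact mul_le_mul_right (h t ht) _
  · simp [(PMF.apply_eq_zero_iff μ t).2 ht]

theorem expect_const (c : ℝ≥0∞) : expect μ (fun _ => c) = c := by
  rw [expect, ENNReal.tsum_mul_right, μ.tsum_coe, one_mul]

theorem expect_congr (h : ∀ t ∈ μ.support, f t = g t) : expect μ f = expect μ g :=
  le_antisymm (expect_mono μ fun t ht => (h t ht).le) (expect_mono μ fun t ht => (h t ht).ge)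

theorem expect_le {c : ℝ≥0∞} (h : ∀ t ∈ μ.support, f t ≤ c) : expect μ f ≤ c :=
  (expect_mono μ h).trans (expect_const μ c).le

theorem le_expect {c : ℝ≥0∞} (h : ∀ t ∈ μ.support, c ≤ f t) : c ≤ expect μ f :=
  (expect_const μ c).ge.trans (expect_mono μ h)

theorem mul_le_expect (f : α → ℝ≥0∞) (t : α) : μ t * f t ≤ expect μ f :=
  ENNReal.le_tsum t

theorem expect_add (f g : α → ℝ≥0∞) :
    expect μ (fun t => f t + g t) = expect μ f + expect μ g := by
  simp only [expect, mul_add, ENNReal.tsum_add]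

theorem expect_const_mul (c : ℝ≥0∞) (f : α → ℝ≥0∞) :
    expect μ (fun t => c * f t) = c * expect μ f := by
  simp only [expect, ← ENNReal.tsum_mul_left]
  exact tsum_congr fun t => by ring

theorem expect_lt_one (h : ∀ t, f t ≤ 1) {t : α} (ht : t ∈ μ.support) (hlt : f t < 1) :
    expect μ f < 1 := by
  have h1 : expect μ (fun s => f s + (1 - f s)) = 1 := by
    rw [expect_congr μ (g := fun _ => 1), expect_const]
    intro s _
    exact add_tsub_cancel_of_le (h s)
  rw [expect_add] at h1
  have h2 : 0 < expect μ fun s => 1 - f s :=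
    lt_of_lt_of_le (ENNReal.mul_pos ((PMF.mem_support_iff _ _).1 ht) (tsub_pos_of_lt hlt).ne')
      (mul_le_expect μ _ t)
  have h3 : expect μ f ≠ ⊤ := ne_top_of_le_ne_top ENNReal.one_ne_top (expect_le μ fun t _ => h t)
  calc expect μ f < expect μ f + expect μ (fun s => 1 - f s) := ENNReal.lt_add_right h3 h2.ne'
    _ = 1 := h1

theorem expect_eq_lintegral [MeasurableSpace α] [DiscreteMeasurableSpace α] [Countable α]
    (f : α → ℝ≥0∞) : expect μ f = ∫⁻ t, f t ∂μ.toMeasure := by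
  rw [lintegral_countable']
  refine tsum_congr fun t => ?_
  rw [PMF.toMeasure_apply_singleton _ _ (MeasurableSet.of_discrete), mul_comm]

/-- Monotone convergence from above; the bound at index `0` supplies the finiteness that decreasing
limits need. -/
theorem expect_iInf [Countable α] {f : ℕ → α → ℝ≥0∞} (hf : Antitone f) (h1 : ∀ t, f 0 t ≤ 1) :
    expect μ (fun t => ⨅ n, f n t) = ⨅ n, expect μ (f n) := by
  let _ : MeasurableSpace α := ⊤
  have : DiscreteMeasurableSpace α := ⟨fun _ => trivial⟩
  simp only [expect_eq_lintegral]
  rw [lintegral_iInf (fun n => measurable_of_countable _) hf]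
  rw [← expect_eq_lintegral]
  exact ne_top_of_le_ne_top ENNReal.one_ne_top (expect_le μ fun t _ => h1 t)

end expect

namespace Game

variable {S : Type} {Act : Bool → Type} (G : Game S Act)

/-! ## The probability of staying in a set of states -/

/-- The probability that the next `n` states after the history `h · s`, and `s` itself, are in
`X`. -/
noncomputable def safe (σ : (i : Bool) → Strat S (Act i)) (X : Set S) :
    ℕ → List S → S → ℝ≥0∞
  | 0, _, s => X.indicator 1 s
  | n + 1, h, s => X.indicator (fun s => expect (G.step σ h s) (safe σ X n (h ++ [s]))) s

section safe

variable {G} {σ : (i : Bool) → Strat S (Act i)} {X : Set S}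

theorem safe_of_notMem {n : ℕ} {h : List S} {s : S} (hs : s ∉ X) : G.safe σ X n h s = 0 := by
  cases n <;> simp [safe, hs]

theorem safe_zero_of_mem {h : List S} {s : S} (hs : s ∈ X) : G.safe σ X 0 h s = 1 := by
  simp [safe, hs]

theorem safe_succ_of_mem {n : ℕ} {h : List S} {s : S} (hs : s ∈ X) :
    G.safe σ X (n + 1) h s = expect (G.step σ h s) (G.safe σ X n (h ++ [s])) := by
  simp [safe, hs]

theorem safe_le_one (n : ℕ) (h : List S) (s : S) : G.safe σ X n h s ≤ 1 := by
  induction n generalizing h s with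
  | zero =>
    by_cases hs : s ∈ X
    · rw [safe_zero_of_mem hs]
    · simp [safe_of_notMem hs]
  | succ n ih =>
    by_cases hs : s ∈ X
    · rw [safe_succ_of_mem hs]
      exact expect_le _ fun t _ => ih _ _
    · simp [safe_of_notMem hs]

theorem safe_succ_le (n : ℕ) (h : List S) (s : S) :
    G.safe σ X (n + 1) h s ≤ G.safe σ X n h s := by
  induction n generalizing h s with
  | zero =>
    by_cases hs : s ∈ X
    · rw [safe_zero_of_mem hs]
      exact safe_le_one _ _ _
    · simp [safe_of_notMem hs]
  | succ n ih =>
    by_cases hs : s ∈ X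
    · rw [safe_succ_of_mem hs, safe_succ_of_mem hs]
      exact expect_mono _ fun t _ => ih _ _
    · simp [safe_of_notMem hs]

theorem safe_antitone (h : List S) (s : S) : Antitone fun n => G.safe σ X n h s :=
  antitone_nat_of_succ_le fun n => safe_succ_le n h s

/-- The probability to stay in `X` forever after the history `h · s`. -/
noncomputable def safeForever (G : Game S Act) (σ : (i : Bool) → Strat S (Act i)) (X : Set S)
    (h : List S) (s : S) : ℝ≥0∞ := ⨅ n, G.safe σ X n h s

theorem safeForever_le_one (h : List S) (s : S) : G.safeForever σ X h s ≤ 1 :=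
  (iInf_le _ 0).trans (safe_le_one _ _ _)

theorem safeForever_of_notMem {h : List S} {s : S} (hs : s ∉ X) : G.safeForever σ X h s = 0 :=
  le_antisymm ((iInf_le _ 0).trans (safe_of_notMem hs).le) zero_le

/-- The one-step equation survives in the limit because `safe` decreases in `n`. Both limit
arguments work with this equation instead of the path measure. -/
theorem safeForever_of_mem [Countable S] {h : List S} {s : S} (hs : s ∈ X) :
    G.safeForever σ X h s = expect (G.step σ h s) (G.safeForever σ X (h ++ [s])) := by
  have h1 : G.safeForever σ X h s = ⨅ n, G.safe σ X (n + 1) h s :=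
    le_antisymm (le_iInf fun n => iInf_le _ _)
      (le_iInf fun n => (iInf_le _ n).trans (safe_succ_le _ _ _))
  rw [h1]
  simp only [safe_succ_of_mem hs]
  rw [← expect_iInf]
  · rfl
  · exact fun m n hmn t => safe_antitone _ _ hmn
  · exact fun t => safe_le_one _ _ _

end safe

section measure

variable [MeasurableSpace S] [DiscreteMeasurableSpace S] [Countable S]
variable {G} {σ : (i : Bool) → Strat S (Act i)} {X : Set S}

/-- Over a single step, `partialTraj` is the given prefix paired with one draw from `stepKernel`, so
only that draw is integrated. -/
theorem lintegral_partialTraj_succ (n : ℕ) (x : (k : Finset.Iic n) → (fun _ : ℕ => S) k)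
    (f : ((k : Finset.Iic (n + 1)) → (fun _ : ℕ => S) k) → ℝ≥0∞) (hf : Measurable f) :
    ∫⁻ y, f y ∂(Kernel.partialTraj (X := fun _ => S) (G.stepKernel σ) n (n + 1) x) =
      ∫⁻ t, f (IicProdIoc (X := fun _ => S) n (n + 1) (x, MeasurableEquiv.piSingleton
        (X := fun _ => S) n t)) ∂(G.stepKernel σ n x) := by
  rw [Kernel.partialTraj_succ_self, Kernel.lintegral_map _ (by fun_prop) _ hf,
    Kernel.lintegral_id_prod (by fun_prop), Kernel.lintegral_map _ (by fun_prop) _ (by fun_prop)]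

theorem measurableSet_forall_le (n j : ℕ) (X : Set S) :
    MeasurableSet {ω : ℕ → S | ∀ m ≤ j, ω (n + m) ∈ X} := by
  have : {ω : ℕ → S | ∀ m ≤ j, ω (n + m) ∈ X} = ⋂ m, ⋂ (_ : m ≤ j), (fun ω => ω (n + m)) ⁻¹' X := by
    ext; simp
  rw [this]
  exact MeasurableSet.iInter fun m => MeasurableSet.iInter fun _ =>
    (measurable_pi_apply _) (MeasurableSet.of_discrete)

/-- Projected to the first coordinates, the trajectory kernel is a Dirac mass at the prefix. -/
theorem traj_ae_start (n : ℕ) (x : (k : Finset.Iic n) → (fun _ : ℕ => S) k) :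
    ∀ᵐ ω ∂(Kernel.traj (X := fun _ => S) (G.stepKernel σ) n x),
      ω n = x ⟨n, Finset.mem_Iic.2 le_rfl⟩ := by
  have h1 := Kernel.traj_map_frestrictLe_of_le (X := fun _ => S) (κ := G.stepKernel σ)
    (le_refl n)
  have h2 : (Kernel.traj (X := fun _ => S) (G.stepKernel σ) n x).map
      (Preorder.frestrictLe n) = Measure.dirac x := by
    rw [← Kernel.map_apply _ (by fun_prop), h1, Kernel.deterministic_apply]
    rfl
  have h3 : ∀ᵐ y ∂((Kernel.traj (X := fun _ => S) (G.stepKernel σ) n x).map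
      (Preorder.frestrictLe n)), y = x := by
    rw [h2, ae_dirac_eq]
    rfl
  have h4 := ae_of_ae_map (by fun_prop) h3
  filter_upwards [h4] with ω hω
  exact congrFun hω ⟨n, Finset.mem_Iic.2 le_rfl⟩

/-- The link between the Ionescu-Tulcea measure and the recursion `safe`. The induction on `j` has
to cover all `n` and all prefixes, since conditioning on one step lengthens the prefix. -/
theorem traj_forall_le (j n : ℕ) (x : (k : Finset.Iic n) → (fun _ : ℕ => S) k) :
    Kernel.traj (X := fun _ => S) (G.stepKernel σ) n x {ω | ∀ m ≤ j, ω (n + m) ∈ X} =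
      G.safe σ X j (List.ofFn fun k : Fin n => x ⟨k, Finset.mem_Iic.2 k.isLt.le⟩)
        (x ⟨n, Finset.mem_Iic.2 le_rfl⟩) := by
  by_cases hx : x ⟨n, Finset.mem_Iic.2 le_rfl⟩ ∈ X
  swap
  · rw [safe_of_notMem hx]
    refine measure_mono_null (t := {ω | ω n = x ⟨n, Finset.mem_Iic.2 le_rfl⟩}ᶜ) ?_
      (traj_ae_start n x)
    intro ω hω heq
    exact hx (heq ▸ hω 0 (Nat.zero_le _))
  induction j generalizing n with
  | zero =>
    rw [safe_zero_of_mem hx]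
    refine (prob_compl_eq_zero_iff (measurableSet_forall_le n 0 X)).1 ?_
    refine measure_mono_null (t := {ω | ω n = x ⟨n, Finset.mem_Iic.2 le_rfl⟩}ᶜ) ?_
      (traj_ae_start n x)
    intro ω hω heq
    refine hω fun m hm => ?_
    rw [Nat.le_zero.1 hm, Nat.add_zero, heq]
    exact hx
  | succ j ih =>
    -- The constraint at time `n` concerns the prefix and holds almost surely, so it can be dropped.
    have hshift : Kernel.traj (X := fun _ => S) (G.stepKernel σ) n x
          {ω | ∀ m ≤ j + 1, ω (n + m) ∈ X} =
        Kernel.traj (X := fun _ => S) (G.stepKernel σ) n x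
          {ω | ∀ m ≤ j, ω (n + 1 + m) ∈ X} := by
      refine measure_congr ?_
      filter_upwards [traj_ae_start (G := G) (σ := σ) n x] with ω hω
      refine propext ⟨fun h m hm => ?_, fun h m hm => ?_⟩
      · have := h (m + 1) (by omega)
        rwa [show n + (m + 1) = n + 1 + m by ring] at this
      · rcases m with _ | m
        · rw [Nat.add_zero, hω]
          exact hx
        · have := h m (by omega)
          rwa [show n + 1 + m = n + (m + 1) by ring] at this
    -- Condition on the state at time `n + 1`; the induction hypothesis treats the rest of the path.
    rw [hshift, ← Kernel.traj_comp_partialTraj (X := fun _ => S) (Nat.le_succ n),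
      Kernel.comp_apply' _ _ _ (measurableSet_forall_le (n + 1) j X),
      lintegral_partialTraj_succ _ _ _
        (Kernel.measurable_coe _ (measurableSet_forall_le (n + 1) j X)),
      safe_succ_of_mem hx, expect_eq_lintegral]
    change _ = ∫⁻ t, _ ∂(G.stepKernel σ n x)
    refine lintegral_congr fun t => ?_
    have hnew : IicProdIoc (X := fun _ => S) n (n + 1) (x, MeasurableEquiv.piSingleton
        (X := fun _ => S) n t) ⟨n + 1, Finset.mem_Iic.2 le_rfl⟩ = t := by
      simp [IicProdIoc, MeasurableEquiv.piSingleton]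
    have hold : (List.ofFn fun k : Fin (n + 1) => IicProdIoc (X := fun _ => S) n (n + 1)
        (x, MeasurableEquiv.piSingleton (X := fun _ => S) n t)
          ⟨k, Finset.mem_Iic.2 k.isLt.le⟩) =
        (List.ofFn fun k : Fin n => x ⟨k, Finset.mem_Iic.2 k.isLt.le⟩) ++
          [x ⟨n, Finset.mem_Iic.2 le_rfl⟩] := by
      rw [List.ofFn_succ', List.concat_eq_append]
      congr 1
      · refine congrArg List.ofFn (funext fun k => ?_)
        simp [IicProdIoc, k.isLt.le]
      · simp [IicProdIoc]
    by_cases ht : t ∈ X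
    · have := ih (n + 1) (IicProdIoc (X := fun _ => S) n (n + 1) (x, MeasurableEquiv.piSingleton
        (X := fun _ => S) n t)) (by rw [hnew]; exact ht)
      rw [this, hold, hnew]
    · rw [safe_of_notMem ht]
      refine measure_mono_null (t := {ω | ω (n + 1) = t}ᶜ) ?_ ?_
      · intro ω hω heq
        have h0 := hω 0 (Nat.zero_le _)
        rw [Nat.add_zero, heq] at h0
        exact ht h0
      · have := traj_ae_start (G := G) (σ := σ) (n + 1) (IicProdIoc (X := fun _ => S) n (n + 1)
          (x, MeasurableEquiv.piSingleton (X := fun _ => S) n t))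
        rw [hnew] at this
        exact this

theorem measurableSet_always (X : Set S) : MeasurableSet (always X) := by
  have : always X = ⋂ n, (fun ω : ℕ → S => ω n) ⁻¹' X := by ext; simp [always]
  rw [this]
  exact MeasurableSet.iInter fun n => (measurable_pi_apply _) MeasurableSet.of_discrete

theorem eventually_eq_compl (X : Set S) : eventually X = (always Xᶜ)ᶜ := by
  ext; simp [eventually, always]

instance (s : S) : IsProbabilityMeasure (G.pathMeasure σ s) := by
  unfold pathMeasure
  infer_instance

theorem pathMeasure_forall_le (s : S) (n : ℕ) :
    G.pathMeasure σ s {ω | ∀ m ≤ n, ω m ∈ X} = G.safe σ X n [] s := by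
  have := traj_forall_le (G := G) (σ := σ) (X := X) n 0 fun _ => s
  simpa [pathMeasure] using this

theorem pathMeasure_always (s : S) :
    G.pathMeasure σ s (always X) = G.safeForever σ X [] s := by
  have : always X = ⋂ n, {ω : ℕ → S | ∀ m ≤ n, ω m ∈ X} := by
    ext ω
    simp only [always, Set.mem_ofPred_eq, Set.mem_iInter]
    exact ⟨fun h n m _ => h m, fun h n => h n n le_rfl⟩
  rw [this, Antitone.measure_iInter]
  · simp only [pathMeasure_forall_le]
    rfl
  · exact fun m n hmn ω hω k hk => hω k (hk.trans hmn)
  · intro n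
    simpa using (measurableSet_forall_le 0 n X).nullMeasurableSet
  · exact ⟨0, measure_ne_top _ _⟩

theorem AS_always_iff (s : S) :
    AS (always X) (G.pathMeasure σ s) ↔ ∀ n, G.safe σ X n [] s = 1 := by
  rw [AS, pathMeasure_always, safeForever]
  refine ⟨fun h n => le_antisymm (safe_le_one _ _ _) (h ▸ iInf_le _ n), fun h => by simp [h]⟩

theorem NZ_always_iff (s : S) :
    NZ (always X) (G.pathMeasure σ s) ↔ 0 < G.safeForever σ X [] s := by
  rw [NZ, pathMeasure_always]

theorem AS_eventually_iff (s : S) :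
    AS (eventually X) (G.pathMeasure σ s) ↔ G.safeForever σ Xᶜ [] s = 0 := by
  rw [AS, eventually_eq_compl, prob_compl_eq_one_iff (measurableSet_always _), pathMeasure_always]

theorem NZ_eventually_iff (s : S) :
    NZ (eventually X) (G.pathMeasure σ s) ↔ ∃ n, G.safe σ Xᶜ n [] s < 1 := by
  rw [NZ, pos_iff_ne_zero, eventually_eq_compl, Ne, prob_compl_eq_zero_iff (measurableSet_always _)]
  change ¬ AS _ _ ↔ _
  rw [AS_always_iff]
  push Not
  exact exists_congr fun n => (safe_le_one _ _ _).lt_iff_ne.symm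

theorem AS_next_iff (s : S) :
    AS (next X) (G.pathMeasure σ s) ↔ ∀ t ∈ (G.step σ [] s).support, t ∈ X := by
  have h1 : G.pathMeasure σ s (next X) = (G.step σ [] s).toMeasure X := by
    have := congrFun (congrArg DFunLike.coe
      (Kernel.map_traj_succ_self (X := fun _ => S) (κ := G.stepKernel σ) (a := 0))) fun _ => s
    rw [Kernel.map_apply _ (by fun_prop)] at this
    have h2 := congrArg (fun μ => μ X) this
    rw [Measure.map_apply (by fun_prop) MeasurableSet.of_discrete] at h2
    exact h2
  rw [AS, h1, PMF.toMeasure_apply_eq_one_iff _ MeasurableSet.of_discrete]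
  rfl

end measure

end Game

end LossyGame

/-! ### Uniform distributions, supports of one step, attractors and determinacy of a round -/

namespace LossyGame

open MeasureTheory ProbabilityTheory

/-- The uniform distribution on a nonempty set of a finite type. -/
noncomputable def unif {B : Type} [Finite B] [Nonempty B] (T : Set B) : PMF B :=
  open Classical in
  if h : T.Nonempty then PMF.uniformOfFinset T.toFinite.toFinset (by simpa using h)
  else PMF.pure (Classical.arbitrary B)

theorem mem_support_unif {B : Type} [Finite B] [Nonempty B] {T : Set B} (hT : T.Nonempty) {a : B} :
    a ∈ (unif T).support ↔ a ∈ T := by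
  rw [unif, dif_pos hT, PMF.mem_support_uniformOfFinset_iff]
  simp

theorem isUniformOn_unif {B : Type} [Finite B] [Nonempty B] {T : Set B} (hT : T.Nonempty) :
    IsUniformOn (unif T) T :=
  ⟨T.toFinite.toFinset, by simpa using hT, by simp, by rw [unif, dif_pos hT]⟩

namespace Game

variable {S : Type} {Act : Bool → Type} {G : Game S Act}

theorem mem_support_jointAct {σ : (i : Bool) → Strat S (Act i)} {h : List S} {s : S}
    {c : (i : Bool) → Act i} :
    c ∈ (jointAct σ h s).support ↔ ∀ i, c i ∈ (σ i h s).support := by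
  simp only [jointAct, PMF.mem_support_bind_iff, PMF.mem_support_map_iff]
  constructor
  · rintro ⟨a, ha, b, hb, rfl⟩ (_ | _)
    · exact ha
    · exact hb
  · intro hc
    refine ⟨c false, hc false, c true, hc true, ?_⟩
    funext i
    cases i <;> rfl

theorem mem_support_step {σ : (i : Bool) → Strat S (Act i)} {h : List S} {s t : S} :
    t ∈ (G.step σ h s).support ↔
      ∃ c : (i : Bool) → Act i, (∀ i, c i ∈ (σ i h s).support) ∧ t ∈ (G.trans s c).support := by
  simp only [step, PMF.mem_support_bind_iff, mem_support_jointAct]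

theorem safe_eq_one {σ : (i : Bool) → Strat S (Act i)} {X Z : Set S} (hZX : Z ⊆ X)
    (hZ : ∀ h, ∀ s ∈ Z, ∀ t ∈ (G.step σ h s).support, t ∈ Z) (n : ℕ) (h : List S) {s : S}
    (hs : s ∈ Z) : G.safe σ X n h s = 1 := by
  induction n generalizing h s with
  | zero => exact safe_zero_of_mem (hZX hs)
  | succ n ih =>
    rw [safe_succ_of_mem (hZX hs), expect_congr _ (g := fun _ => 1), expect_const]
    exact fun t ht => ih _ (hZ h s hs t ht)

theorem safe_mono {σ : (i : Bool) → Strat S (Act i)} {X X' : Set S} (hX : X ⊆ X') (n : ℕ)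
    (h : List S) (s : S) : G.safe σ X n h s ≤ G.safe σ X' n h s := by
  by_cases hs : s ∈ X
  swap
  · simp [safe_of_notMem hs]
  induction n generalizing h s with
  | zero => rw [safe_zero_of_mem hs, safe_zero_of_mem (hX hs)]
  | succ n ih =>
    rw [safe_succ_of_mem hs, safe_succ_of_mem (hX hs)]
    refine expect_mono _ fun t _ => ?_
    by_cases ht : t ∈ X
    · exact ih _ _ ht
    · simp [safe_of_notMem ht]

/-! ## Attractors -/

/-- The game cannot leave its set of states, and the players always have an allowed action. -/
structure Proper (G : Game S Act) : Prop where
  closed : ∀ s ∈ G.dom, ∀ c : (i : Bool) → Act i, (∀ i, c i ∈ G.allowed i s) →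
    ∀ t ∈ (G.trans s c).support, t ∈ G.dom
  nonempty : ∀ i, ∀ s ∈ G.dom, (G.allowed i s).Nonempty

/-- The states from which player `j` can force a visit to `T` within `n - 1` rounds, with positive
probability. -/
def attr (G : Game S Act) (j : Bool) (T : Set S) : ℕ → Set S
  | 0 => ∅
  | n + 1 => {s | s ∈ G.dom ∧ (s ∈ T ∨
      ∀ c : (i : Bool) → Act i, (∀ k, k ≠ j → c k ∈ G.allowed k s) → ∃ a ∈ G.allowed j s,
        ∃ t ∈ (G.trans s (Function.update c j a)).support, t ∈ attr G j T n)}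

/-- The states from which player `j` can force a visit to `T` with positive probability. -/
def attractor (G : Game S Act) (j : Bool) (T : Set S) : Set S := ⋃ n, G.attr j T n

theorem attr_mono {j : Bool} {T : Set S} : Monotone (G.attr j T) := by
  refine monotone_nat_of_le_succ fun n => ?_
  induction n with
  | zero => exact Set.empty_subset _
  | succ n ih =>
    rintro s ⟨hs, h | h⟩
    · exact ⟨hs, Or.inl h⟩
    · refine ⟨hs, Or.inr fun c hc => ?_⟩
      obtain ⟨a, ha, t, ht, htn⟩ := h c hc
      exact ⟨a, ha, t, ht, ih htn⟩

theorem attractor_subset_dom {j : Bool} {T : Set S} : G.attractor j T ⊆ G.dom := by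
  refine Set.iUnion_subset fun n => ?_
  cases n with
  | zero => exact Set.empty_subset _
  | succ n => exact fun s hs => hs.1

theorem inter_dom_subset_attractor {j : Bool} {T : Set S} : G.dom ∩ T ⊆ G.attractor j T :=
  fun _ hs => Set.mem_iUnion.2 ⟨1, hs.1, Or.inl hs.2⟩

/-- The order of quantifiers is the point: one choice of the opponent is safe against all actions of
`j` and for all layers at once. If each choice failed at some layer, a bound on these layers would
put `s` into the attractor. -/
theorem exists_of_notMem_attractor [∀ i, Finite (Act i)] {j : Bool} {T : Set S} {s : S}
    (hs : s ∈ G.dom \ G.attractor j T) :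
    ∃ c : (i : Bool) → Act i, (∀ k, k ≠ j → c k ∈ G.allowed k s) ∧ ∀ a ∈ G.allowed j s,
      ∀ t ∈ (G.trans s (Function.update c j a)).support, t ∉ G.attractor j T := by
  by_contra! hcon
  have h1 : ∀ c : (i : Bool) → Act i, ∃ n, (∀ k, k ≠ j → c k ∈ G.allowed k s) →
      ∃ a ∈ G.allowed j s, ∃ t ∈ (G.trans s (Function.update c j a)).support,
        t ∈ G.attr j T n := by
    intro c
    by_cases hc : ∀ k, k ≠ j → c k ∈ G.allowed k s
    · obtain ⟨a, ha, t, ht, htT⟩ := hcon c hc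
      obtain ⟨n, hn⟩ := Set.mem_iUnion.1 htT
      exact ⟨n, fun _ => ⟨a, ha, t, ht, hn⟩⟩
    · exact ⟨0, fun h => absurd h hc⟩
  choose n hn using h1
  -- There are finitely many joint actions, so the layers `n c` have a common bound.
  obtain ⟨N, hN⟩ := (Set.finite_range n).bddAbove
  refine hs.2 (Set.mem_iUnion.2 ⟨N + 1, hs.1, Or.inr fun c hc => ?_⟩)
  obtain ⟨a, ha, t, ht, htn⟩ := hn c hc
  exact ⟨a, ha, t, ht, attr_mono (hN ⟨c, rfl⟩) htn⟩

/-- Against a player who plays all allowed actions with positive probability, the target of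
the attractor is reached with positive probability. -/
theorem safe_lt_one_of_mem_attr (hG : G.Proper) {j : Bool} {T : Set S}
    {σ : (i : Bool) → Strat S (Act i)} (hσ : G.IsProfile σ)
    (hj : ∀ h, ∀ s ∈ G.dom, ∀ a ∈ G.allowed j s, a ∈ (σ j h s).support) (n : ℕ) (h : List S) {s : S}
    (hs : s ∈ G.attr j T n) : G.safe σ Tᶜ n h s < 1 := by
  induction n generalizing h s with
  | zero => exact absurd hs (Set.notMem_empty s)
  | succ n ih =>
    by_cases hT : s ∈ T
    · rw [safe_of_notMem (by simpa using hT)]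
      exact one_pos
    · rw [safe_succ_of_mem (by simpa using hT)]
      -- Any draw of the opponent will do: the attractor answers it with some `a`, which has
      -- positive probability under `σ j`.
      have hex : ∀ k, ∃ a, a ∈ (σ k h s).support := fun k => (σ k h s).support_nonempty
      choose c hc using hex
      obtain ⟨a, ha, t, ht, htn⟩ := (hs.2.resolve_left hT) c fun k _ => hσ k h s hs.1 _ (hc k)
      refine expect_lt_one _ (fun t => safe_le_one _ _ _) (t := t) ?_ (ih _ htn)
      refine mem_support_step.2 ⟨_, fun k => ?_, ht⟩
      by_cases hk : k = j
      · subst hk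
        rw [Function.update_self]
        exact hj h s hs.1 a ha
      · rw [Function.update_of_ne hk]
        exact hc k

variable [∀ i, Finite (Act i)] [∀ i, Nonempty (Act i)]

theorem Proper.isStrategy_unif (hG : G.Proper) (i : Bool) :
    G.IsStrategy i fun _ s => unif (G.allowed i s) :=
  fun _ s hs _ ha => (mem_support_unif (hG.nonempty i s hs)).1 ha

/-- The safe action outside the attractor depends on the state only. Playing it makes the complement
of the attractor invariant. -/
theorem exists_positional_avoiding (hG : G.Proper) {i j : Bool} (hij : i ≠ j) (T : Set S) :
    ∃ τ : Strat S (Act i), G.IsStrategy i τ ∧ ∀ σ : (k : Bool) → Strat S (Act k), G.IsProfile σ →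
      σ i = τ → ∀ n h, ∀ s ∈ G.dom \ G.attractor j T,
        G.safe σ (G.dom \ T) n h s = 1 := by
  classical
  have hch : ∀ s, ∃ b : Act i, s ∈ G.dom → b ∈ G.allowed i s ∧ (s ∉ G.attractor j T →
      ∀ a ∈ G.allowed j s, ∀ c : (k : Bool) → Act k, c i = b → c j = a →
        ∀ t ∈ (G.trans s c).support, t ∉ G.attractor j T) := by
    intro s
    by_cases hs : s ∈ G.dom \ G.attractor j T
    · obtain ⟨c, hc, hc'⟩ := exists_of_notMem_attractor hs
      refine ⟨c i, fun _ => ⟨hc i hij, fun _ a ha c' hci hcj t ht => hc' a ha t ?_⟩⟩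
      have : c' = Function.update c j a := by
        funext k
        by_cases hk : k = j
        · subst hk
          rw [Function.update_self, hcj]
        · have : k = i := by
            revert hk hij; cases k <;> cases i <;> cases j <;> simp
          subst this
          rw [Function.update_of_ne hk, hci]
      rwa [← this]
    · by_cases hd : s ∈ G.dom
      · obtain ⟨b, hb⟩ := hG.nonempty i s hd
        exact ⟨b, fun _ => ⟨hb, fun h => absurd ⟨hd, h⟩ hs⟩⟩
      · exact ⟨Classical.arbitrary _, fun h => absurd h hd⟩
  choose b hb using hch
  refine ⟨fun _ s => PMF.pure (b s), fun h s hs a ha => ?_, ?_⟩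
  · rw [PMF.support_pure, Set.mem_singleton_iff] at ha
    exact ha ▸ (hb s hs).1
  · intro σ hσ hσi n h s hs
    refine safe_eq_one (Z := G.dom \ G.attractor j T) ?_ ?_ n h hs
    · exact fun x hx => ⟨hx.1, fun hT => hx.2 (inter_dom_subset_attractor ⟨hx.1, hT⟩)⟩
    · intro h s hs t ht
      obtain ⟨c, hc, hct⟩ := mem_support_step.1 ht
      have hall : ∀ k, c k ∈ G.allowed k s := fun k => hσ k h s hs.1 _ (hc k)
      refine ⟨hG.closed s hs.1 c hall t hct, ?_⟩
      refine (hb s hs.1).2 hs.2 (c j) (hall j) c ?_ rfl t hct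
      have := hc i
      rw [hσi, PMF.support_pure] at this
      exact this

theorem isProfile_update {σ : (k : Bool) → Strat S (Act k)} (hσ : G.IsProfile σ) {i : Bool}
    {τ : Strat S (Act i)} (hτ : G.IsStrategy i τ) : G.IsProfile (Function.update σ i τ) := by
  intro k
  by_cases hk : k = i
  · subst hk
    rw [Function.update_self]
    exact hτ
  · rw [Function.update_of_ne hk]
    exact hσ k

/-- Lets two given strategies meet in one profile, so that incompatible winning claims contradict
each other. -/
theorem isProfile_of_ne {i j : Bool} (hij : i ≠ j) {τ : Strat S (Act i)} {ρ : Strat S (Act j)}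
    (hτ : G.IsStrategy i τ) (hρ : G.IsStrategy j ρ) (hG : G.Proper) :
    ∃ σ : (k : Bool) → Strat S (Act k), G.IsProfile σ ∧ σ i = τ ∧ σ j = ρ := by
  refine ⟨Function.update (Function.update (fun k _ s => unif (G.allowed k s)) j ρ) i τ,
    isProfile_update (isProfile_update (fun k => hG.isStrategy_unif k) hρ) hτ, ?_, ?_⟩
  · rw [Function.update_self]
  · rw [Function.update_of_ne hij.symm, Function.update_self]

section measure

variable [MeasurableSpace S] [DiscreteMeasurableSpace S] [Countable S]

/-- Inside the attractor uniform play wins, as it draws each required answer with positive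
probability. Outside, the avoiding strategy of the opponent refutes any winning claim. -/
theorem winRegion_NZ_eventually (hG : G.Proper) (j : Bool) (T : Set S) :
    G.winRegion j (NZ (eventually T)) = G.attractor j T := by
  ext s
  constructor
  · rintro ⟨hs, σ, hσ, hwin⟩
    by_contra hcon
    have hij : (!j) ≠ j := by simp
    obtain ⟨τ, hτ, hτ'⟩ := exists_positional_avoiding hG hij T
    obtain ⟨ρ, hρ, hρi, hρj⟩ := isProfile_of_ne hij hτ hσ hG
    have h1 := (NZ_eventually_iff s).1 (hwin ρ hρ)
    rw [← hρj, Function.update_eq_self] at h1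
    obtain ⟨n, hn⟩ := h1
    have h2 := hτ' ρ hρ hρi n [] s ⟨hs, hcon⟩
    have h3 := safe_mono (G := G) (σ := ρ) (X := G.dom \ T) (X' := Tᶜ) (fun x hx => hx.2) n [] s
    rw [h2] at h3
    exact absurd hn (not_lt.2 h3)
  · intro hs
    refine ⟨attractor_subset_dom hs, _, hG.isStrategy_unif j, fun σ hσ => ?_⟩
    rw [NZ_eventually_iff]
    obtain ⟨n, hn⟩ := Set.mem_iUnion.1 hs
    refine ⟨n, safe_lt_one_of_mem_attr hG (isProfile_update hσ (hG.isStrategy_unif j)) ?_ n [] hn⟩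
    intro h s hs a ha
    rw [Function.update_self]
    exact (mem_support_unif (hG.nonempty j s hs)).2 ha

/-- Uniform play of `j` refutes safety inside its attractor, and pure positional play of `i`
achieves it outside. Remaining in `dom` costs nothing, because a proper game cannot leave it. -/
theorem winRegion_AS_always (hG : G.Proper) {i j : Bool} (hij : i ≠ j) (T : Set S) :
    G.winRegion i (AS (always (G.dom \ T))) = G.dom \ G.attractor j T := by
  ext s
  constructor
  · rintro ⟨hs, σ, hσ, hwin⟩
    refine ⟨hs, fun hcon => ?_⟩
    obtain ⟨n, hn⟩ := Set.mem_iUnion.1 hcon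
    obtain ⟨ρ, hρ, hρi, hρj⟩ := isProfile_of_ne hij hσ (hG.isStrategy_unif j) hG
    have h1 := (AS_always_iff s).1 (hwin ρ hρ) n
    rw [← hρi, Function.update_eq_self] at h1
    have h2 := safe_lt_one_of_mem_attr (T := T) hG hρ (fun h s hs a ha => by
      rw [hρj]; exact (mem_support_unif (hG.nonempty j s hs)).2 ha) n [] hn
    have h3 := safe_mono (G := G) (σ := ρ) (X := G.dom \ T) (X' := Tᶜ) (fun x hx => hx.2) n [] s
    rw [h1] at h3
    exact absurd h2 (not_lt.2 h3)
  · intro hs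
    obtain ⟨τ, hτ, hτ'⟩ := exists_positional_avoiding hG hij T
    refine ⟨hs.1, τ, hτ, fun σ hσ => (AS_always_iff s).2 fun n => ?_⟩
    exact hτ' _ (isProfile_update hσ hτ) (Function.update_self ..) n [] s hs

/-- The allowed actions of player `i` in `s` such that all possible successors are in `D`. -/
def keep (G : Game S Act) (i : Bool) (D : Set S) (s : S) : Set (Act i) :=
  {a | a ∈ G.allowed i s ∧ ∀ c : (k : Bool) → Act k, c i = a → (∀ k, k ≠ i → c k ∈ G.allowed k s) →
    ∀ t ∈ (G.trans s c).support, t ∈ D}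

/-- Replaces a condition on path measures by one on supports: a reply with a bad successor becomes a
profile that plays it surely in `s`. -/
theorem stay_eq_keep (hG : G.Proper) (i : Bool) (D : Set S) {s : S} (hs : s ∈ G.dom) :
    G.stay i D s = G.keep i D s := by
  classical
  ext a
  refine and_congr_right fun ha => ⟨fun h c hca hc t ht => ?_, fun h σ hσ hσa => ?_⟩
  · have hall : ∀ k, c k ∈ G.allowed k s := by
      intro k
      by_cases hk : k = i
      · subst hk
        exact hca ▸ ha
      · exact hc k hk
    -- Away from `s` the profile only has to be allowed, hence the uniform choice.
    have := h (fun k _ x => if x = s then PMF.pure (c k) else unif (G.allowed k x)) ?_ ?_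
    · refine (AS_next_iff s).1 this t (mem_support_step.2 ⟨c, fun k => ?_, ht⟩)
      simp
    · intro k h x hx b hb
      by_cases hxs : x = s
      · subst hxs
        simp only [if_true, PMF.support_pure, Set.mem_singleton_iff] at hb
        exact hb ▸ hall k
      · simp only [hxs, if_false] at hb
        exact (mem_support_unif (hG.nonempty k x hx)).1 hb
    · simp [hca]
  · rw [AS_next_iff]
    intro t ht
    obtain ⟨c, hc, hct⟩ := mem_support_step.1 ht
    refine h c ?_ (fun k _ => hσ k [] s hs _ (hc k)) t hct
    have := hc i
    rw [hσa, PMF.support_pure] at this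
    exact this

/-! ## The rounds of the algorithm -/

section rounds

variable {H : Game S Act} {i : Bool} {R : Set S}

/-- The structure of the arenas in the algorithm. -/
structure IsRound (H : Game S Act) (i : Bool) (A : Game S Act) (D : Set S) : Prop where
  dom_eq : A.dom = D
  trans_eq : A.trans = H.trans
  allowed_ne : ∀ k, k ≠ i → A.allowed k = H.allowed k
  allowed_eq : ∀ s ∈ D, A.allowed i s = H.keep i D s
  proper : A.Proper

/-- Determinacy makes `Y` an attractor and `C` its complement in `D`. Staying in `Y` then means
avoiding `C`, so determinacy applies once more, with the players exchanged. -/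
theorem IsRound.asD_succ_eq {k : ℕ} (h : IsRound H i (H.asArena i R k) (H.asD i R k)) :
    H.asY i R k = (H.asArena i R k).attractor i R ∧
    H.asC i R k = H.asD i R k \ H.asY i R k ∧
    H.asD i R (k + 1) = H.asD i R k \ (H.asArena i R k).attractor (!i) (H.asC i R k) := by
  have hij : (!i) ≠ i := by simp
  have hY : H.asY i R k = (H.asArena i R k).attractor i R := winRegion_NZ_eventually h.proper i R
  have hC : H.asC i R k = H.asD i R k \ H.asY i R k := by
    rw [hY, asC]
    conv_lhs => rw [← h.dom_eq]
    conv_rhs => rw [← h.dom_eq]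
    exact winRegion_AS_always h.proper hij R
  refine ⟨hY, hC, ?_⟩
  have hsub : H.asY i R k ⊆ H.asD i R k := by
    rw [hY, ← h.dom_eq]
    exact attractor_subset_dom
  have := winRegion_AS_always h.proper hij.symm (H.asC i R k)
  rw [h.dom_eq] at this
  rw [← this, hC, Set.sdiff_sdiff_cancel_left hsub]
  rfl

/-- As the sets `D k` decrease, stay actions computed in the restricted arena agree with those
computed in `H`, so an arena is determined by its current `D`. No state is blocked, because outside
the opponent's attractor of `C` some action avoids that attractor against all replies. -/
theorem isRound_asArena (hH : H.Proper) (k : ℕ) :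
    IsRound H i (H.asArena i R k) (H.asD i R k) := by
  induction k with
  | zero =>
    refine ⟨rfl, rfl, fun _ _ => rfl, fun s hs => ?_, hH⟩
    refine Set.Subset.antisymm (fun a ha => ⟨ha, fun c hca hc t ht => ?_⟩) fun a ha => ha.1
    refine hH.closed s hs c (fun k => ?_) t ht
    by_cases hk : k = i
    · subst hk
      exact hca ▸ ha
    · exact hc k hk
  | succ k ih =>
    obtain ⟨hY, hC, hD⟩ := ih.asD_succ_eq
    have hsub : H.asD i R (k + 1) ⊆ H.asD i R k := by
      rw [hD]
      exact Set.sdiff_subset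
    have hne : ∀ j, j ≠ i → (H.asArena i R (k + 1)).allowed j = H.allowed j := by
      intro j hj
      rw [← ih.allowed_ne j hj]
      exact Function.update_of_ne hj _ _
    have hkeep : ∀ s ∈ H.asD i R (k + 1),
        (H.asArena i R (k + 1)).allowed i s = (H.asArena i R k).keep i (H.asD i R (k + 1)) s := by
      intro s hs
      rw [← stay_eq_keep ih.proper i _ (ih.dom_eq ▸ hsub hs)]
      exact congrFun (Function.update_self (β := fun i => S → Set (Act i)) i
        ((H.asArena i R k).stay i (H.asD i R (k + 1))) (H.asArena i R k).allowed) s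
    have heq : ∀ s ∈ H.asD i R (k + 1), (H.asArena i R (k + 1)).allowed i s =
        H.keep i (H.asD i R (k + 1)) s := by
      intro s hs
      rw [hkeep s hs]
      simp only [keep, ih.allowed_eq s (hsub hs), ih.trans_eq]
      ext a
      constructor
      · rintro ⟨⟨h1, h2⟩, h3⟩
        exact ⟨h1, fun c hca hc => h3 c hca fun j hj => by
          rw [ih.allowed_ne j hj]; exact hc j hj⟩
      · rintro ⟨h1, h2⟩
        refine ⟨⟨h1, fun c hca hc t ht => hsub (h2 c hca hc t ht)⟩, fun c hca hc => h2 c hca ?_⟩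
        intro j hj
        rw [← ih.allowed_ne j hj]
        exact hc j hj
    have htrans : (H.asArena i R (k + 1)).trans = H.trans := ih.trans_eq
    refine ⟨rfl, htrans, hne, heq, ?_, ?_⟩
    · intro s hs c hc t ht
      have hi := hc i
      rw [heq s hs] at hi
      exact hi.2 c rfl (fun j hj => hne j hj ▸ hc j) t (htrans ▸ ht)
    · intro j s hs
      by_cases hj : j = i
      · subst hj
        rw [hkeep s hs]
        have hs' := hs
        change s ∈ H.asD j R (k + 1) at hs'
        have hs2 : s ∈ (H.asArena j R k).dom \ (H.asArena j R k).attractor (!j)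
            (H.asC j R k) := by
          rw [ih.dom_eq, ← hD]
          exact hs'
        obtain ⟨c, hc, hc'⟩ := exists_of_notMem_attractor hs2
        have hcj := hc j (by simp)
        refine ⟨c j, hcj, fun c' hc'j hall t ht => ?_⟩
        have hb := hall (!j) (by simp)
        have hupd : c' = Function.update c (!j) (c' (!j)) := by
          funext l
          by_cases hl : l = !j
          · subst hl
            rw [Function.update_self]
          · have : l = j := by revert hl; cases l <;> cases j <;> simp
            subst this
            rw [Function.update_of_ne hl, hc'j]
        rw [hD]
        refine ⟨?_, hc' _ hb t (hupd ▸ ht)⟩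
        rw [← ih.dom_eq]
        refine ih.proper.closed s (ih.dom_eq ▸ hsub hs') c' (fun l => ?_) t ht
        by_cases hl : l = j
        · subst hl
          exact hc'j ▸ hcj
        · exact hall l hl
      · rw [hne j hj]
        have := ih.proper.nonempty j s (ih.dom_eq ▸ hsub hs)
        rwa [ih.allowed_ne j hj] at this

end rounds

end measure

end Game

end LossyGame

/-! ### Estimates of values over one step -/

namespace LossyGame

open MeasureTheory ProbabilityTheory

/-- A deficit `e` at the single point `t₀` lowers the expectation by its share `μ t₀ * e`. The
additive form avoids truncated subtraction. -/
theorem expect_add_mul_le {α : Type} (μ : PMF α) {f : α → ℝ≥0∞} {Q e : ℝ≥0∞} {t₀ : α}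
    (h : ∀ t ∈ μ.support, f t ≤ Q) (h₀ : f t₀ + e ≤ Q) : expect μ f + μ t₀ * e ≤ Q := by
  classical
  calc expect μ f + μ t₀ * e
      ≤ expect μ f + expect μ (fun t => if t = t₀ then e else 0) := by
        gcongr
        simpa using mul_le_expect μ (fun t => if t = t₀ then e else 0) t₀
    _ = expect μ (fun t => f t + if t = t₀ then e else 0) := (expect_add _ _ _).symm
    _ ≤ Q := expect_le _ fun t ht => by
        by_cases htt : t = t₀
        · simpa [htt] using h₀
        · simpa [htt] using h t ht

theorem mul_expect_le_expect {α : Type} {μ ν : PMF α} {w : ℝ≥0∞} (h : ∀ t, w * μ t ≤ ν t)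
    (f : α → ℝ≥0∞) : w * expect μ f ≤ expect ν f := by
  rw [expect, ← ENNReal.tsum_mul_left]
  refine ENNReal.tsum_le_tsum fun t => ?_
  rw [← mul_assoc]
  gcongr
  exact h t

namespace Game

variable {S : Type} {Act : Bool → Type} {G : Game S Act}

/-- The pair of actions with given components for player `i` and for the opponent. -/
def joint (i : Bool) (a : Act i) (b : Act (!i)) : (k : Bool) → Act k :=
  match i, a, b with
  | false, a, b => pairAct a b
  | true, a, b => pairAct b a

theorem joint_self (i : Bool) (a : Act i) (b : Act (!i)) : joint i a b i = a := by
  cases i <;> rfl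

theorem joint_not (i : Bool) (a : Act i) (b : Act (!i)) : joint i a b (!i) = b := by
  cases i <;> rfl

theorem eq_joint {i : Bool} {c : (k : Bool) → Act k} {a : Act i} {b : Act (!i)} (ha : c i = a)
    (hb : c (!i) = b) : c = joint i a b := by
  subst ha hb
  funext k
  cases i <;> cases k <;> rfl

theorem jointAct_eq (i : Bool) (σ : (k : Bool) → Strat S (Act k)) (h : List S) (s : S) :
    jointAct σ h s = (σ (!i) h s).bind fun b => (σ i h s).map fun a => joint i a b := by
  cases i
  · simp only [jointAct, ← PMF.bind_pure_comp]
    rw [PMF.bind_comm]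
    rfl
  · rfl

theorem expect_step (i : Bool) (σ : (k : Bool) → Strat S (Act k)) (h : List S) (s : S)
    (f : S → ℝ≥0∞) : expect (G.step σ h s) f = expect (σ (!i) h s) fun b =>
      expect (σ i h s) fun a => expect (G.trans s (joint i a b)) f := by
  simp only [step, jointAct_eq i, expect_bind, expect_map]

/-! ### Almost-sure reachability from a finite set that is met again and again -/

section reach

variable {σ : (k : Bool) → Strat S (Act k)} {i : Bool} {W R : Set S} {π : S → PMF (Act i)}
  {B : S → Set (Act (!i))}

/-- From layer `n + 1`, layer `n` is reached with positive probability whatever the opponent draws,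
so a deficit below `Q` is passed back, scaled by the probability of the step. The number `ε` is
independent of the history because `π` is. -/
theorem exists_add_mul_le_of_layer [Countable S] [∀ i, Finite (Act i)] [∀ i, Nonempty (Act i)]
    {U : ℕ → Set S} {Q : ℝ≥0∞}
    (hπ : ∀ h, ∀ s ∈ W \ R, σ i h s = π s)
    (hB : ∀ h s, ∀ b ∈ (σ (!i) h s).support, b ∈ B s)
    (hW : ∀ s ∈ W \ R, ∀ a ∈ (π s).support, ∀ b ∈ B s,
      ∀ t ∈ (G.trans s (joint i a b)).support, t ∈ W)
    (hU0 : U 0 = ∅)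
    (hU : ∀ n, ∀ s ∈ U (n + 1), s ∈ R ∨ ∀ b ∈ B s, ∃ a ∈ (π s).support,
      ∃ t ∈ (G.trans s (joint i a b)).support, t ∈ U n)
    (hQ : ∀ h, ∀ s ∈ W, G.safeForever σ Rᶜ h s ≤ Q) (n : ℕ) :
    ∀ s ∈ W, s ∈ U n → ∃ ε : ℝ≥0∞, 0 < ε ∧ ∀ h, G.safeForever σ Rᶜ h s + ε * Q ≤ Q := by
  induction n with
  | zero =>
    intro s _ hs
    rw [hU0] at hs
    exact absurd hs (Set.notMem_empty s)
  | succ n ih =>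
    intro s hsW hs
    by_cases hR : s ∈ R
    · refine ⟨1, one_pos, fun h => ?_⟩
      rw [safeForever_of_notMem (by simpa using hR), zero_add, one_mul]
    · have hb : ∀ b : Act (!i), ∃ ε : ℝ≥0∞, 0 < ε ∧ (b ∈ B s → ∀ h,
          (expect (π s) fun a => expect (G.trans s (joint i a b))
            (G.safeForever σ Rᶜ (h ++ [s]))) + ε * Q ≤ Q) := by
        intro b
        by_cases hbB : b ∈ B s
        · obtain ⟨a, ha, t, ht, htU⟩ := (hU n s hs).resolve_left hR b hbB
          obtain ⟨ε, hε, hε'⟩ := ih t (hW s ⟨hsW, hR⟩ a ha b hbB t ht) htU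
          refine ⟨π s a * (G.trans s (joint i a b) t * ε), ?_, fun _ h => ?_⟩
          · exact ENNReal.mul_pos ((PMF.mem_support_iff _ _).1 ha)
              (ENNReal.mul_pos ((PMF.mem_support_iff _ _).1 ht) hε.ne').ne'
          · rw [mul_assoc, mul_assoc]
            refine expect_add_mul_le _ (fun a' ha' => expect_le _ fun t' ht' =>
              hQ _ _ (hW s ⟨hsW, hR⟩ a' ha' b hbB t' ht')) ?_
            exact expect_add_mul_le _ (fun t' ht' =>
              hQ _ _ (hW s ⟨hsW, hR⟩ a ha b hbB t' ht')) (hε' _)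
        -- A dummy value for actions outside `B`, so that the minimum below can range over all
        -- actions.
        · exact ⟨1, one_pos, fun h => absurd h hbB⟩
      choose ε hε hε' using hb
      obtain ⟨b₀, hb₀⟩ := Finite.exists_min ε
      refine ⟨ε b₀, hε b₀, fun h => ?_⟩
      rw [safeForever_of_mem (by simpa using hR), expect_step i, hπ h s ⟨hsW, hR⟩,
        ← expect_const (σ (!i) h s) (ε b₀ * Q), ← expect_add]
      refine expect_le _ fun b hbs => le_trans ?_ (hε' b (hB h s b hbs) h)
      gcongr
      exact hb₀ b

/-- `V` is a Lyapunov function: until `F` is met, its expectation shrinks by the factor `ρ` in each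
step, while `V` remains at least `1`. -/
theorem safe_compl_le_pow {F : Set S} {V : S → ℝ≥0∞} {ρ : ℝ≥0∞} (hV : ∀ s ∉ F, 1 ≤ V s)
    (hdrift : ∀ s ∉ F, ∀ c, expect (G.trans s c) V ≤ ρ * V s) (n : ℕ) (h : List S) (s : S) :
    G.safe σ Fᶜ n h s ≤ ρ ^ n * V s := by
  by_cases hs : s ∈ F
  · rw [safe_of_notMem (by simpa using hs)]
    exact zero_le
  induction n generalizing h s with
  | zero => rw [safe_zero_of_mem (by simpa using hs), pow_zero, one_mul]; exact hV s hs
  | succ n ih =>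
    rw [safe_succ_of_mem (by simpa using hs)]
    calc expect (G.step σ h s) (G.safe σ Fᶜ n (h ++ [s]))
        ≤ expect (G.step σ h s) (fun t => ρ ^ n * V t) := by
          refine expect_mono _ fun t _ => ?_
          by_cases ht : t ∈ F
          · rw [safe_of_notMem (by simpa using ht)]
            exact zero_le
          · exact ih _ _ ht
      _ = ρ ^ n * expect (G.step σ h s) V := expect_const_mul _ _ _
      _ ≤ ρ ^ n * (ρ * V s) := by
          gcongr
          rw [step, expect_bind]
          exact expect_le _ fun c _ => hdrift s hs c
      _ = ρ ^ (n + 1) * V s := by ring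

/-- If a finite set of states is visited again and again almost surely, and if from every state
in `W` the set `R` is reached with a positive probability that does not depend on the past, then
`R` is reached almost surely. -/
theorem safeForever_eq_zero [Countable S] [∀ i, Finite (Act i)] [∀ i, Nonempty (Act i)]
    {U : ℕ → Set S} {F : Set S} {V : S → ℝ≥0∞} {ρ : ℝ≥0∞}
    (hπ : ∀ h, ∀ s ∈ W \ R, σ i h s = π s)
    (hB : ∀ h s, ∀ b ∈ (σ (!i) h s).support, b ∈ B s)
    (hW : ∀ s ∈ W \ R, ∀ a ∈ (π s).support, ∀ b ∈ B s,
      ∀ t ∈ (G.trans s (joint i a b)).support, t ∈ W)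
    (hU0 : U 0 = ∅)
    (hU : ∀ n, ∀ s ∈ U (n + 1), s ∈ R ∨ ∀ b ∈ B s, ∃ a ∈ (π s).support,
      ∃ t ∈ (G.trans s (joint i a b)).support, t ∈ U n)
    (hWU : W ⊆ ⋃ n, U n) (hF : F.Finite) (hρ : ρ < 1)
    (hV : ∀ s ∉ F, 1 ≤ V s) (hVtop : ∀ s, V s ≠ ⊤)
    (hdrift : ∀ s ∉ F, ∀ c, expect (G.trans s c) V ≤ ρ * V s) (h : List S) {s : S} (hs : s ∈ W) :
    G.safeForever σ Rᶜ h s = 0 := by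
  -- The worst probability of missing `R`. Histories are included in the supremum because the
  -- opponent's play may depend on them. The aim is `Q ≤ Q - ε * Q`.
  set Q : ℝ≥0∞ := ⨆ h, ⨆ s ∈ W, G.safeForever σ Rᶜ h s with hQdef
  have hQ : ∀ h, ∀ s ∈ W, G.safeForever σ Rᶜ h s ≤ Q := fun h s hs =>
    le_iSup_of_le h (le_iSup₂_of_le s hs le_rfl)
  have hQ1 : Q ≤ 1 := iSup_le fun h => iSup₂_le fun s _ => safeForever_le_one _ _
  -- Since `F` is finite, one factor serves all of its states; `ε ≤ 1` ensures `ε * Q ≤ Q`.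
  have hF' : ∃ ε : ℝ≥0∞, 0 < ε ∧ ε ≤ 1 ∧
      ∀ s ∈ F, s ∈ W → ∀ h, G.safeForever σ Rᶜ h s + ε * Q ≤ Q := by
    have hex : ∀ s, ∃ ε : ℝ≥0∞, 0 < ε ∧ (s ∈ W → ∀ h, G.safeForever σ Rᶜ h s + ε * Q ≤ Q) := by
      intro s
      by_cases hs : s ∈ W
      · obtain ⟨n, hn⟩ := Set.mem_iUnion.1 (hWU hs)
        obtain ⟨ε, h1, h2⟩ := exists_add_mul_le_of_layer hπ hB hW hU0 hU hQ n s hs hn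
        exact ⟨ε, h1, fun _ => h2⟩
      · exact ⟨1, one_pos, fun h => absurd h hs⟩
    choose ε hε hε' using hex
    rcases F.eq_empty_or_nonempty with rfl | hne
    · exact ⟨1, one_pos, le_rfl, fun s hs => absurd hs (Set.notMem_empty s)⟩
    · obtain ⟨s₀, _, hs₀⟩ := Set.exists_min_image F ε hF hne
      refine ⟨min (ε s₀) 1, lt_min (hε _) one_pos, min_le_right _ _, fun s hs hsW h => ?_⟩
      refine le_trans ?_ (hε' s hsW h)
      gcongr
      exact (min_le_left _ _).trans (hs₀ s hs)
  obtain ⟨ε, hε0, hε1, hε⟩ := hF'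
  have hεQ : ε * Q ≤ Q := mul_le_of_le_one_left zero_le hε1
  -- Run for `n` steps: paths that meet `F` or `R` gain the deficit, and the others are paid for by
  -- the probability of missing `F`, which tends to zero by the drift.
  have key : ∀ n h, ∀ s ∈ W,
      G.safeForever σ Rᶜ h s + ε * Q ≤ Q + G.safe σ Fᶜ n h s := by
    intro n
    induction n with
    | zero =>
      intro h s hs
      by_cases hsF : s ∈ F
      · exact (hε s hsF hs h).trans le_self_add
      · rw [safe_zero_of_mem (by simpa using hsF), add_comm]
        exact add_le_add hεQ (safeForever_le_one _ _)
    | succ n ih =>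
      intro h s hs
      by_cases hsF : s ∈ F
      · exact (hε s hsF hs h).trans le_self_add
      by_cases hR : s ∈ R
      · rw [safeForever_of_notMem (by simpa using hR), zero_add]
        exact hεQ.trans le_self_add
      rw [safeForever_of_mem (by simpa using hR), safe_succ_of_mem (by simpa using hsF),
        ← expect_const (G.step σ h s) (ε * Q), ← expect_const (G.step σ h s) Q, ← expect_add,
        ← expect_add, expect_const]
      refine expect_mono _ fun t ht => ih _ _ ?_
      obtain ⟨c, hc, hct⟩ := mem_support_step.1 ht
      rw [eq_joint (i := i) (c := c) rfl rfl] at hct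
      refine hW s ⟨hs, hR⟩ _ ?_ _ (hB h s _ (hc _)) t hct
      rw [← hπ h s ⟨hs, hR⟩]
      exact hc i
  have hlim : ∀ h, ∀ s ∈ W, G.safeForever σ Rᶜ h s + ε * Q ≤ Q := by
    intro h s hs
    have ht : Filter.Tendsto (fun n => Q + ρ ^ n * V s) Filter.atTop (nhds (Q + 0 * V s)) :=
      (ENNReal.Tendsto.mul_const (ENNReal.tendsto_pow_atTop_nhds_zero_of_lt_one hρ)
        (Or.inr (hVtop s))).const_add Q
    rw [zero_mul, add_zero] at ht
    refine ge_of_tendsto' ht fun n => (key n h s hs).trans ?_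
    gcongr
    exact safe_compl_le_pow hV hdrift n h s
  have hεQtop : ε * Q ≠ ⊤ :=
    ne_top_of_le_ne_top ENNReal.one_ne_top (hεQ.trans hQ1)
  have hQle : Q ≤ Q - ε * Q := by
    conv_lhs => rw [hQdef]
    exact iSup_le fun h => iSup₂_le fun s hs =>
      ENNReal.le_sub_of_add_le_right hεQtop (hlim h s hs)
  have hQ0 : Q = 0 := by
    by_contra hne
    exact absurd hQle (not_le.2 (ENNReal.sub_lt_self
      (ne_top_of_le_ne_top ENNReal.one_ne_top hQ1) hne (mul_ne_zero hε0.ne' hne)))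
  exact le_antisymm ((hQ h s hs).trans hQ0.le) zero_le

end reach

/-! ### Avoiding the target with positive probability by counting -/

section counting

variable {σ : (k : Bool) → Strat S (Act k)} {i : Bool} {R : Set S}

theorem safeForever_pos_of_succ [Countable S] {h : List S} {s t : S}
    {c : (k : Bool) → Act k} (hs : s ∉ R) (hc : ∀ k, c k ∈ (σ k h s).support)
    (ht : t ∈ (G.trans s c).support) (hpos : 0 < G.safeForever σ Rᶜ (h ++ [s]) t) :
    0 < G.safeForever σ Rᶜ h s := by
  rw [safeForever_of_mem (by simpa using hs)]
  exact lt_of_lt_of_le (ENNReal.mul_pos ((PMF.mem_support_iff _ _).1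
    (mem_support_step.2 ⟨c, hc, ht⟩)) hpos.ne') (mul_le_expect _ _ t)

/-- The opponent mixes two strategies: `u` stays in the sets `C k`, as long as player `i`
only plays the actions `K k`, and the other strategy plays all actions. Then, from the states
outside of some `D k`, the set `R` is avoided with positive probability. -/
theorem safeForever_pos_of_counting [Countable S] {u : Strat S (Act (!i))} {w : ℕ → ℝ≥0∞}
    (hw1 : ∀ k, w k ≤ 1) (hw0 : ∀ k, 0 < w k) (hw : ∀ k, w (k + 1) * w (k + 1) = w k)
    (hτu : ∀ h s b, w (h.length + 1) * u h s b ≤ σ (!i) h s b)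
    (hτv : ∀ h s, ∀ b ∈ G.allowed (!i) s, b ∈ (σ (!i) h s).support)
    (hσ : ∀ h s, ∀ a ∈ (σ i h s).support, a ∈ G.allowed i s)
    {C D : ℕ → Set S} {P : ℕ → ℕ → Set S} {K : ℕ → S → Set (Act i)}
    (hC : ∀ k, ∀ s ∈ C k, s ∈ D k \ R ∧ ∀ h, ∀ b ∈ (u h s).support, ∀ a ∈ K k s,
      ∀ t ∈ (G.trans s (joint i a b)).support, t ∈ C k)
    (hK : ∀ k, ∀ s ∈ D k \ R, ∀ a ∈ G.allowed i s, a ∉ K k s → ∃ b ∈ G.allowed (!i) s,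
      ∃ t ∈ (G.trans s (joint i a b)).support, t ∉ D k)
    (hP0 : ∀ k, P k 0 = ∅)
    (hP : ∀ k n, ∀ s ∈ P k (n + 1), s ∈ C k ∨ (s ∈ D k \ R ∧ ∀ a ∈ K k s, ∃ b ∈ G.allowed (!i) s,
      ∃ t ∈ (G.trans s (joint i a b)).support, t ∈ P k n))
    (hD0 : D 0 = Set.univ) (hD : ∀ k, ∀ s ∉ D (k + 1), s ∉ D k ∨ ∃ n, s ∈ P k n) (k : ℕ) :
    ∀ h, ∀ s ∉ D k, 0 < G.safeForever σ Rᶜ h s := by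
  induction k with
  | zero => intro h s hs; exact absurd (hD0 ▸ Set.mem_univ s) hs
  | succ k ih =>
    -- Positive values propagate backwards through every allowed reply of the opponent, because the
    -- mixture plays all of them with positive probability.
    have hsucc : ∀ h, ∀ s ∈ D k \ R, ∀ a ∈ (σ i h s).support, ∀ b ∈ G.allowed (!i) s,
        ∀ t ∈ (G.trans s (joint i a b)).support, 0 < G.safeForever σ Rᶜ (h ++ [s]) t →
        0 < G.safeForever σ Rᶜ h s := by
      intro h s hs a ha b hb t ht hpos
      refine safeForever_pos_of_succ hs.2 (c := joint i a b) (fun j => ?_) ht hpos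
      by_cases hj : j = i
      · subst hj
        rwa [joint_self]
      · obtain rfl : j = !i := by revert hj; cases i <;> cases j <;> simp
        rw [joint_not]
        exact hτv h s b hb
    have hCpos : ∀ h, ∀ s ∈ C k, 0 < G.safeForever σ Rᶜ h s := by
      intro h s hs
      by_contra hcon
      -- If the value is zero, it is zero at all possible successors, and player `i` draws only
      -- actions in `K k`: another action could lead out of `D k`, where the value is positive by
      -- induction on `k`. So `u` keeps the play in `C k`, and finite products of the weights from
      -- index `h.length + 1` on are at least `w h.length`.
      have hall : ∀ n h, ∀ s ∈ C k, ¬ 0 < G.safeForever σ Rᶜ h s →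
          w h.length ≤ G.safe σ Rᶜ n h s := by
        intro n
        induction n with
        | zero =>
          intro h s hs _
          rw [safe_zero_of_mem (by simpa using (hC k s hs).1.2)]
          exact hw1 _
        | succ n ihn =>
          intro h s hs hz
          have hsD := (hC k s hs).1
          -- `w h.length` is the product of two copies of `w (h.length + 1)`: one is the chance of
          -- drawing `u` now, the other is the bound for the rest, whose past is longer by one
          -- state.
          rw [safe_succ_of_mem (by simpa using hsD.2), expect_step i, ← hw h.length]
          refine le_trans ?_ (mul_expect_le_expect (hτu h s) _)
          gcongr
          refine le_expect _ fun b hb => le_expect _ fun a ha => le_expect _ fun t ht => ?_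
          have haK : a ∈ K k s := by
            by_contra haK
            obtain ⟨b', hb', t', ht', htD⟩ := hK k s hsD a (hσ h s a ha) haK
            exact hz (hsucc h s hsD a ha b' hb' t' ht' (ih _ _ htD))
          have htC := (hC k s hs).2 h b hb a haK t ht
          have := ihn (h ++ [s]) t htC ?_
          · simpa using this
          · intro hpos
            refine hz (safeForever_pos_of_succ hsD.2 (c := joint i a b) (fun j => ?_) ht hpos)
            by_cases hj : j = i
            · subst hj
              rwa [joint_self]
            · obtain rfl : j = !i := by revert hj; cases i <;> cases j <;> simp
              rw [joint_not, PMF.mem_support_iff]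
              exact (lt_of_lt_of_le (ENNReal.mul_pos (hw0 _).ne' ((PMF.mem_support_iff _ _).1 hb))
                (hτu h s b)).ne'
      exact hcon (lt_of_lt_of_le (hw0 h.length) (le_iInf fun n => hall n h s hs hcon))
    -- Each layer leads to the previous one with positive probability, unless player `i` draws an
    -- action outside `K k`, which again allows leaving `D k`.
    have hPpos : ∀ n h, ∀ s ∈ P k n, 0 < G.safeForever σ Rᶜ h s := by
      intro n
      induction n with
      | zero => intro h s hs; rw [hP0] at hs; exact absurd hs (Set.notMem_empty s)
      | succ n ihn =>
        intro h s hs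
        rcases hP k n s hs with hsC | ⟨hsD, hsa⟩
        · exact hCpos h s hsC
        · obtain ⟨a, ha⟩ := (σ i h s).support_nonempty
          by_cases haK : a ∈ K k s
          · obtain ⟨b, hb, t, ht, htP⟩ := hsa a haK
            exact hsucc h s hsD a ha b hb t ht (ihn _ _ htP)
          · obtain ⟨b, hb, t, ht, htD⟩ := hK k s hsD a (hσ h s a ha) haK
            exact hsucc h s hsD a ha b hb t ht (ih _ _ htD)
    intro h s hs
    rcases hD k s hs with hsD | ⟨n, hn⟩
    · exact ih h s hsD
    · exact hPpos n h s hn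

end counting

end Game

end LossyGame

/-! ### Layers that do not depend on the choice of the absorbing version -/

namespace LossyGame

open MeasureTheory ProbabilityTheory

theorem IsUniformOn.mem_support {B : Type} {p : PMF B} {X : Set B} (h : IsUniformOn p X) {a : B} :
    a ∈ p.support ↔ a ∈ X := by
  obtain ⟨F, hF, rfl, rfl⟩ := h
  rw [PMF.mem_support_uniformOfFinset_iff]
  rfl

theorem IsUniformOn.eq {B : Type} {p q : PMF B} {X : Set B} (hp : IsUniformOn p X)
    (hq : IsUniformOn q X) : p = q := by
  obtain ⟨F, hF, rfl, rfl⟩ := hp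
  obtain ⟨F', hF', h, rfl⟩ := hq
  obtain rfl := Finset.coe_injective h
  rfl

namespace Game

variable {S : Type} {Act : Bool → Type} {G H : Game S Act} {i : Bool} {R : Set S}

/-- The allowed actions of player `k`, which player `i` has to choose such that all successors are
in `D`. -/
def restrictedActs (G : Game S Act) (i : Bool) (D : Set S) (k : Bool) (s : S) : Set (Act k) :=
  {a | a ∈ G.allowed k s ∧ (k = i → ∀ c : (l : Bool) → Act l, c k = a →
    (∀ l, l ≠ k → c l ∈ G.allowed l s) → ∀ t ∈ (G.trans s c).support, t ∈ D)}

theorem restrictedActs_self {D : Set S} {s : S} : G.restrictedActs i D i s = G.keep i D s := by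
  simp [restrictedActs, keep]

theorem restrictedActs_ne {D : Set S} {s : S} {k : Bool} (hk : k ≠ i) :
    G.restrictedActs i D k s = G.allowed k s := by
  simp [restrictedActs, hk]

theorem mem_keep_iff {D : Set S} {s : S} {a : Act i} :
    a ∈ G.keep i D s ↔ a ∈ G.allowed i s ∧ ∀ b ∈ G.allowed (!i) s,
      ∀ t ∈ (G.trans s (joint i a b)).support, t ∈ D := by
  refine and_congr_right fun _ => ⟨fun h b hb => h _ (joint_self ..) fun k hk => ?_,
    fun h c hc hall => ?_⟩
  · obtain rfl : k = !i := by revert hk; cases i <;> cases k <;> simp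
    rwa [joint_not]
  · rw [eq_joint hc rfl]
    exact h _ (hall _ (by simp))

/-- One round of the positive-probability reachability computation with target `T` for player
`j`, in the arena where player `i` has to stay in `D`; the states in `R` are left alone. -/
def layerStep (G : Game S Act) (i : Bool) (R D : Set S) (j : Bool) (T X : Set S) : Set S :=
  {s | s ∈ D ∧ (s ∈ T ∨ s ∉ R ∧
    ∀ c : (k : Bool) → Act k, (∀ k, k ≠ j → c k ∈ G.restrictedActs i D k s) →
      ∃ a ∈ G.restrictedActs i D j s,
        ∃ t ∈ (G.trans s (Function.update c j a)).support, t ∈ X)}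

theorem iterate_layerStep_succ {D T : Set S} {j : Bool} (n : ℕ) :
    (G.layerStep i R D j T)^[n + 1] ∅ = G.layerStep i R D j T ((G.layerStep i R D j T)^[n] ∅) :=
  Function.iterate_succ_apply' _ _ _

/-- The least fixed point of `layerStep`. -/
def layers (G : Game S Act) (i : Bool) (R D : Set S) (j : Bool) (T : Set S) : Set S :=
  ⋃ n, (G.layerStep i R D j T)^[n] ∅

theorem IsAbsorbingVersion.keep_eq (hH : H.IsAbsorbingVersion G R) {D : Set S} {s : S}
    (hs : s ∉ R) : H.keep i D s = G.keep i D s := by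
  simp only [keep, hH.allowed_eq, hH.trans_eq s hs]

theorem IsRound.allowed_eq_restrictedActs {A : Game S Act} {D : Set S} (h : IsRound H i A D)
    (hH : H.IsAbsorbingVersion G R) {s : S} (hs : s ∈ D) (hR : s ∉ R) (k : Bool) :
    A.allowed k s = G.restrictedActs i D k s := by
  by_cases hk : k = i
  · subst hk
    rw [h.allowed_eq s hs, hH.keep_eq hR, restrictedActs_self]
  · rw [h.allowed_ne k hk, hH.allowed_eq, restrictedActs_ne hk]

theorem disjoint_layers {D T : Set S} {j : Bool} (hT : Disjoint R T) :
    Disjoint R (G.layers i R D j T) := by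
  refine Set.disjoint_iUnion_right.2 fun n => Set.disjoint_left.2 fun s hs hsn => ?_
  cases n with
  | zero => exact hsn
  | succ n =>
    rw [iterate_layerStep_succ] at hsn
    rcases hsn.2 with h | h
    · exact Set.disjoint_left.1 hT hs h
    · exact h.1 hs

/-- Off `R` the games `H` and `G` have the same transitions. On `R` the transitions of `H` are
irrelevant: either `R` is part of the target, or `R` is absorbing and disjoint from the target, so
that no state of `R` is in the attractor. -/
theorem IsRound.attr_eq {A : Game S Act} {D T : Set S} {j : Bool} (h : IsRound H i A D)
    (hH : H.IsAbsorbingVersion G R) (hdom : G.dom = Set.univ) (hT : R ⊆ T ∨ Disjoint R T) (n : ℕ) :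
    A.attr j T n = (G.layerStep i R D j T)^[n] ∅ := by
  -- From an absorbing `R` no target outside of `R` can be reached; the arena's actions are among
  -- those of `H`, where `R` is absorbing.
  have hdisj : Disjoint R T → ∀ n, ∀ s ∈ R, s ∉ A.attr j T n := by
    intro hRT n
    induction n with
    | zero => exact fun s _ => Set.notMem_empty s
    | succ n ih =>
      rintro s hs ⟨hsA, hsT | hall⟩
      · exact Set.disjoint_left.1 hRT hs hsT
      · have hex : ∀ k, ∃ a, a ∈ A.allowed k s := fun k => h.proper.nonempty k s hsA
        choose c hc using hex
        obtain ⟨a, ha, t, ht, htn⟩ := hall c fun k _ => hc k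
        have hsub : ∀ k, A.allowed k s ⊆ H.allowed k s := by
          intro k
          by_cases hk : k = i
          · subst hk
            rw [h.allowed_eq s (h.dom_eq ▸ hsA)]
            exact fun a ha => ha.1
          · rw [h.allowed_ne k hk]
        refine ih t (hH.absorbing s ⟨?_, hs⟩ (Function.update c j a) (fun k => ?_) t
            (h.trans_eq ▸ ht)) htn
        · rw [hH.dom_eq, hdom]
          trivial
        by_cases hk : k = j
        · subst hk
          rw [Function.update_self]
          exact hsub _ ha
        · rw [Function.update_of_ne hk]
          exact hsub _ (hc k)
  induction n with
  | zero => rfl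
  | succ n ih =>
    rw [iterate_layerStep_succ, ← ih]
    ext s
    simp only [attr, layerStep, Set.mem_ofPred_eq, h.dom_eq]
    refine and_congr_right fun hs => ?_
    by_cases hR : s ∈ R
    · rcases hT with hT | hT
      · simp [hT hR]
      · have h1 : s ∉ T := Set.disjoint_left.1 hT hR
        have h2 := hdisj hT (n + 1) s hR
        simp only [attr, Set.mem_ofPred_eq, h.dom_eq, hs, true_and] at h2
        simp only [hR, h1, false_or, not_true_eq_false, false_and, iff_false]
        exact fun h3 => h2 (Or.inr h3)
    · simp only [h.allowed_eq_restrictedActs hH hs hR, h.trans_eq, hH.trans_eq s hR, hR,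
        not_false_eq_true, true_and]

/-- The component of `c` at the reaching player is overwritten, so only the opponent's action
matters; nonemptiness of the action type fills the overwritten component. -/
theorem mem_layerStep_self [Nonempty (Act i)] {D T X : Set S} {s : S} :
    s ∈ G.layerStep i R D i T X ↔ s ∈ D ∧ (s ∈ T ∨ s ∉ R ∧ ∀ b ∈ G.allowed (!i) s,
      ∃ a ∈ G.keep i D s, ∃ t ∈ (G.trans s (joint i a b)).support, t ∈ X) := by
  refine and_congr_right fun _ => or_congr_right (and_congr_right fun _ => ?_)
  rw [restrictedActs_self]
  constructor
  · intro h b hb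
    obtain ⟨a, ha, t, ht, htX⟩ := h (joint i (Classical.arbitrary _) b) fun k hk => by
      obtain rfl : k = !i := by revert hk; cases i <;> cases k <;> simp
      rw [joint_not, restrictedActs_ne hk]
      exact hb
    refine ⟨a, ha, t, ?_, htX⟩
    rwa [eq_joint (i := i) (a := a) (b := b) (c := Function.update _ i a)
      (Function.update_self ..) ((Function.update_of_ne (by simp) _ _).trans (joint_not ..))] at ht
  · intro h c hc
    have hb := hc (!i) (by simp)
    rw [restrictedActs_ne (by simp)] at hb
    obtain ⟨a, ha, t, ht, htX⟩ := h _ hb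
    refine ⟨a, ha, t, ?_, htX⟩
    rwa [eq_joint (i := i) (a := a) (b := c (!i)) (c := Function.update _ i a)
      (Function.update_self ..) (Function.update_of_ne (by simp) _ _)]

theorem mem_layerStep_not [Nonempty (Act (!i))] {D T X : Set S} {s : S} :
    s ∈ G.layerStep i R D (!i) T X ↔ s ∈ D ∧ (s ∈ T ∨ s ∉ R ∧ ∀ a ∈ G.keep i D s,
      ∃ b ∈ G.allowed (!i) s, ∃ t ∈ (G.trans s (joint i a b)).support, t ∈ X) := by
  refine and_congr_right fun _ => or_congr_right (and_congr_right fun _ => ?_)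
  rw [restrictedActs_ne (by simp)]
  constructor
  · intro h a ha
    obtain ⟨b, hb, t, ht, htX⟩ := h (joint i a (Classical.arbitrary _)) fun k hk => by
      obtain rfl : k = i := by revert hk; cases i <;> cases k <;> simp
      rw [joint_self, restrictedActs_self]
      exact ha
    refine ⟨b, hb, t, ?_, htX⟩
    rwa [eq_joint (i := i) (a := a) (b := b) (c := Function.update _ (!i) b)
      ((Function.update_of_ne (by simp) _ _).trans (joint_self ..)) (Function.update_self ..)] at ht
  · intro h c hc
    have ha := hc i (by simp)
    rw [restrictedActs_self] at ha
    obtain ⟨b, hb, t, ht, htX⟩ := h _ ha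
    refine ⟨b, hb, t, ?_, htX⟩
    rwa [eq_joint (i := i) (a := c i) (b := b) (c := Function.update _ (!i) b)
      (Function.update_of_ne (by simp) _ _) (Function.update_self ..)]

/-! ## The rounds of the algorithm, in terms of the original game -/

/-- The positive-probability winning region of a round. -/
def roundY (G : Game S Act) (i : Bool) (R D : Set S) : Set S := G.layers i R D i R

/-- The losing region of a round. -/
def roundC (G : Game S Act) (i : Bool) (R D : Set S) : Set S := D \ G.roundY i R D

/-- The states that remain after a round. -/
def roundD (G : Game S Act) (i : Bool) (R D : Set S) : Set S :=
  D \ G.layers i R D (!i) (G.roundC i R D)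

theorem inter_subset_layers {D T : Set S} {j : Bool} : D ∩ T ⊆ G.layers i R D j T :=
  fun _ hs => Set.mem_iUnion.2 ⟨1, hs.1, Or.inl hs.2⟩

theorem disjoint_roundC {D : Set S} : Disjoint R (G.roundC i R D) :=
  Set.disjoint_left.2 fun _ hR hC => hC.2 (inter_subset_layers ⟨hC.1, hR⟩)

theorem subset_roundD {D : Set S} (h : R ⊆ D) : R ⊆ G.roundD i R D := fun _ hR =>
  ⟨h hR, Set.disjoint_left.1 (disjoint_layers disjoint_roundC) hR⟩

theorem subset_iterate_roundD (k : ℕ) : R ⊆ (G.roundD i R)^[k] Set.univ := by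
  induction k with
  | zero => exact Set.subset_univ R
  | succ k ih =>
    rw [Function.iterate_succ_apply']
    exact subset_roundD ih

theorem roundD_subset {D : Set S} : G.roundD i R D ⊆ D := Set.sdiff_subset

theorem iterate_roundD_antitone : Antitone fun k => (G.roundD i R)^[k] Set.univ :=
  antitone_nat_of_succ_le fun k => by
    rw [Function.iterate_succ_apply']
    exact roundD_subset

/-- `C` is contained in its own layers, so if nothing is removed then `C` is empty. -/
theorem subset_roundY_of_eq {D : Set S} (h : G.roundD i R D = D) : D ⊆ G.roundY i R D := by
  intro s hs
  by_contra hY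
  have h1 : s ∈ G.roundD i R D := h.symm ▸ hs
  exact h1.2 (inter_subset_layers ⟨hs, hs, hY⟩)

section measure

variable [MeasurableSpace S] [DiscreteMeasurableSpace S] [Countable S]
variable [∀ i, Finite (Act i)] [∀ i, Nonempty (Act i)]

theorem IsAbsorbingVersion.proper (hH : H.IsAbsorbingVersion G R) (hG : G.Proper)
    (hdom : G.dom = Set.univ) : H.Proper := by
  refine ⟨fun s _ c _ t _ => ?_, fun k s _ => ?_⟩
  · rw [hH.dom_eq, hdom]
    trivial
  · rw [hH.allowed_eq]
    refine hG.nonempty k s ?_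
    rw [hdom]
    trivial

/-- Eliminates `H`, the measures and the nested arenas: what remains is an iteration defined by the
supports of the original game, which is what the computation evaluates. -/
theorem asD_eq_iterate_roundD (hG : G.Proper) (hdom : G.dom = Set.univ)
    (hH : H.IsAbsorbingVersion G R) (k : ℕ) :
    H.asD i R k = (G.roundD i R)^[k] Set.univ ∧
    H.asY i R k = G.roundY i R ((G.roundD i R)^[k] Set.univ) ∧
    H.asC i R k = G.roundC i R ((G.roundD i R)^[k] Set.univ) := by
  have hround := fun k => isRound_asArena (i := i) (R := R) (hH.proper hG hdom) k
  have hY : ∀ k, H.asY i R k = G.roundY i R (H.asD i R k) := by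
    intro k
    rw [(hround k).asD_succ_eq.1]
    simp only [attractor, (hround k).attr_eq hH hdom (Or.inl Set.Subset.rfl)]
    rfl
  have hC : ∀ k, H.asC i R k = G.roundC i R (H.asD i R k) := by
    intro k
    rw [(hround k).asD_succ_eq.2.1, hY]
    rfl
  have hD : ∀ k, H.asD i R (k + 1) = G.roundD i R (H.asD i R k) := by
    intro k
    rw [(hround k).asD_succ_eq.2.2, hC]
    simp only [attractor, (hround k).attr_eq hH hdom (Or.inr disjoint_roundC)]
    rfl
  have hit : H.asD i R k = (G.roundD i R)^[k] Set.univ := by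
    induction k with
    | zero => exact hH.dom_eq.trans hdom
    | succ k ih => rw [hD, ih, Function.iterate_succ_apply']
  exact ⟨hit, hit ▸ hY k, hit ▸ hC k⟩

/-- `C` is the complement of an attractor, so one reply is safe against all actions of player `i`
that stay in `D`. It depends on the state only, which makes the strategy `u` positional. -/
theorem exists_good_of_mem_asC (hH : H.Proper) {k : ℕ} {s : S} (hs : s ∈ H.asC i R k) :
    ∃ b ∈ H.allowed (!i) s, ∀ a ∈ H.keep i (H.asD i R k) s,
      ∀ t ∈ (H.trans s (joint i a b)).support, t ∈ H.asC i R k := by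
  have hr := isRound_asArena (i := i) (R := R) hH k
  obtain ⟨hY, hC, -⟩ := hr.asD_succ_eq
  rw [hC] at hs
  have hs' : s ∈ (H.asArena i R k).dom \ (H.asArena i R k).attractor i R := by
    rw [← hY, hr.dom_eq]
    exact hs
  obtain ⟨c, hc, hc'⟩ := exists_of_notMem_attractor hs'
  have hb := hc (!i) (by simp)
  rw [hr.allowed_ne _ (by simp)] at hb
  refine ⟨c (!i), hb, fun a ha t ht => ?_⟩
  rw [hC]
  refine ⟨ha.2 _ (joint_self ..) (fun l hl => ?_) t ht, ?_⟩
  · obtain rfl : l = !i := by revert hl; cases i <;> cases l <;> simp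
    rwa [joint_not]
  · rw [hY]
    refine hc' a (by rwa [hr.allowed_eq s hs.1]) t ?_
    rw [hr.trans_eq, eq_joint (i := i) (a := a) (b := c (!i)) (c := Function.update _ i a)
      (Function.update_self ..) (Function.update_of_ne (by simp) _ _)]
    exact ht

/-- `C` is disjoint from `R`, so the safe action for `H` is also safe for `G`. -/
theorem exists_good_of_mem_roundC (hG : G.Proper) (hdom : G.dom = Set.univ)
    (hH : H.IsAbsorbingVersion G R) {k : ℕ} {s : S}
    (hs : s ∈ G.roundC i R ((G.roundD i R)^[k] Set.univ)) :
    ∃ b ∈ G.allowed (!i) s, ∀ a ∈ G.keep i ((G.roundD i R)^[k] Set.univ) s,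
      ∀ t ∈ (G.trans s (joint i a b)).support,
        t ∈ G.roundC i R ((G.roundD i R)^[k] Set.univ) := by
  have hR : s ∉ R := fun hR => Set.disjoint_left.1 disjoint_roundC hR hs
  obtain ⟨hD, hY, hC⟩ := asD_eq_iterate_roundD (i := i) hG hdom hH k
  rw [← hC] at hs
  have := exists_good_of_mem_asC (hH.proper hG hdom) hs
  rwa [hH.allowed_eq, hH.trans_eq s hR, hD, hC, hH.keep_eq hR] at this

/-- In a fixed point of the algorithm, playing uniformly the actions that stay there is winning for
almost-sure reachability. -/
theorem wins_AS_eventually_of_uniform {F : Set S} {V : S → ℝ≥0∞} {ρ : ℝ≥0∞}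
    (hF : F.Finite) (hρ : ρ < 1) (hV : ∀ s ∉ F, 1 ≤ V s) (hVtop : ∀ s, V s ≠ ⊤)
    (hdrift : ∀ s ∉ F, ∀ c, expect (G.trans s c) V ≤ ρ * V s)
    (hdom : G.dom = Set.univ) {W : Set S}
    (hW : G.roundD i R W = W) {σ : Strat S (Act i)}
    (hunif : ∀ h, ∀ s ∈ W \ R, IsUniformOn (σ h s) (G.keep i W s)) {s : S} (hs : s ∈ W) :
    G.Wins i σ (AS (eventually R)) s := by
  intro σ' hσ'
  rw [AS_eventually_iff]
  -- On `W \ R` uniformity determines the distribution, so `σ []` describes it after every history.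
  refine safeForever_eq_zero (i := i) (W := W) (π := σ []) (B := G.allowed (!i))
    (U := fun n => (G.layerStep i R W i R)^[n] ∅) ?_ ?_ ?_ rfl ?_ (subset_roundY_of_eq hW)
    hF hρ hV hVtop hdrift [] hs
  · intro h s hs
    rw [Function.update_self]
    exact (hunif h s hs).eq (hunif [] s hs)
  · intro h s b hb
    rw [Function.update_of_ne (by simp)] at hb
    exact hσ' _ h s (hdom ▸ Set.mem_univ s) b hb
  · intro s hs a ha b hb t ht
    rw [(hunif [] s hs).mem_support, mem_keep_iff] at ha
    exact ha.2 b hb t ht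
  · intro n s hs
    rw [iterate_layerStep_succ, mem_layerStep_self] at hs
    refine or_iff_not_imp_left.2 fun hR b hb => ?_
    obtain ⟨a, ha, hat⟩ := (hs.2.resolve_left hR).2 b hb
    exact ⟨a, ((hunif [] s ⟨hs.1, hR⟩).mem_support).2 ha, hat⟩

/-- A mixture of a strategy that stays in the losing regions of the rounds, and of a strategy that
plays all actions, avoids `R` with positive probability, from all states that are removed in some
round. -/
theorem wins_NZ_always_of_counting {u τ : Strat S (Act (!i))} {w : ℕ → ℝ≥0∞}
    (hdom : G.dom = Set.univ)
    (hw1 : ∀ k, w k ≤ 1) (hw0 : ∀ k, 0 < w k) (hw : ∀ k, w (k + 1) * w (k + 1) = w k)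
    (hτu : ∀ h s b, w (h.length + 1) * u h s b ≤ τ h s b)
    (hτv : ∀ h s, ∀ b ∈ G.allowed (!i) s, b ∈ (τ h s).support)
    (hu : ∀ k h, ∀ s ∈ G.roundC i R ((G.roundD i R)^[k] Set.univ), ∀ b ∈ (u h s).support,
      ∀ a ∈ G.keep i ((G.roundD i R)^[k] Set.univ) s, ∀ t ∈ (G.trans s (joint i a b)).support,
        t ∈ G.roundC i R ((G.roundD i R)^[k] Set.univ))
    {k : ℕ} {s : S} (hs : s ∉ (G.roundD i R)^[k] Set.univ) :
    G.Wins (!i) τ (NZ (always Rᶜ)) s := by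
  intro σ' hσ'
  rw [NZ_always_iff]
  refine safeForever_pos_of_counting (i := i) (u := u) (w := w)
    (C := fun k => G.roundC i R ((G.roundD i R)^[k] Set.univ))
    (D := fun k => (G.roundD i R)^[k] Set.univ)
    (P := fun k n => (G.layerStep i R ((G.roundD i R)^[k] Set.univ) (!i)
      (G.roundC i R ((G.roundD i R)^[k] Set.univ)))^[n] ∅)
    (K := fun k => G.keep i ((G.roundD i R)^[k] Set.univ))
    hw1 hw0 hw ?_ ?_ ?_ ?_ ?_ (fun _ => rfl) ?_ rfl ?_ k [] s hs
  · rwa [Function.update_self]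
  · rwa [Function.update_self]
  · intro h s a ha
    rw [Function.update_of_ne (by simp)] at ha
    exact hσ' _ h s (hdom ▸ Set.mem_univ s) a ha
  · exact fun k s hs => ⟨⟨hs.1, fun hR => Set.disjoint_left.1 disjoint_roundC hR hs⟩,
      fun h b hb a ha t ht => hu k h s hs b hb a ha t ht⟩
  · intro k s hs a ha haK
    rw [mem_keep_iff] at haK
    push Not at haK
    exact haK ha
  · intro k n s hs
    rw [iterate_layerStep_succ, mem_layerStep_not] at hs
    rcases hs with ⟨h1, h2 | h2⟩
    · exact Or.inl h2
    · exact Or.inr ⟨⟨h1, h2.1⟩, h2.2⟩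
  · intro k s hs
    rw [Function.iterate_succ_apply'] at hs
    by_cases h1 : s ∈ (G.roundD i R)^[k] Set.univ
    · right
      by_contra hn
      push Not at hn
      exact hs ⟨h1, fun h2 => by
        obtain ⟨n, hn'⟩ := Set.mem_iUnion.1 h2
        exact hn n hn'⟩
    · exact Or.inl h1

end measure

end Game

end LossyGame

namespace LossyGame

open MeasureTheory ProbabilityTheory

/-! ## Message losses -/

section lossy

variable {M : Type} {p : ℝ≥0} {hp : p ≤ 1}

theorem coin_apply_true : coin p hp true = p := rfl

theorem coin_apply_false : coin p hp false = ((1 - p : ℝ≥0) : ℝ≥0∞) := by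
  simp [coin, PMF.ofFintype_apply]

theorem mem_support_coin (h0 : 0 < p) (h1 : p < 1) (b : Bool) : b ∈ (coin p hp).support := by
  rw [PMF.mem_support_iff]
  cases b
  · rw [coin_apply_false]
    exact_mod_cast (tsub_pos_of_lt h1).ne'
  · rw [coin_apply_true]
    exact_mod_cast h0.ne'

/-- For `0 < p < 1` every pattern of losses has positive probability. Qualitatively, losses thus are
the subword order, whatever the value of `p`. -/
theorem mem_support_lossy (h0 : 0 < p) (h1 : p < 1) {μ ν : List M} :
    ν ∈ (lossy p hp μ).support ↔ ν.Sublist μ := by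
  induction μ generalizing ν with
  | nil => simp [lossy]
  | cons m μ ih =>
    simp only [lossy, PMF.mem_support_bind_iff, mem_support_coin h0 h1, true_and,
      PMF.mem_support_map_iff, ih, Bool.exists_bool, List.sublist_cons_iff]
    constructor
    · rintro (⟨ν', h, rfl⟩ | ⟨ν', h, rfl⟩)
      · exact Or.inr ⟨ν', rfl, h⟩
      · exact Or.inl h
    · rintro (h | ⟨ν', rfl, h⟩)
      · exact Or.inr ⟨ν, h, rfl⟩
      · exact Or.inl ⟨ν', h, rfl⟩

theorem expect_coin (f : Bool → ℝ≥0∞) :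
    expect (coin p hp) f = ((1 - p : ℝ≥0) : ℝ≥0∞) * f false + p * f true := by
  rw [expect, tsum_bool, coin_apply_false, coin_apply_true]

/-- Each message survives with probability `1 - p`, and expectations add up. -/
theorem expect_lossy_length (μ : List M) :
    expect (lossy p hp μ) (fun ν => (ν.length : ℝ≥0∞)) =
      ((1 - p : ℝ≥0) : ℝ≥0∞) * (μ.length : ℝ≥0∞) := by
  induction μ with
  | nil => simp [lossy, expect_pure]
  | cons m μ ih =>
    have hsum : ((1 - p : ℝ≥0) : ℝ≥0∞) + (p : ℝ≥0∞) = 1 := by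
      exact_mod_cast tsub_add_cancel_of_le hp
    simp only [lossy, expect_bind, expect_map, expect_coin, if_true, List.length_cons,
      Nat.cast_add, Nat.cast_one, expect_add, expect_const, ih, Bool.false_eq_true, if_false]
    set q : ℝ≥0∞ := ((1 - p : ℝ≥0) : ℝ≥0∞)
    calc q * (q * ↑μ.length + 1) + ↑p * (q * ↑μ.length) = (q + p) * (q * ↑μ.length) + q := by ring
      _ = q * (↑μ.length + 1) := by rw [hsum]; ring

theorem length_apply_le [DecidableEq M] (o : ChanOp M) (μ : List M) :
    ((o.apply μ).getD μ).length ≤ μ.length + 1 := by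
  cases o with
  | nop => simp [ChanOp.apply]
  | send m => simp [ChanOp.apply]
  | recv m =>
    simp only [ChanOp.apply]
    split_ifs
    · simp; omega
    · simp

end lossy

namespace Arena

variable {A : Arena} {p : ℝ≥0} {hp : p ≤ 1}

theorem mem_support_game_trans (h0 : 0 < p) (h1 : p < 1) {s t : A.State} {c : (i : Bool) → A.Act i} :
    t ∈ ((A.game p hp).trans s c).support ↔ ∃ o ∈ (A.tab s.loc c).support, t.loc = o.1 ∧
      t.chan.Sublist ((o.2.apply s.chan).getD s.chan) := by
  simp only [game, PMF.mem_support_bind_iff, PMF.mem_support_map_iff, mem_support_lossy h0 h1]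
  refine exists_congr fun o => and_congr_right fun _ => ?_
  constructor
  · rintro ⟨μ, hμ, rfl⟩
    exact ⟨rfl, hμ⟩
  · rintro ⟨h2, h3⟩
    refine ⟨t.chan, h3, ?_⟩
    cases t
    simp_all

theorem expect_game_trans_length (s : A.State) (c : (i : Bool) → A.Act i) :
    expect ((A.game p hp).trans s c) (fun t => (t.chan.length : ℝ≥0∞)) ≤
      ((1 - p : ℝ≥0) : ℝ≥0∞) * ((s.chan.length : ℝ≥0∞) + 1) := by
  simp only [game, expect_bind, expect_map, expect_lossy_length]
  refine expect_le _ fun o _ => ?_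
  gcongr
  exact_mod_cast length_apply_le o.2 s.chan

/-- An operation adds at most one message, and losses multiply the expected length by `1 - p`. For
length `ℓ` the claim amounts to `1 - p ≤ p * ℓ / 2`, which holds as soon as `p * ℓ ≥ 2`. -/
theorem drift (h0 : 0 < p) {K : ℕ} (hK : 2 ≤ p * K) {s : A.State} (hs : K < s.chan.length)
    (c : (i : Bool) → A.Act i) :
    expect ((A.game p hp).trans s c) (fun t => (t.chan.length : ℝ≥0∞)) ≤
      ((1 - p / 2 : ℝ≥0) : ℝ≥0∞) * (s.chan.length : ℝ≥0∞) := by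
  refine (expect_game_trans_length s c).trans ?_
  have hp2 : p / 2 ≤ 1 := (half_le_self zero_le).trans hp
  have : (1 - p : ℝ≥0) * ((s.chan.length : ℝ≥0) + 1) ≤ (1 - p / 2) * (s.chan.length : ℝ≥0) := by
    rw [← NNReal.coe_le_coe]
    push_cast [NNReal.coe_sub hp, NNReal.coe_sub hp2]
    have h3 : (K : ℝ) ≤ s.chan.length := by exact_mod_cast hs.le
    have h4 : (2 : ℝ) ≤ p * K := by exact_mod_cast hK
    have h5 : (0 : ℝ) < p := by exact_mod_cast h0
    have h6 : (p : ℝ) * K ≤ p * s.chan.length := by gcongr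
    nlinarith
  exact_mod_cast this

theorem finite_setOf_length_le (A : Arena) (K : ℕ) : {s : A.State | s.chan.length ≤ K}.Finite := by
  have h1 : {μ : List (Fin A.numMsg) | μ.length ≤ K}.Finite := List.finite_length_le _ _
  have h2 : ((Set.univ : Set (Fin A.numLoc)) ×ˢ {μ : List (Fin A.numMsg) | μ.length ≤ K}).Finite :=
    Set.finite_univ.prod h1
  refine (h2.image fun x => (⟨x.1, x.2⟩ : A.State)).subset fun s hs => ?_
  exact ⟨(s.loc, s.chan), ⟨trivial, hs⟩, rfl⟩

theorem NonBlocking.nonempty_act (hA : A.NonBlocking) (i : Bool) : Nonempty (A.Act i) :=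
  (hA i ⟨A.init, []⟩).to_subtype.map Subtype.val

theorem NonBlocking.proper (hA : A.NonBlocking) : (A.game p hp).Proper :=
  ⟨fun _ _ _ _ _ _ => Set.mem_univ _, fun i s _ => hA i s⟩

/-! ## Counting strategies -/

theorem countWeight_pos (k : ℕ) : 0 < countWeight k := Real.rpow_pos_of_pos two_pos _

theorem countWeight_lt_one (k : ℕ) : countWeight k < 1 := by
  refine Real.rpow_lt_one_of_one_lt_of_neg one_lt_two ?_
  exact div_neg_of_neg_of_pos (by norm_num) (by positivity)

/-- The exponents double. This identity is what makes the products of all later weights stay away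
from zero. -/
theorem countWeight_mul_self (k : ℕ) :
    countWeight (k + 1) * countWeight (k + 1) = countWeight k := by
  rw [countWeight, countWeight, ← Real.rpow_add two_pos]
  congr 1
  rw [pow_succ]
  field_simp
  norm_num

/-- The weights of counting strategies, as nonnegative numbers. -/
noncomputable def countWeightNN (k : ℕ) : ℝ≥0 := ⟨countWeight k, (countWeight_pos k).le⟩

theorem coe_countWeightNN (k : ℕ) : (countWeightNN k : ℝ) = countWeight k := rfl

theorem countWeightNN_le_one (k : ℕ) : countWeightNN k ≤ 1 := (countWeight_lt_one k).le

theorem countWeightNN_pos (k : ℕ) : 0 < countWeightNN k := countWeight_pos k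

theorem countWeightNN_lt_one (k : ℕ) : countWeightNN k < 1 := countWeight_lt_one k

/-- The counting strategy defined by `u` and `v`. -/
noncomputable def countingMix {S B : Type} (u v : Strat S B) : Strat S B := fun h s =>
  (coin (countWeightNN (h.length + 1)) (countWeightNN_le_one _)).bind fun b =>
    if b then u h s else v h s

theorem countingMix_apply {S B : Type} (u v : Strat S B) (h : List S) (s : S) (b : B) :
    countingMix u v h s b = ((1 - countWeightNN (h.length + 1) : ℝ≥0) : ℝ≥0∞) * v h s b +
      countWeightNN (h.length + 1) * u h s b := by
  rw [countingMix, PMF.bind_apply, tsum_bool, coin_apply_false, coin_apply_true]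
  rfl

theorem isCountingMix_countingMix {i : Bool} (u v : Strat A.State (A.Act i)) :
    IsCountingMix (countingMix u v) u v := by
  intro h s a
  rw [countingMix_apply, ENNReal.toReal_add, ENNReal.toReal_mul, ENNReal.toReal_mul,
    ENNReal.coe_toReal, ENNReal.coe_toReal, NNReal.coe_sub (countWeightNN_le_one _)]
  · rw [coe_countWeightNN, NNReal.coe_one]
    ring
  · exact ENNReal.mul_ne_top ENNReal.coe_ne_top (PMF.apply_ne_top _ _)
  · exact ENNReal.mul_ne_top ENNReal.coe_ne_top (PMF.apply_ne_top _ _)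

theorem mem_support_countingMix {S B : Type} {u v : Strat S B} {h : List S} {s : S} {b : B} :
    b ∈ (countingMix u v h s).support ↔ b ∈ (u h s).support ∨ b ∈ (v h s).support := by
  rw [countingMix, PMF.mem_support_bind_iff]
  simp [mem_support_coin (countWeightNN_pos _) (countWeightNN_lt_one _), or_comm]

/-! ## The winning strategies -/

section main

variable {i : Bool} {R : Set A.State}

/-- The actions of the winning strategy for almost-sure reachability, where `W` is the winning
region. -/
def reachActs (G : Game A.State A.Act) (i : Bool) (R W : Set A.State) (s : A.State) :
    Set (A.Act i) :=
  {a | a ∈ G.allowed i s ∧ (s ∈ W → s ∉ R → a ∈ G.keep i W s)}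

/-- The actions that stay in the losing regions of the rounds of the algorithm. -/
def avoidActs (G : Game A.State A.Act) (i : Bool) (R : Set A.State) (s : A.State) :
    Set (A.Act (!i)) :=
  {b | b ∈ G.allowed (!i) s ∧ ∀ k, s ∈ G.roundC i R ((G.roundD i R)^[k] Set.univ) →
    ∀ a ∈ G.keep i ((G.roundD i R)^[k] Set.univ) s, ∀ t ∈ (G.trans s (Game.joint i a b)).support,
      t ∈ G.roundC i R ((G.roundD i R)^[k] Set.univ)}

/-- `C j` is removed when the next `D` is formed, so the losing regions are disjoint and a single
positional strategy can serve all of them. -/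
theorem index_eq_of_mem_roundC {G : Game A.State A.Act} {j k : ℕ} {s : A.State}
    (hj : s ∈ G.roundC i R ((G.roundD i R)^[j] Set.univ))
    (hk : s ∈ G.roundC i R ((G.roundD i R)^[k] Set.univ)) : j = k := by
  have key : ∀ j k, j < k → s ∈ G.roundC i R ((G.roundD i R)^[j] Set.univ) →
      s ∉ G.roundC i R ((G.roundD i R)^[k] Set.univ) := by
    intro j k hjk hj hk
    have h1 := Game.iterate_roundD_antitone (G := G) (i := i) (R := R) (Nat.succ_le_of_lt hjk) hk.1
    simp only [Nat.succ_eq_add_one, Function.iterate_succ_apply'] at h1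
    exact h1.2 (Game.inter_subset_layers ⟨hj.1, hj⟩)
  rcases lt_trichotomy j k with h | h | h
  · exact absurd hk (key j k h hj)
  · exact h
  · exact absurd hj (key k j h hk)

variable (hA : A.NonBlocking) (h0 : 0 < p) (h1 : p < 1) {H : Game A.State A.Act}

include hA

/-- At a fixed point every state of `W \ R` lies in some layer, and its layer provides a staying
action in answer to any allowed reply. -/
theorem reachActs_nonempty {k : ℕ} (hk : ((A.game p hp).roundD i R)^[k] Set.univ =
      ((A.game p hp).roundD i R)^[k + 1] Set.univ) (s : A.State) :
    (reachActs (A.game p hp) i R (((A.game p hp).roundD i R)^[k] Set.univ) s).Nonempty := by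
  have := fun i => hA.nonempty_act i
  by_cases hs : s ∈ ((A.game p hp).roundD i R)^[k] Set.univ \ R
  · rw [Function.iterate_succ_apply'] at hk
    have h1 := Game.subset_roundY_of_eq hk.symm hs.1
    obtain ⟨n, hn⟩ := Set.mem_iUnion.1 h1
    cases n with
    | zero => exact absurd hn (Set.notMem_empty s)
    | succ n =>
      rw [Game.iterate_layerStep_succ, Game.mem_layerStep_self] at hn
      obtain ⟨b, hb⟩ := hA (!i) s
      obtain ⟨a, ha, -⟩ := (hn.2.resolve_left hs.2).2 b hb
      exact ⟨a, ha.1, fun _ _ => ha⟩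
  · obtain ⟨a, ha⟩ := hA i s
    exact ⟨a, ha, fun h1 h2 => absurd ⟨h1, h2⟩ hs⟩

theorem avoidActs_nonempty (hH : H.IsAbsorbingVersion (A.game p hp) R) (s : A.State) :
    (avoidActs (A.game p hp) i R s).Nonempty := by
  have := fun i => hA.nonempty_act i
  by_cases hs : ∃ k, s ∈ (A.game p hp).roundC i R (((A.game p hp).roundD i R)^[k] Set.univ)
  · obtain ⟨k, hk⟩ := hs
    obtain ⟨b, hb, hb'⟩ := Game.exists_good_of_mem_roundC hA.proper rfl hH hk
    refine ⟨b, hb, fun j hj => ?_⟩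
    obtain rfl := index_eq_of_mem_roundC hj hk
    exact hb'
  · push Not at hs
    obtain ⟨b, hb⟩ := hA (!i) s
    exact ⟨b, hb, fun k hk => absurd hk (hs k)⟩

/-- On `R` every allowed action stays in `W` for `H`, since `R` is absorbing there and contained in
`W`. In `G` this may fail, which is why `reachActs` demands nothing on `R`. -/
theorem stay_eq_reachActs (hH : H.IsAbsorbingVersion (A.game p hp) R) {W : Set A.State}
    (hRW : R ⊆ W) {s : A.State} (hs : s ∈ W) :
    H.stay i W s = reachActs (A.game p hp) i R W s := by
  have := fun i => hA.nonempty_act i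
  have hdom : s ∈ H.dom := by rw [hH.dom_eq]; trivial
  rw [Game.stay_eq_keep (hH.proper hA.proper rfl) i W hdom]
  by_cases hR : s ∈ R
  · ext a
    simp only [reachActs, hs, hR, not_true_eq_false, false_implies, and_true, true_implies,
      Set.mem_ofPred_eq]
    rw [← hH.allowed_eq]
    refine ⟨fun h => h.1, fun h => ⟨h, fun c hc hall t ht => hRW ?_⟩⟩
    refine hH.absorbing s ⟨hdom, hR⟩ c (fun k => ?_) t ht
    by_cases hk : k = i
    · subst hk
      exact hc ▸ h
    · exact hall k hk
  · rw [hH.keep_eq hR]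
    ext a
    simp only [reachActs, hs, hR, not_false_eq_true, true_implies, Set.mem_ofPred_eq]
    exact ⟨fun h => ⟨h.1, h⟩, fun h => h.2⟩

include h0 h1

theorem wins_AS_eventually (hH : H.IsAbsorbingVersion (A.game p hp) R) {k : ℕ}
    (hk : ((A.game p hp).roundD i R)^[k] Set.univ = ((A.game p hp).roundD i R)^[k + 1] Set.univ)
    {σ : Strat A.State (A.Act i)}
    (hunif : ∀ h, ∀ s ∈ ((A.game p hp).roundD i R)^[k] Set.univ,
      IsUniformOn (σ h s) (H.stay i (((A.game p hp).roundD i R)^[k] Set.univ) s)) {s : A.State}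
    (hs : s ∈ ((A.game p hp).roundD i R)^[k] Set.univ) :
    (A.game p hp).Wins i σ (AS (eventually R)) s := by
  have := fun i => hA.nonempty_act i
  -- The Lyapunov function is the channel length; this bound is what the drift estimate requires
  -- outside of the finite set.
  obtain ⟨K, hK⟩ : ∃ K : ℕ, 2 ≤ p * K := by
    obtain ⟨K, hK⟩ := exists_nat_ge (2 / p)
    refine ⟨K, ?_⟩
    rwa [div_le_iff₀ h0, mul_comm] at hK
  have hRk := Game.subset_iterate_roundD (G := A.game p hp) (i := i) (R := R) k
  rw [Function.iterate_succ_apply'] at hk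
  refine Game.wins_AS_eventually_of_uniform (F := {s : A.State | s.chan.length ≤ K})
    (V := fun s => (s.chan.length : ℝ≥0∞)) (ρ := ((1 - p / 2 : ℝ≥0) : ℝ≥0∞))
    (finite_setOf_length_le A K) ?_ ?_ (fun s => ENNReal.natCast_ne_top _) ?_ rfl hk.symm ?_ hs
  · have : (1 - p / 2 : ℝ≥0) < 1 := tsub_lt_self one_pos (half_pos h0)
    exact_mod_cast this
  · intro s hs
    have : 1 ≤ s.chan.length := by
      simp only [Set.mem_ofPred_eq, not_le] at hs
      omega
    exact_mod_cast this
  · intro s hs c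
    exact drift h0 hK (not_le.1 hs) c
  · intro h s hs
    have := hunif h s hs.1
    rw [stay_eq_reachActs hA hH hRk hs.1] at this
    convert this using 1
    ext a
    simp only [reachActs, hs.1, hs.2, not_false_eq_true, true_implies, Set.mem_ofPred_eq]
    exact ⟨fun h => ⟨h.1, h⟩, fun h => h.2⟩

omit h0 h1 in
theorem wins_NZ_always {u v : Strat A.State (A.Act (!i))}
    (hu : ∀ h s, (u h s).support ⊆ avoidActs (A.game p hp) i R s)
    (hv : ∀ h s, (A.game p hp).allowed (!i) s ⊆ (v h s).support) {k : ℕ} {s : A.State}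
    (hs : s ∉ ((A.game p hp).roundD i R)^[k] Set.univ) :
    (A.game p hp).Wins (!i) (countingMix u v) (NZ (always Rᶜ)) s := by
  have := fun i => hA.nonempty_act i
  refine Game.wins_NZ_always_of_counting (u := u) (w := fun k => (countWeightNN k : ℝ≥0∞)) rfl
    ?_ ?_ ?_ ?_ ?_ ?_ hs
  · exact fun k => by exact_mod_cast countWeightNN_le_one k
  · exact fun k => by exact_mod_cast countWeightNN_pos k
  · intro k
    have : countWeightNN (k + 1) * countWeightNN (k + 1) = countWeightNN k :=
      NNReal.eq (countWeight_mul_self k)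
    exact_mod_cast this
  · intro h s b
    rw [countingMix_apply]
    exact le_add_self
  · exact fun h s b hb => mem_support_countingMix.2 (Or.inr (hv h s hb))
  · exact fun k h s hs b hb => (hu h s hb).2 k hs

/-- Both strategies are winning, and they cannot coexist in one state: the probability of never
reaching `R` would be zero and positive. So the fixed point is exactly the winning region. -/
theorem iterate_roundD_eq_winRegion (hH : H.IsAbsorbingVersion (A.game p hp) R) {k : ℕ}
    (hk : ((A.game p hp).roundD i R)^[k] Set.univ = ((A.game p hp).roundD i R)^[k + 1] Set.univ) :
    ((A.game p hp).roundD i R)^[k] Set.univ =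
      (A.game p hp).winRegion i (AS (eventually R)) := by
  have := fun i => hA.nonempty_act i
  have hRk := Game.subset_iterate_roundD (G := A.game p hp) (i := i) (R := R) k
  ext s
  constructor
  · intro hs
    refine ⟨trivial, fun _ s => unif (reachActs (A.game p hp) i R
      (((A.game p hp).roundD i R)^[k] Set.univ) s), ?_, ?_⟩
    · intro h s _ a ha
      exact ((mem_support_unif (reachActs_nonempty hA hk s)).1 ha).1
    · refine wins_AS_eventually hA h0 h1 hH hk (fun h s hs => ?_) hs
      rw [stay_eq_reachActs hA hH hRk hs]
      exact isUniformOn_unif (reachActs_nonempty hA hk s)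
  · rintro ⟨_, σ, hσ, hwin⟩
    by_contra hs
    have hτ := wins_NZ_always hA (i := i) (R := R)
      (u := fun _ s => unif (avoidActs (A.game p hp) i R s))
      (v := fun _ s => unif ((A.game p hp).allowed (!i) s))
      (fun h s b hb => (mem_support_unif (avoidActs_nonempty hA hH s)).1 hb)
      (fun h s b hb => (mem_support_unif (hA (!i) s)).2 hb) hs
    have hstrat : (A.game p hp).IsStrategy (!i)
        (countingMix (fun _ s => unif (avoidActs (A.game p hp) i R s))
          (fun _ s => unif ((A.game p hp).allowed (!i) s))) := by
      intro h s _ b hb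
      rcases mem_support_countingMix.1 hb with h | h
      · exact ((mem_support_unif (avoidActs_nonempty hA hH s)).1 h).1
      · exact (mem_support_unif (hA (!i) s)).1 h
    have hij : i ≠ !i := by simp
    obtain ⟨ρ, hρ, hρi, hρj⟩ := Game.isProfile_of_ne hij hσ hstrat hA.proper
    have h2 := hτ ρ hρ
    have h3 := hwin ρ hρ
    rw [← hρj, Function.update_eq_self, Game.NZ_always_iff] at h2
    rw [← hρi, Function.update_eq_self, Game.AS_eventually_iff] at h3
    exact h2.ne' h3

end main

end Arena

end LossyGame

namespace LossyGame

/-! ## Runs of automata given by codes -/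

namespace AutCode

/-- The states that are reached from the states in `Q` by reading the letter `x`. -/
def nstep (e : AutCode) (Q : List ℕ) (x : ℕ ⊕ ℕ) : List ℕ :=
  (e.1.filter fun t => t.2.1 = x ∧ t.1 ∈ Q).map fun t => t.2.2

/-- The states that are reached from the states in `Q` by reading a word. -/
def runFrom (e : AutCode) (Q : List ℕ) (w : List (ℕ ⊕ ℕ)) : List ℕ := w.foldl (nstep e) Q

/-- The states that are reached by reading a word. -/
def run (e : AutCode) (w : List (ℕ ⊕ ℕ)) : List ℕ := runFrom e e.2.1 w

/-- The word of a location and a channel content. -/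
def confWord (s : ℕ × List ℕ) : List (ℕ ⊕ ℕ) := Sum.inl s.1 :: s.2.map Sum.inr

/-- The configuration `s` is accepted by `e`. -/
def Mem (e : AutCode) (s : ℕ × List ℕ) : Prop := ∃ q ∈ run e (confWord s), q ∈ e.2.2

/-- There is a run from `q` to `q'`. -/
def Path (e : AutCode) : ℕ → List (ℕ ⊕ ℕ) → ℕ → Prop
  | q, [], q' => q' = q
  | q, x :: w, q' => ∃ r, (q, x, r) ∈ e.1 ∧ Path e r w q'

theorem mem_nstep {e : AutCode} {Q : List ℕ} {x : ℕ ⊕ ℕ} {r : ℕ} :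
    r ∈ nstep e Q x ↔ ∃ q ∈ Q, (q, x, r) ∈ e.1 := by
  simp only [nstep, List.mem_map, List.mem_filter, decide_eq_true_eq]
  constructor
  · rintro ⟨⟨q, y, r'⟩, ⟨h1, rfl, h2⟩, rfl⟩
    exact ⟨q, h2, h1⟩
  · rintro ⟨q, h1, h2⟩
    exact ⟨(q, x, r), ⟨h2, rfl, h1⟩, rfl⟩

theorem mem_runFrom {e : AutCode} {Q : List ℕ} {w : List (ℕ ⊕ ℕ)} {q' : ℕ} :
    q' ∈ runFrom e Q w ↔ ∃ q ∈ Q, Path e q w q' := by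
  induction w generalizing Q with
  | nil => simp [runFrom, Path]
  | cons x w ih =>
    change q' ∈ runFrom e (nstep e Q x) w ↔ _
    rw [ih]
    simp only [mem_nstep, Path]
    constructor
    · rintro ⟨r, ⟨q, hq, h1⟩, h2⟩
      exact ⟨q, hq, r, h1, h2⟩
    · rintro ⟨q, hq, r, h1, h2⟩
      exact ⟨r, ⟨q, hq, h1⟩, h2⟩

theorem runFrom_append (e : AutCode) (Q : List ℕ) (v w : List (ℕ ⊕ ℕ)) :
    runFrom e Q (v ++ w) = runFrom e (runFrom e Q v) w := List.foldl_append ..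

/-- Runs are lists, not sets, but after a nonempty word the run lists the targets of a sublist of
the fixed transition list. -/
theorem finite_range_run (e : AutCode) : (Set.range (run e)).Finite := by
  have h : (Set.range (run e)) ⊆ insert e.2.1
      ((fun l : List (ℕ × (ℕ ⊕ ℕ) × ℕ) => l.map fun t => t.2.2) '' {l | l ∈ e.1.sublists}) := by
    rintro _ ⟨w, rfl⟩
    induction w using List.reverseRecOn with
    | nil => exact Or.inl rfl
    | append_singleton w x _ =>
      right
      rw [run, runFrom_append]
      exact ⟨_, List.mem_sublists.2 List.filter_sublist, rfl⟩
  exact ((((List.finite_toSet e.1.sublists)).image _).insert _).subset h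

theorem mem_iff {e : AutCode} {s : ℕ × List ℕ} :
    Mem e s ↔ ∃ q ∈ e.2.1, ∃ q' ∈ e.2.2, Path e q (confWord s) q' := by
  simp only [Mem, run, mem_runFrom]
  constructor
  · rintro ⟨q', ⟨q, hq, h⟩, hq'⟩
    exact ⟨q, hq, q', hq', h⟩
  · rintro ⟨q, hq, q', hq', h⟩
    exact ⟨q', ⟨q, hq, h⟩, hq'⟩

theorem mem_nfa_evalFrom {e : AutCode} {Q : Set ℕ} {w : List (ℕ ⊕ ℕ)} {q' : ℕ} :
    q' ∈ e.nfa.evalFrom Q w ↔ ∃ q ∈ Q, Path e q w q' := by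
  induction w generalizing Q with
  | nil => simp [Path]
  | cons x w ih =>
    rw [NFA.evalFrom_cons, ih]
    simp only [NFA.mem_stepSet, Path]
    constructor
    · rintro ⟨r, ⟨q, hq, h1⟩, h2⟩
      exact ⟨q, hq, r, h1, h2⟩
    · rintro ⟨q, hq, r, h1, h2⟩
      exact ⟨r, ⟨q, hq, h1⟩, h2⟩

theorem mem_accepts_nfa {e : AutCode} {w : List (ℕ ⊕ ℕ)} :
    w ∈ e.nfa.accepts ↔ ∃ q ∈ e.2.1, ∃ q' ∈ e.2.2, Path e q w q' := by
  rw [NFA.mem_accepts]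
  constructor
  · rintro ⟨q', hq', h⟩
    obtain ⟨q, hq, h⟩ := mem_nfa_evalFrom.1 h
    exact ⟨q, hq, q', hq', h⟩
  · rintro ⟨q, hq, q', hq', h⟩
    exact ⟨q', hq', mem_nfa_evalFrom.2 ⟨q, hq, h⟩⟩

theorem mem_iff_mem_accepts {e : AutCode} {s : ℕ × List ℕ} :
    Mem e s ↔ confWord s ∈ e.nfa.accepts := by
  rw [mem_iff, mem_accepts_nfa]

/-! ### Upward closures -/

/-- The states that can be reached at all. -/
def targets (e : AutCode) : List ℕ := e.2.1 ++ e.1.map fun t => t.2.2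

/-- The loops that allow an automaton to skip messages. -/
def loops (n : ℕ) (e : AutCode) : List (ℕ × (ℕ ⊕ ℕ) × ℕ) :=
  (List.range n).flatMap fun m => (targets e).map fun q => (q, Sum.inr m, q)

/-- An automaton that may skip messages, and thus accepts the upward closure of the original
set of configurations. -/
def up (n : ℕ) (e : AutCode) : AutCode := (e.1 ++ loops n e, e.2.1, e.2.2)

theorem mem_up_trans {n : ℕ} {e : AutCode} {q r : ℕ} {x : ℕ ⊕ ℕ} :
    (q, x, r) ∈ (up n e).1 ↔ (q, x, r) ∈ e.1 ∨ ∃ m < n, x = Sum.inr m ∧ r = q ∧ q ∈ targets e := by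
  simp only [up, loops, List.mem_append, List.mem_flatMap, List.mem_range, List.mem_map,
    Prod.mk.injEq]
  refine or_congr_right ?_
  constructor
  · rintro ⟨m, hm, q', hq', rfl, rfl, rfl⟩
    exact ⟨m, hm, rfl, rfl, hq'⟩
  · rintro ⟨m, hm, rfl, rfl, hq⟩
    exact ⟨m, hm, _, hq, rfl, rfl, rfl⟩

theorem target_mem_targets {e : AutCode} {q r : ℕ} {x : ℕ ⊕ ℕ} (h : (q, x, r) ∈ e.1) :
    r ∈ targets e :=
  List.mem_append_right _ (List.mem_map.2 ⟨_, h, rfl⟩)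

/-- A loop reads a message that the original word does not have. Loops exist only at initial states
and targets of transitions, and a run never leaves these states. -/
theorem path_up_iff {n : ℕ} {e : AutCode} {μ : List ℕ} (hμ : ∀ m ∈ μ, m < n) {q q' : ℕ}
    (hq : q ∈ targets e) :
    Path (up n e) q (μ.map Sum.inr) q' ↔ ∃ ν : List ℕ, ν.Sublist μ ∧ Path e q (ν.map Sum.inr) q' := by
  induction μ generalizing q with
  | nil => simp [Path]
  | cons m μ ih =>
    have hμ' : ∀ m ∈ μ, m < n := fun m hm => hμ m (List.mem_cons_of_mem _ hm)
    simp only [List.map_cons, Path, mem_up_trans]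
    constructor
    · rintro ⟨r, h1 | ⟨m', hm', -, rfl, -⟩, h2⟩
      · obtain ⟨ν, hν, h3⟩ := (ih hμ' (target_mem_targets h1)).1 h2
        exact ⟨m :: ν, hν.cons_cons m, r, h1, h3⟩
      · obtain ⟨ν, hν, h3⟩ := (ih hμ' hq).1 h2
        exact ⟨ν, hν.cons m, h3⟩
    · rintro ⟨ν, hν, h⟩
      rcases List.sublist_cons_iff.1 hν with hν | ⟨ν', rfl, hν'⟩
      · exact ⟨q, Or.inr ⟨m, hμ m List.mem_cons_self, rfl, rfl, hq⟩, (ih hμ' hq).2 ⟨ν, hν, h⟩⟩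
      · obtain ⟨r, h1, h2⟩ := h
        exact ⟨r, Or.inl h1, (ih hμ' (target_mem_targets h1)).2 ⟨ν', hν', h2⟩⟩

theorem mem_up_iff {n : ℕ} {e : AutCode} {l : ℕ} {μ : List ℕ} (hμ : ∀ m ∈ μ, m < n) :
    Mem (up n e) (l, μ) ↔ ∃ ν : List ℕ, ν.Sublist μ ∧ Mem e (l, ν) := by
  simp only [mem_iff, confWord, Path, mem_up_trans]
  constructor
  · rintro ⟨q, hq, q', hq', r, h1 | ⟨m, -, h, -⟩, h2⟩
    · obtain ⟨ν, hν, h3⟩ := (path_up_iff hμ (target_mem_targets h1)).1 h2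
      exact ⟨ν, hν, q, hq, q', hq', r, h1, h3⟩
    · cases h
  · rintro ⟨ν, hν, q, hq, q', hq', r, h1, h3⟩
    exact ⟨q, hq, q', hq', r, Or.inl h1, (path_up_iff hμ (target_mem_targets h1)).2 ⟨ν, hν, h3⟩⟩

/-! ### A finite index congruence -/

/-- The runs of automata on a channel content, after some prefixes. -/
def runs (ps : List (AutCode × List (ℕ ⊕ ℕ))) (μ : List ℕ) : List (List ℕ) :=
  ps.map fun ep => run ep.1 (ep.2 ++ μ.map Sum.inr)

/-- A finite amount of information about a channel content. -/
def feat (ps : List (AutCode × List (ℕ ⊕ ℕ))) (μ : List ℕ) :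
    Option ℕ × List (List ℕ) × List (List ℕ) :=
  (μ.getLast?, runs ps μ, runs ps μ.dropLast)

theorem finite_range_runs (ps : List (AutCode × List (ℕ ⊕ ℕ))) : (Set.range (runs ps)).Finite := by
  induction ps with
  | nil => exact (Set.finite_singleton []).subset (by rintro _ ⟨μ, rfl⟩; rfl)
  | cons ep ps ih =>
    refine ((Set.Finite.image2 List.cons (finite_range_run ep.1) ih)).subset ?_
    rintro _ ⟨μ, rfl⟩
    exact ⟨_, ⟨_, rfl⟩, _, ⟨μ, rfl⟩, rfl⟩

theorem runs_eq_iff {ps : List (AutCode × List (ℕ ⊕ ℕ))} {μ μ' : List ℕ} :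
    runs ps μ = runs ps μ' ↔ ∀ ep ∈ ps,
      run ep.1 (ep.2 ++ μ.map Sum.inr) = run ep.1 (ep.2 ++ μ'.map Sum.inr) :=
  List.map_inj_left

theorem runs_append {ps : List (AutCode × List (ℕ ⊕ ℕ))} {μ μ' : List ℕ}
    (h : runs ps μ = runs ps μ') (m : ℕ) : runs ps (μ ++ [m]) = runs ps (μ' ++ [m]) := by
  rw [runs_eq_iff] at h ⊢
  intro ep hep
  have := h ep hep
  simp only [run, List.map_append, ← List.append_assoc, runFrom_append] at this ⊢
  rw [this]

/-- After appending `m`, the last letter is `m` and the runs without the last letter are the former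
runs. Recording the runs of `dropLast`, as needed for dequeuing, therefore still gives a right
congruence. -/
theorem feat_append {ps : List (AutCode × List (ℕ ⊕ ℕ))} {μ μ' : List ℕ}
    (h : feat ps μ = feat ps μ') (m : ℕ) : feat ps (μ ++ [m]) = feat ps (μ' ++ [m]) := by
  simp only [feat, Prod.mk.injEq] at h ⊢
  simp only [List.getLast?_append, List.getLast?_singleton, List.dropLast_concat]
  exact ⟨rfl, runs_append h.2.1 m, h.2.1⟩

theorem finite_image_feat (ps : List (AutCode × List (ℕ ⊕ ℕ))) (n : ℕ) :
    (feat ps '' {μ | ∀ m ∈ μ, m < n}).Finite := by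
  have h1 : (insert none (some '' Set.Iio n) : Set (Option ℕ)).Finite :=
    ((Set.finite_Iio n).image _).insert _
  refine (h1.prod ((finite_range_runs ps).prod (finite_range_runs ps))).subset ?_
  rintro _ ⟨μ, hμ, rfl⟩
  refine ⟨?_, ⟨μ, rfl⟩, ⟨_, rfl⟩⟩
  rcases h : μ.getLast? with _ | m
  · exact Or.inl h
  · exact Or.inr ⟨m, hμ m (List.mem_of_getLast? h), h.symm⟩

end AutCode

/-! ## Regular languages and codes -/

section regular

variable {n k : ℕ}

/-- A set of configurations is regular if membership only depends on a right congruence of finite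
index on channel contents. -/
theorem isRegular_of_congruence {κ : Type} {Z : Fin n → List (Fin k) → Prop}
    {f : List (Fin k) → κ} (hfin : (Set.range f).Finite)
    (hcong : ∀ μ μ' m, f μ = f μ' → f (μ ++ [m]) = f (μ' ++ [m]))
    (hZ : ∀ l μ μ', f μ = f μ' → (Z l μ ↔ Z l μ')) :
    Language.IsRegular ({w | ∃ l μ, Z l μ ∧ w = Sum.inl l :: μ.map Sum.inr} :
      Language (Fin n ⊕ Fin k)) := by
  set L : Language (Fin n ⊕ Fin k) := {w | ∃ l μ, Z l μ ∧ w = Sum.inl l :: μ.map Sum.inr} with hL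
  have hmem : ∀ w, w ∈ L ↔ ∃ l μ, Z l μ ∧ w = Sum.inl l :: μ.map Sum.inr := fun w => Iff.rfl
  have hcong' : ∀ ν μ μ', f μ = f μ' → f (μ ++ ν) = f (μ' ++ ν) := by
    intro ν
    induction ν with
    | nil => intro μ μ' h; simpa using h
    | cons m ν ih =>
      intro μ μ' h
      have := ih _ _ (hcong μ μ' m h)
      simpa using this
  refine Language.IsRegular.of_finite_range_leftQuotient ?_
  have hword : ∀ l (μ : List (Fin k)) w, (Sum.inl l :: μ.map Sum.inr) ++ w ∈ L ↔
      ∃ ν : List (Fin k), w = ν.map Sum.inr ∧ Z l (μ ++ ν) := by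
    intro l μ w
    rw [hmem]
    constructor
    · rintro ⟨l', μ', hz, heq⟩
      simp only [List.cons_append, List.cons.injEq, Sum.inl.injEq] at heq
      obtain ⟨rfl, heq⟩ := heq
      obtain ⟨μ₁, ν, rfl, h1, h2⟩ := List.append_eq_map_iff.1 heq
      rw [List.map_injective_iff.2 Sum.inr_injective h1] at hz
      exact ⟨ν, h2.symm, hz⟩
    · rintro ⟨ν, rfl, hz⟩
      exact ⟨l, μ ++ ν, hz, by simp⟩
  have hfact : (Set.range fun x : Fin n × List (Fin k) =>
      L.leftQuotient (Sum.inl x.1 :: x.2.map Sum.inr)).Finite := by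
    have hfin2 : (Set.range fun x : Fin n × List (Fin k) => (x.1, f x.2)).Finite := by
      refine ((Set.finite_univ (α := Fin n)).prod hfin).subset ?_
      rintro _ ⟨x, rfl⟩
      exact ⟨trivial, ⟨x.2, rfl⟩⟩
    -- A left quotient by a location and a channel content depends only on the location and the
    -- class of the content.
    have hft : Function.FactorsThrough (fun x : Fin n × List (Fin k) =>
        L.leftQuotient (Sum.inl x.1 :: x.2.map Sum.inr)) (fun x => (x.1, f x.2)) := by
      rintro ⟨l, μ⟩ ⟨l', μ'⟩ h
      simp only [Prod.mk.injEq] at h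
      obtain ⟨rfl, h⟩ := h
      ext w
      simp only [Language.mem_leftQuotient, hword]
      exact exists_congr fun ν => and_congr_right fun _ => hZ l _ _ (hcong' ν _ _ h)
    have := hft.extend_comp (fun _ => L)
    rw [← this, Set.range_comp]
    exact hfin2.image _
  -- The empty word has quotient `L`, and words that do not begin a configuration have an empty
  -- quotient.
  refine ((hfact.insert ⊥).insert L).subset ?_
  rintro _ ⟨w, rfl⟩
  rcases w with _ | ⟨x, w⟩
  · exact Or.inl rfl
  right
  by_cases h : ∃ l μ, x :: w = Sum.inl l :: (List.map Sum.inr μ : List (Fin n ⊕ Fin k))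
  · obtain ⟨l, μ, h⟩ := h
    exact Or.inr ⟨(l, μ), by rw [h]⟩
  · left
    ext v
    simp only [Language.mem_leftQuotient, hmem]
    refine iff_of_false ?_ (fun h => h)
    rintro ⟨l, μ, -, heq⟩
    simp only [List.cons_append, List.cons.injEq] at heq
    obtain ⟨μ₁, ν, rfl, h1, h2⟩ := List.append_eq_map_iff.1 heq.2
    exact h ⟨l, μ₁, by rw [heq.1, h1]⟩

/-- A letter as a pair of a sort and a number. -/
def letterCode (x : Fin n ⊕ Fin k) : ℕ ⊕ ℕ := Sum.map Fin.val Fin.val x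

theorem letterCode_injective : Function.Injective (letterCode (n := n) (k := k)) :=
  Sum.map_injective.2 ⟨Fin.val_injective, Fin.val_injective⟩

/-- Every regular language has a code. -/
theorem exists_autCode {L : Language (Fin n ⊕ Fin k)} (hL : L.IsRegular) :
    ∃ e : AutCode, ∀ w : List (Fin n ⊕ Fin k), w.map letterCode ∈ e.nfa.accepts ↔ w ∈ L := by
  classical
  obtain ⟨Q, _, M, rfl⟩ := hL
  let num : Q → ℕ := fun q => Fintype.equivFin Q q
  have hnum : Function.Injective num :=
    Fin.val_injective.comp (Fintype.equivFin Q).injective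
  let e : AutCode :=
    (((Finset.univ : Finset (Q × (Fin n ⊕ Fin k))).toList.map fun x =>
      (num x.1, letterCode x.2, num (M.step x.1 x.2))), [num M.start],
      ((Finset.univ : Finset Q).filter (· ∈ M.accept)).toList.map num)
  have htrans : ∀ q x r, (num q, letterCode x, r) ∈ e.1 ↔ r = num (M.step q x) := by
    intro q x r
    simp only [e, List.mem_map, Finset.mem_toList, Finset.mem_univ, true_and, Prod.mk.injEq,
      Prod.exists]
    constructor
    · rintro ⟨q', x', h1, h2, rfl⟩
      rw [hnum h1, letterCode_injective h2]
    · rintro rfl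
      exact ⟨q, x, rfl, rfl, rfl⟩
  have hpath : ∀ (w : List (Fin n ⊕ Fin k)) q r,
      AutCode.Path e (num q) (w.map letterCode) r ↔ r = num (M.evalFrom q w) := by
    intro w
    induction w with
    | nil => intro q r; simp [AutCode.Path]
    | cons x w ih =>
      intro q r
      simp only [List.map_cons, AutCode.Path, htrans, exists_eq_left, ih, DFA.evalFrom_cons]
  refine ⟨e, fun w => ?_⟩
  rw [AutCode.mem_accepts_nfa, DFA.mem_accepts, DFA.eval]
  simp only [e, List.mem_singleton, exists_eq_left, List.mem_map, Finset.mem_toList,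
    Finset.mem_filter, Finset.mem_univ, true_and]
  constructor
  · rintro ⟨q', ⟨q, hq, rfl⟩, h⟩
    rwa [← hnum ((hpath w M.start _).1 h)]
  · intro h
    exact ⟨_, ⟨_, h, rfl⟩, (hpath w M.start _).2 rfl⟩

/-- A set of configurations that is described by a right congruence of finite index has a code. -/
theorem exists_autCode_of_feat {ps : List (AutCode × List (ℕ ⊕ ℕ))} {Z : ℕ × List ℕ → Prop}
    (hZ : ∀ l < n, ∀ μ μ' : List ℕ, (∀ m ∈ μ, m < k) → (∀ m ∈ μ', m < k) →
      AutCode.feat ps μ = AutCode.feat ps μ' → (Z (l, μ) ↔ Z (l, μ'))) :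
    ∃ e : AutCode, ∀ l < n, ∀ μ : List ℕ, (∀ m ∈ μ, m < k) → (AutCode.Mem e (l, μ) ↔ Z (l, μ)) := by
  have hval : ∀ μ : List (Fin k), ∀ m ∈ μ.map Fin.val, m < k := by
    intro μ m hm
    obtain ⟨x, _, rfl⟩ := List.mem_map.1 hm
    exact x.isLt
  obtain ⟨e, he⟩ := exists_autCode (isRegular_of_congruence (n := n) (k := k)
    (Z := fun l μ => Z (l, μ.map Fin.val)) (f := fun μ => AutCode.feat ps (μ.map Fin.val))
    ((AutCode.finite_image_feat ps k).subset
      (by rintro _ ⟨μ, rfl⟩; exact ⟨_, hval μ, rfl⟩))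
    (fun μ μ' m h => by simpa using AutCode.feat_append h m)
    (fun l μ μ' h => hZ l l.isLt _ _ (hval μ) (hval μ') h))
  refine ⟨e, fun l hl μ hμ => ?_⟩
  obtain ⟨μ, rfl⟩ : ∃ μ' : List (Fin k), μ = μ'.map Fin.val :=
    ⟨μ.pmap Fin.mk hμ, by simp [List.map_pmap]⟩
  have h1 : AutCode.confWord (l, μ.map Fin.val) =
      List.map letterCode (Sum.inl (⟨l, hl⟩ : Fin n) :: μ.map Sum.inr) := by
    simp [AutCode.confWord, letterCode]
  rw [AutCode.mem_iff_mem_accepts, h1, he]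
  constructor
  · rintro ⟨l', μ', hz, heq⟩
    simp only [List.cons.injEq, Sum.inl.injEq] at heq
    obtain ⟨rfl, heq⟩ := heq
    rwa [List.map_injective_iff.2 Sum.inr_injective heq]
  · exact fun hz => ⟨⟨l, hl⟩, μ, hz, rfl⟩

end regular

namespace Arena

variable {A : Arena}

/-- A configuration, with numbers for the location and the messages. -/
def raw (s : A.State) : ℕ × List ℕ := (s.loc, s.chan.map Fin.val)

theorem mem_states_iff {e : AutCode} {s : A.State} : s ∈ e.states A ↔ e.Mem (raw s) := by
  rw [AutCode.mem_iff_mem_accepts]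
  simp only [AutCode.states, raw, AutCode.confWord, word, List.map_cons, List.map_map]
  exact Iff.rfl

/-- The code may accept words that are no configurations and may use letters out of range. The
congruence given by its runs after each location avoids restricting the automaton itself. -/
theorem regularSet_states (e : AutCode) : A.RegularSet (e.states A) := by
  have h := isRegular_of_congruence (n := A.numLoc) (k := A.numMsg)
    (Z := fun l μ => (⟨l, μ⟩ : A.State) ∈ e.states A)
    (f := fun μ => AutCode.runs ((List.finRange A.numLoc).map fun l : Fin A.numLoc => (e, [Sum.inl l.val]))
      (μ.map Fin.val)) ?_ ?_ ?_
  · have heq : ({w | ∃ s ∈ e.states A, w = A.word s} : Set (List A.Letter)) =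
        {w | ∃ l μ, (⟨l, μ⟩ : A.State) ∈ e.states A ∧ w = Sum.inl l :: μ.map Sum.inr} := by
      ext w
      constructor
      · rintro ⟨s, hs, rfl⟩
        exact ⟨s.loc, s.chan, hs, rfl⟩
      · rintro ⟨l, μ, hs, rfl⟩
        exact ⟨⟨l, μ⟩, hs, rfl⟩
    rw [RegularSet]
    exact heq ▸ h
  · exact (AutCode.finite_range_runs _).subset (by rintro _ ⟨μ, rfl⟩; exact ⟨_, rfl⟩)
  · intro μ μ' m h
    simpa using AutCode.runs_append h m
  · intro l μ μ' h
    rw [AutCode.runs_eq_iff] at h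
    have := h (e, [Sum.inl l.val]) (List.mem_map.2 ⟨l, List.mem_finRange l, rfl⟩)
    rw [mem_states_iff, mem_states_iff, AutCode.Mem, AutCode.Mem]
    simp only [List.singleton_append] at this
    simp only [raw, AutCode.confWord, this]

theorem RegularSet.exists_autCode {X : Set A.State} (hX : A.RegularSet X) :
    ∃ e : AutCode, e.states A = X := by
  obtain ⟨e, he⟩ := LossyGame.exists_autCode hX
  refine ⟨e, ?_⟩
  ext s
  have : s ∈ e.states A ↔ ∃ t ∈ X, A.word s = A.word t := he (A.word s)
  rw [this]
  constructor
  · rintro ⟨t, ht, heq⟩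
    have : s = t := by
      simp only [word, List.cons.injEq, Sum.inl.injEq] at heq
      cases s; cases t
      obtain ⟨h1, h2⟩ := heq
      simp only [Config.mk.injEq]
      exact ⟨h1, List.map_injective_iff.2 Sum.inr_injective h2⟩
    rwa [this]
  · exact fun hs => ⟨s, hs, rfl⟩

end Arena

end LossyGame

namespace LossyGame

/-! ## Computability of runs -/

section primrec

theorem _root_.PrimrecPred.forall_mem {α β : Type} [Primcodable α] [Primcodable β] {f : α → List β}
    (hf : Primrec f) {p : α × β → Prop} (hp : PrimrecPred p) :
    PrimrecPred fun x => ∀ b ∈ f x, p (x, b) := by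
  have h : PrimrecRel fun (b : β) (x : α) => p (x, b) :=
    hp.comp (Primrec.snd.pair Primrec.fst)
  exact h.forall_mem_list.comp hf Primrec.id

theorem _root_.PrimrecPred.exists_mem {α β : Type} [Primcodable α] [Primcodable β] {f : α → List β}
    (hf : Primrec f) {p : α × β → Prop} (hp : PrimrecPred p) :
    PrimrecPred fun x => ∃ b ∈ f x, p (x, b) := by
  have h : PrimrecRel fun (b : β) (x : α) => p (x, b) :=
    hp.comp (Primrec.snd.pair Primrec.fst)
  exact h.exists_mem_list.comp hf Primrec.id

theorem _root_.PrimrecPred.forall_lt' {α : Type} [Primcodable α] {f : α → ℕ}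
    (hf : Primrec f) {p : α × ℕ → Prop} (hp : PrimrecPred p) :
    PrimrecPred fun x => ∀ b < f x, p (x, b) :=
  (PrimrecPred.forall_mem (Primrec.list_range.comp hf) hp).of_eq fun x => by simp

theorem _root_.PrimrecPred.exists_lt' {α : Type} [Primcodable α] {f : α → ℕ}
    (hf : Primrec f) {p : α × ℕ → Prop} (hp : PrimrecPred p) :
    PrimrecPred fun x => ∃ b < f x, p (x, b) :=
  (PrimrecPred.exists_mem (Primrec.list_range.comp hf) hp).of_eq fun x => by simp

theorem _root_.PrimrecPred.imp {α : Type} [Primcodable α] {p q : α → Prop}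
    (hp : PrimrecPred p) (hq : PrimrecPred q) : PrimrecPred fun x => p x → q x :=
  (hp.not.or hq).of_eq fun x => by tauto

theorem _root_.PrimrecPred.iff {α : Type} [Primcodable α] {p q : α → Prop}
    (hp : PrimrecPred p) (hq : PrimrecPred q) : PrimrecPred fun x => (p x ↔ q x) :=
  ((hp.imp hq).and (hq.imp hp)).of_eq fun x => by tauto

namespace AutCode

theorem primrec_nstep : Primrec fun x : (AutCode × List ℕ) × (ℕ ⊕ ℕ) =>
    nstep x.1.1 x.1.2 x.2 := by
  have h1 : PrimrecPred fun y : ((AutCode × List ℕ) × (ℕ ⊕ ℕ)) × (ℕ × (ℕ ⊕ ℕ) × ℕ) =>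
      y.2.2.1 = y.1.2 ∧ y.2.1 ∈ y.1.1.2 := by
    refine PrimrecPred.and (Primrec.eq.comp (Primrec.fst.comp (Primrec.snd.comp Primrec.snd))
      (Primrec.snd.comp Primrec.fst)) ?_
    exact (PrimrecPred.exists_mem (f := fun y : ((AutCode × List ℕ) × (ℕ ⊕ ℕ)) ×
      (ℕ × (ℕ ⊕ ℕ) × ℕ) => y.1.1.2)
      (Primrec.snd.comp (Primrec.fst.comp Primrec.fst))
      (p := fun z => z.1.2.1 = z.2)
      (Primrec.eq.comp (Primrec.fst.comp (Primrec.snd.comp Primrec.fst)) Primrec.snd)).of_eq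
      fun y => by simp
  refine (Primrec.list_flatMap (f := fun x : (AutCode × List ℕ) × (ℕ ⊕ ℕ) => x.1.1.1)
    (g := fun x t => if t.2.1 = x.2 ∧ t.1 ∈ x.1.2 then [t.2.2] else [])
    (Primrec.fst.comp (Primrec.fst.comp Primrec.fst))
    (Primrec.ite h1 (Primrec.list_cons.comp (Primrec.snd.comp (Primrec.snd.comp Primrec.snd))
      (Primrec.const [])) (Primrec.const []))).of_eq fun x => ?_
  unfold nstep
  generalize x.1.1.1 = l
  induction l with
  | nil => rfl
  | cons t l ih =>
    rw [List.flatMap_cons, ih, List.filter_cons]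
    split_ifs <;> simp_all

theorem primrec_run : Primrec fun x : AutCode × List (ℕ ⊕ ℕ) => run x.1 x.2 := by
  refine Primrec.list_foldl (f := fun x : AutCode × List (ℕ ⊕ ℕ) => x.2)
    (g := fun x => x.1.2.1) (h := fun x y => nstep x.1 y.1 y.2) Primrec.snd
    (Primrec.fst.comp (Primrec.snd.comp Primrec.fst)) ?_
  exact primrec_nstep.comp (((Primrec.fst.comp Primrec.fst).pair
    (Primrec.fst.comp Primrec.snd)).pair (Primrec.snd.comp Primrec.snd))

theorem primrec_map_inr : Primrec fun μ : List ℕ => (μ.map Sum.inr : List (ℕ ⊕ ℕ)) :=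
  Primrec.list_map Primrec.id ((Primrec.sumInr.comp Primrec.snd).to₂)

theorem primrec_confWord : Primrec confWord :=
  Primrec.list_cons.comp (Primrec.sumInl.comp Primrec.fst) (primrec_map_inr.comp Primrec.snd)

theorem primrecPred_mem : PrimrecPred fun x : AutCode × (ℕ × List ℕ) => Mem x.1 x.2 := by
  refine PrimrecPred.exists_mem (f := fun x : AutCode × (ℕ × List ℕ) => run x.1 (confWord x.2))
    (primrec_run.comp (Primrec.fst.pair (primrec_confWord.comp Primrec.snd)))
    (p := fun y => y.2 ∈ y.1.1.2.2) ?_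
  exact (PrimrecPred.exists_mem (f := fun y : (AutCode × (ℕ × List ℕ)) × ℕ => y.1.1.2.2)
    (Primrec.snd.comp (Primrec.snd.comp (Primrec.fst.comp Primrec.fst)))
    (p := fun z => z.1.2 = z.2)
    (Primrec.eq.comp (Primrec.snd.comp Primrec.fst) Primrec.snd)).of_eq fun y => by simp

theorem primrec_targets : Primrec targets :=
  Primrec.list_append.comp (Primrec.fst.comp Primrec.snd)
    (Primrec.list_map Primrec.fst ((Primrec.snd.comp (Primrec.snd.comp Primrec.snd)).to₂))

theorem primrec_up : Primrec fun x : ℕ × AutCode => up x.1 x.2 := by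
  refine Primrec.pair (Primrec.list_append.comp (Primrec.fst.comp Primrec.snd) ?_)
    (Primrec.snd.comp Primrec.snd)
  refine Primrec.list_flatMap (f := fun x : ℕ × AutCode => List.range x.1)
    (Primrec.list_range.comp Primrec.fst) ?_
  refine Primrec.list_map (f := fun y : (ℕ × AutCode) × ℕ => targets y.1.2)
    (primrec_targets.comp (Primrec.snd.comp Primrec.fst)) ?_
  exact (Primrec.snd.pair ((Primrec.sumInr.comp (Primrec.snd.comp Primrec.fst)).pair
    Primrec.snd)).to₂

theorem primrec_dropLast {α : Type} [Primcodable α] : Primrec (@List.dropLast α) :=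
  (Primrec.list_reverse.comp (Primrec.list_tail.comp Primrec.list_reverse)).of_eq fun l => by
    rw [List.tail_reverse, List.reverse_reverse]

theorem primrec_getLast? {α : Type} [Primcodable α] : Primrec (@List.getLast? α) :=
  (Primrec.list_head?.comp Primrec.list_reverse).of_eq fun l => by
    rw [List.head?_reverse]

theorem primrec_runs : Primrec fun x : List (AutCode × List (ℕ ⊕ ℕ)) × List ℕ => runs x.1 x.2 := by
  refine Primrec.list_map (f := fun x : List (AutCode × List (ℕ ⊕ ℕ)) × List ℕ => x.1)
    Primrec.fst ?_
  exact (primrec_run.comp ((Primrec.fst.comp Primrec.snd).pair (Primrec.list_append.comp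
    (Primrec.snd.comp Primrec.snd) (primrec_map_inr.comp (Primrec.snd.comp Primrec.fst))))).to₂

theorem primrec_feat : Primrec fun x : List (AutCode × List (ℕ ⊕ ℕ)) × List ℕ => feat x.1 x.2 :=
  (primrec_getLast?.comp Primrec.snd).pair (primrec_runs.pair
    (primrec_runs.comp (Primrec.fst.pair (primrec_dropLast.comp Primrec.snd))))

end AutCode

/-- All words of length at most `n` over the letters below `k`. -/
def wordsLe (k n : ℕ) : List (List ℕ) :=
  Nat.rec [[]] (fun _ W => [] :: W.flatMap fun w => (List.range k).map fun m => w ++ [m]) n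

theorem mem_wordsLe {k n : ℕ} {w : List ℕ} :
    w ∈ wordsLe k n ↔ w.length ≤ n ∧ ∀ m ∈ w, m < k := by
  induction n generalizing w with
  | zero =>
    change w ∈ [[]] ↔ _
    simp only [List.mem_singleton, Nat.le_zero, List.length_eq_zero_iff]
    constructor
    · rintro rfl; simp
    · exact fun h => h.1
  | succ n ih =>
    change w ∈ [] :: (wordsLe k n).flatMap (fun w => (List.range k).map fun m => w ++ [m]) ↔ _
    simp only [List.mem_cons, List.mem_flatMap, List.mem_map, List.mem_range, ih]
    constructor
    · rintro (rfl | ⟨v, ⟨h1, h2⟩, m, hm, rfl⟩)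
      · simp
      · refine ⟨by simpa using h1, fun m' hm' => ?_⟩
        rcases List.mem_append.1 hm' with h | h
        · exact h2 _ h
        · rw [List.mem_singleton.1 h]
          exact hm
    · rintro ⟨h1, h2⟩
      rcases List.eq_nil_or_concat w with rfl | ⟨v, m, rfl⟩
      · exact Or.inl rfl
      · rw [List.concat_eq_append] at h1 h2 ⊢
        refine Or.inr ⟨v, ⟨by simpa using h1, fun m' hm' => h2 _ (List.mem_append_left _ hm')⟩,
          m, h2 _ (by simp), rfl⟩

theorem primrec_wordsLe : Primrec fun x : ℕ × ℕ => wordsLe x.1 x.2 := by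
  have h : Primrec₂ fun (k : ℕ) (n : ℕ) => wordsLe k n := by
    refine Primrec.nat_rec (f := fun _ : ℕ => ([[]] : List (List ℕ)))
      (g := fun k y => [] :: y.2.flatMap fun w => (List.range k).map fun m => w ++ [m])
      (Primrec.const _) ?_
    refine Primrec.list_cons.comp (Primrec.const []) ?_
    refine Primrec.list_flatMap (f := fun y : ℕ × (ℕ × List (List ℕ)) => y.2.2)
      (Primrec.snd.comp Primrec.snd) ?_
    refine Primrec.list_map
      (f := fun z : (ℕ × (ℕ × List (List ℕ))) × List ℕ => List.range z.1.1)
      (Primrec.list_range.comp (Primrec.fst.comp Primrec.fst)) ?_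
    exact (Primrec.list_concat.comp (Primrec.snd.comp Primrec.fst) Primrec.snd).to₂
  exact h

end primrec

/-! ## Computable choices -/

/-- Unbounded search through the encodings of `β`. Termination needs only the bare existence of a
solution, which may be proved classically. -/
theorem exists_computable_choice {α β : Type} [Primcodable α] [Primcodable β] {p : α → β → Prop}
    (hp : ComputablePred fun y : α × β => p y.1 y.2) (h : ∀ a, ∃ b, p a b) :
    ∃ f : α → β, Computable f ∧ ∀ a, p a (f a) := by
  obtain ⟨hdec, hd⟩ := hp
  have hdec' : ∀ a b, Decidable (p a b) := fun a b => hdec (a, b)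
  have hd' : Computable fun y : α × β => decide (p y.1 y.2) := hd.of_eq fun y => by congr
  let g : α → ℕ → Option β := fun a n =>
    (Encodable.decode (α := β) n).bind fun b => cond (decide (p a b)) (some b) none
  have hc : Computable fun z : (α × ℕ) × β => cond (decide (p z.1.1 z.2)) (some z.2) none := by
    have h1 : Computable fun z : (α × ℕ) × β => decide (p z.1.1 z.2) :=
      Computable.comp (g := fun z : (α × ℕ) × β => (z.1.1, z.2)) hd'
        ((Computable.fst.comp Computable.fst).pair Computable.snd)
    exact Computable.cond h1 (Computable.option_some.comp Computable.snd) (Computable.const none)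
  have hg : Computable₂ g := by
    have h1 : Computable fun y : α × ℕ => (Encodable.decode (α := β) y.2) :=
      Computable.decode.comp Computable.snd
    exact Computable.option_bind h1 hc
  have hdom : ∀ a, (Nat.rfindOpt (g a)).Dom := by
    intro a
    obtain ⟨b, hb⟩ := h a
    refine Nat.rfindOpt_dom.2 ⟨Encodable.encode b, b, ?_⟩
    simp [g, hb]
  refine ⟨fun a => (Nat.rfindOpt (g a)).get (hdom a),
    (Partrec.rfindOpt hg).of_eq_tot fun a => Part.get_mem _, fun a => ?_⟩
  obtain ⟨n, hn⟩ := Nat.rfindOpt_spec (Part.get_mem (hdom a))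
  simp only [g, Option.mem_def, Option.bind_eq_some_iff] at hn
  obtain ⟨b, -, hb⟩ := hn
  by_cases hpb : p a b
  · simp only [hpb, decide_true, cond_true, Option.some.injEq] at hb
    exact (congrArg (p a) hb).mp hpb
  · simp [hpb] at hb

theorem _root_.ComputablePred.comp {α β : Type} [Primcodable α] [Primcodable β] {p : β → Prop}
    (hp : ComputablePred p) {f : α → β} (hf : Computable f) : ComputablePred fun x => p (f x) := by
  obtain ⟨_, hp⟩ := hp
  exact ⟨inferInstance, hp.comp hf⟩

/-- Channel contents over the messages below `k`. -/
def Valid (k : ℕ) (μ : List ℕ) : Prop := ∀ m ∈ μ, m < k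

/-- It can be decided whether all words satisfy a property that depends on a right congruence of
finite index. -/
theorem computablePred_forall_of_congruence {α β : Type} [Primcodable α] [Primcodable β]
    {k : α → ℕ} (hk : Primrec k) {f : α → List ℕ → β}
    (hf : Primrec fun y : α × List ℕ => f y.1 y.2)
    (hcong : ∀ x μ μ' m, f x μ = f x μ' → f x (μ ++ [m]) = f x (μ' ++ [m]))
    (hfin : ∀ x, (f x '' {μ | Valid (k x) μ}).Finite) {p : α → List ℕ → Prop}
    (hp : PrimrecPred fun y : α × List ℕ => p y.1 y.2)
    (hpf : ∀ x μ μ', Valid (k x) μ → Valid (k x) μ' → f x μ = f x μ' → (p x μ ↔ p x μ')) :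
    ComputablePred fun x => ∀ μ, Valid (k x) μ → p x μ := by
  classical
  -- A checkable stopping criterion: words of length at most `n + 1` show no class that words of
  -- length at most `n` do not show.
  have hclosed : PrimrecPred fun y : α × ℕ => ∀ w ∈ wordsLe (k y.1) (y.2 + 1),
      ∃ w' ∈ wordsLe (k y.1) y.2, f y.1 w = f y.1 w' := by
    refine PrimrecPred.forall_mem (f := fun y : α × ℕ => wordsLe (k y.1) (y.2 + 1))
      (primrec_wordsLe.comp ((hk.comp Primrec.fst).pair (Primrec.succ.comp Primrec.snd)))
      (p := fun z => ∃ w' ∈ wordsLe (k z.1.1) z.1.2, f z.1.1 z.2 = f z.1.1 w') ?_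
    refine PrimrecPred.exists_mem (f := fun z : (α × ℕ) × List ℕ => wordsLe (k z.1.1) z.1.2)
      (primrec_wordsLe.comp ((hk.comp (Primrec.fst.comp Primrec.fst)).pair
        (Primrec.snd.comp Primrec.fst))) (p := fun u => f u.1.1.1 u.1.2 = f u.1.1.1 u.2) ?_
    exact Primrec.eq.comp
      (hf.comp ((Primrec.fst.comp (Primrec.fst.comp Primrec.fst)).pair
        (Primrec.snd.comp Primrec.fst)))
      (hf.comp ((Primrec.fst.comp (Primrec.fst.comp Primrec.fst)).pair Primrec.snd))
  -- There are finitely many classes, so some length bound admits a representative of each of them.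
  have hex : ∀ x, ∃ n, ∀ w ∈ wordsLe (k x) (n + 1),
      ∃ w' ∈ wordsLe (k x) n, f x w = f x w' := by
    intro x
    have hrep : ∀ b : β, ∃ n, ∀ w, Valid (k x) w → f x w = b →
        ∃ w', Valid (k x) w' ∧ w'.length ≤ n ∧ f x w' = b := by
      intro b
      by_cases h : ∃ w, Valid (k x) w ∧ f x w = b
      · obtain ⟨w, h1, h2⟩ := h
        exact ⟨w.length, fun _ _ _ => ⟨w, h1, le_rfl, h2⟩⟩
      · exact ⟨0, fun w h1 h2 => absurd ⟨w, h1, h2⟩ h⟩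
    choose n hn using hrep
    obtain ⟨N, hN⟩ := ((hfin x).image n).bddAbove
    refine ⟨N, fun w hw => ?_⟩
    have hv := (mem_wordsLe.1 hw).2
    obtain ⟨w', h1, h2, h3⟩ := hn (f x w) w hv rfl
    exact ⟨w', mem_wordsLe.2 ⟨h2.trans (hN ⟨_, ⟨w, hv, rfl⟩, rfl⟩), h1⟩, h3.symm⟩
  obtain ⟨N, hNc, hN⟩ := exists_computable_choice hclosed.computablePred hex
  -- By the right congruence, each further letter can be appended to a short representative and the
  -- result shortened again, so the criterion covers words of all lengths.
  have hrep : ∀ x μ, Valid (k x) μ → ∃ μ' ∈ wordsLe (k x) (N x), f x μ = f x μ' := by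
    intro x μ
    induction μ using List.reverseRecOn with
    | nil => exact fun _ => ⟨[], mem_wordsLe.2 ⟨Nat.zero_le _, by simp⟩, rfl⟩
    | append_singleton μ m ih =>
      intro hv
      obtain ⟨μ', h1, h2⟩ := ih fun m hm => hv m (List.mem_append_left _ hm)
      rw [mem_wordsLe] at h1
      obtain ⟨μ'', h3, h4⟩ := hN x (μ' ++ [m]) (mem_wordsLe.2 ⟨by simpa using h1.1, fun m' hm' => by
        rcases List.mem_append.1 hm' with h | h
        · exact h1.2 _ h
        · rw [List.mem_singleton.1 h]
          exact hv m (by simp)⟩)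
      exact ⟨μ'', h3, (hcong x _ _ m h2).trans h4⟩
  have hcheck : PrimrecPred fun y : α × ℕ => ∀ w ∈ wordsLe (k y.1) y.2, p y.1 w :=
    PrimrecPred.forall_mem (f := fun y : α × ℕ => wordsLe (k y.1) y.2)
      (primrec_wordsLe.comp ((hk.comp Primrec.fst).pair Primrec.snd)) (p := fun z => p z.1.1 z.2)
      (hp.comp ((Primrec.fst.comp Primrec.fst).pair Primrec.snd))
  refine (hcheck.computablePred.comp (Computable.id.pair hNc)).of_eq fun x => ?_
  constructor
  · intro h μ hμ
    obtain ⟨μ', h1, h2⟩ := hrep x μ hμ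
    exact (hpf x μ μ' hμ (mem_wordsLe.1 h1).2 h2).2 (h μ' h1)
  · exact fun h w hw => h w (mem_wordsLe.1 hw).2

/-! ## Sets of configurations that are defined by automata -/

/-- Two channel contents cannot be distinguished by some automata, by adding or removing at most
one message. -/
structure Indist (cs : List AutCode) (n k : ℕ) (μ μ' : List ℕ) : Prop where
  last : μ.getLast? = μ'.getLast?
  mem : ∀ e ∈ cs, ∀ l < n, AutCode.Mem e (l, μ) ↔ AutCode.Mem e (l, μ')
  mem_cons : ∀ e ∈ cs, ∀ l < n, ∀ m < k, AutCode.Mem e (l, m :: μ) ↔ AutCode.Mem e (l, m :: μ')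
  mem_dropLast : ∀ e ∈ cs, ∀ l < n, AutCode.Mem e (l, μ.dropLast) ↔ AutCode.Mem e (l, μ'.dropLast)

theorem Indist.mono {cs cs' : List AutCode} {n k : ℕ} {μ μ' : List ℕ} (h : Indist cs' n k μ μ')
    (hcs : ∀ e ∈ cs, e ∈ cs') : Indist cs n k μ μ' :=
  ⟨h.last, fun e he => h.mem e (hcs e he), fun e he => h.mem_cons e (hcs e he),
    fun e he => h.mem_dropLast e (hcs e he)⟩

/-- Words with a location and at most one message. -/
def prefixes (n k : ℕ) : List (List (ℕ ⊕ ℕ)) :=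
  (List.range n).flatMap fun l => [Sum.inl l] :: (List.range k).map fun m => [Sum.inl l, Sum.inr m]

/-- All pairs of an automaton and a prefix. -/
def prefixed (cs : List AutCode) (n k : ℕ) : List (AutCode × List (ℕ ⊕ ℕ)) :=
  cs.flatMap fun e => (prefixes n k).map fun w => (e, w)

theorem indist_of_feat_eq {cs : List AutCode} {n k : ℕ} {μ μ' : List ℕ}
    (h : AutCode.feat (prefixed cs n k) μ = AutCode.feat (prefixed cs n k) μ') :
    Indist cs n k μ μ' := by
  simp only [AutCode.feat, Prod.mk.injEq] at h
  obtain ⟨h1, h2, h3⟩ := h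
  rw [AutCode.runs_eq_iff] at h2 h3
  have hp : ∀ e ∈ cs, ∀ w ∈ prefixes n k, (e, w) ∈ prefixed cs n k := fun e he w hw =>
    List.mem_flatMap.2 ⟨e, he, List.mem_map.2 ⟨w, hw, rfl⟩⟩
  have hp1 : ∀ l < n, [Sum.inl l] ∈ prefixes n k := fun l hl =>
    List.mem_flatMap.2 ⟨l, List.mem_range.2 hl, List.mem_cons_self⟩
  have hp2 : ∀ l < n, ∀ m < k, [Sum.inl l, Sum.inr m] ∈ prefixes n k := fun l hl m hm =>
    List.mem_flatMap.2 ⟨l, List.mem_range.2 hl, List.mem_cons_of_mem _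
      (List.mem_map.2 ⟨m, List.mem_range.2 hm, rfl⟩)⟩
  refine ⟨h1, fun e he l hl => ?_, fun e he l hl m hm => ?_, fun e he l hl => ?_⟩
  · have : AutCode.run e (AutCode.confWord (l, μ)) = AutCode.run e (AutCode.confWord (l, μ')) :=
      h2 _ (hp e he _ (hp1 l hl))
    rw [AutCode.Mem, AutCode.Mem, this]
  · have : AutCode.run e (AutCode.confWord (l, m :: μ)) =
        AutCode.run e (AutCode.confWord (l, m :: μ')) := h2 _ (hp e he _ (hp2 l hl m hm))
    rw [AutCode.Mem, AutCode.Mem, this]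
  · have : AutCode.run e (AutCode.confWord (l, μ.dropLast)) =
        AutCode.run e (AutCode.confWord (l, μ'.dropLast)) := h3 _ (hp e he _ (hp1 l hl))
    rw [AutCode.Mem, AutCode.Mem, this]

theorem primrec_prefixed : Primrec fun x : List AutCode × ℕ × ℕ => prefixed x.1 x.2.1 x.2.2 := by
  have h : Primrec fun x : ℕ × ℕ => prefixes x.1 x.2 := by
    refine Primrec.list_flatMap (f := fun x : ℕ × ℕ => List.range x.1)
      (Primrec.list_range.comp Primrec.fst) ?_
    refine Primrec.list_cons.comp (Primrec.list_cons.comp (Primrec.sumInl.comp Primrec.snd)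
      (Primrec.const [])) ?_
    refine Primrec.list_map (f := fun y : (ℕ × ℕ) × ℕ => List.range y.1.2)
      (Primrec.list_range.comp (Primrec.snd.comp Primrec.fst)) ?_
    exact (Primrec.list_cons.comp (Primrec.sumInl.comp (Primrec.snd.comp Primrec.fst))
      (Primrec.list_cons.comp (Primrec.sumInr.comp Primrec.snd) (Primrec.const []))).to₂
  refine Primrec.list_flatMap (f := fun x : List AutCode × ℕ × ℕ => x.1) Primrec.fst ?_
  refine Primrec.list_map (f := fun y : (List AutCode × ℕ × ℕ) × AutCode =>
    prefixes y.1.2.1 y.1.2.2) (h.comp (Primrec.snd.comp Primrec.fst)) ?_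
  exact ((Primrec.snd.comp Primrec.fst).pair Primrec.snd).to₂

section decide

variable {α : Type} [Primcodable α] {n k : α → ℕ} {cs : α → List AutCode}

theorem computablePred_forall (hn : Primrec n) (hk : Primrec k) (hcs : Primrec cs)
    {p : α → ℕ × List ℕ → Prop} (hp : PrimrecPred fun y : α × (ℕ × List ℕ) => p y.1 y.2)
    (hind : ∀ x μ μ', Valid (k x) μ → Valid (k x) μ' → Indist (cs x) (n x) (k x) μ μ' →
      ∀ l < n x, p x (l, μ) ↔ p x (l, μ')) :
    ComputablePred fun x => ∀ l < n x, ∀ μ, Valid (k x) μ → p x (l, μ) := by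
  have hps : Primrec fun x => prefixed (cs x) (n x) (k x) :=
    primrec_prefixed.comp (hcs.pair (hn.pair hk))
  refine (computablePred_forall_of_congruence hk
    (f := fun x μ => AutCode.feat (prefixed (cs x) (n x) (k x)) μ)
    (AutCode.primrec_feat.comp ((hps.comp Primrec.fst).pair Primrec.snd))
    (fun x μ μ' m h => AutCode.feat_append h m)
    (fun x => AutCode.finite_image_feat _ _) (p := fun x μ => ∀ l < n x, p x (l, μ)) ?_ ?_).of_eq ?_
  · exact PrimrecPred.forall_lt' (f := fun y : α × List ℕ => n y.1) (hn.comp Primrec.fst)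
      (p := fun z => p z.1.1 (z.2, z.1.2)) (hp.comp ((Primrec.fst.comp Primrec.fst).pair
        (Primrec.snd.pair (Primrec.snd.comp Primrec.fst))))
  · exact fun x μ μ' hμ hμ' h => forall₂_congr fun l hl =>
      hind x μ μ' hμ hμ' (indist_of_feat_eq h) l hl
  · exact fun x => ⟨fun h l hl μ hμ => h μ hμ l hl, fun h μ hμ l hl => h l hl μ hμ⟩

/-- Existence of the automaton is the regularity of a set described by a congruence; the search is
computable because a candidate can be compared with `p` on all configurations. -/
theorem exists_computable_autCode (hn : Primrec n) (hk : Primrec k) (hcs : Primrec cs)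
    {p : α → ℕ × List ℕ → Prop} (hp : PrimrecPred fun y : α × (ℕ × List ℕ) => p y.1 y.2)
    (hind : ∀ x μ μ', Valid (k x) μ → Valid (k x) μ' → Indist (cs x) (n x) (k x) μ μ' →
      ∀ l < n x, p x (l, μ) ↔ p x (l, μ')) :
    ∃ F : α → AutCode, Computable F ∧ ∀ x, ∀ l < n x, ∀ μ, Valid (k x) μ →
      (AutCode.Mem (F x) (l, μ) ↔ p x (l, μ)) := by
  refine exists_computable_choice (p := fun x e => ∀ l < n x, ∀ μ, Valid (k x) μ →
      (AutCode.Mem e (l, μ) ↔ p x (l, μ))) ?_ ?_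
  · refine computablePred_forall (α := α × AutCode) (n := fun y => n y.1) (k := fun y => k y.1)
      -- The candidate joins the list, so that indistinguishable contents also agree on membership
      -- in it.
      (cs := fun y => y.2 :: cs y.1) (hn.comp Primrec.fst) (hk.comp Primrec.fst)
      (Primrec.list_cons.comp Primrec.snd (hcs.comp Primrec.fst))
      (p := fun y s => AutCode.Mem y.2 s ↔ p y.1 s) ?_ ?_
    · exact (AutCode.primrecPred_mem.comp ((Primrec.snd.comp Primrec.fst).pair Primrec.snd)).iff
        (hp.comp ((Primrec.fst.comp Primrec.fst).pair Primrec.snd))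
    · intro y μ μ' hμ hμ' h l hl
      exact iff_congr (h.mem _ List.mem_cons_self l hl)
        (hind y.1 μ μ' hμ hμ' (h.mono fun e he => List.mem_cons_of_mem _ he) l hl)
  · intro x
    exact exists_autCode_of_feat (ps := prefixed (cs x) (n x) (k x)) fun l hl μ μ' hμ hμ' h =>
      hind x μ μ' hμ hμ' (indist_of_feat_eq h) l hl

/-- A positional strategy with weights that depend on an indistinguishability relation has a
computable code. -/
theorem exists_computable_stratCode (hn : Primrec n) (hk : Primrec k) (hcs : Primrec cs)
    {wt : α → ℕ × List ℕ → List ℕ} (hwt : Primrec fun y : α × (ℕ × List ℕ) => wt y.1 y.2)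
    (hfin : ∀ x, (Set.range (wt x)).Finite)
    (hind : ∀ x μ μ', Valid (k x) μ → Valid (k x) μ' → Indist (cs x) (n x) (k x) μ μ' →
      ∀ l < n x, wt x (l, μ) = wt x (l, μ')) :
    ∃ F : α → StratCode, Computable F ∧ ∀ x, ∀ l < n x, ∀ μ, Valid (k x) μ →
      (∃ e : AutCode × List ℕ, e ∈ F x ∧ AutCode.Mem e.1 (l, μ)) ∧
      ∀ e : AutCode × List ℕ, e ∈ F x → AutCode.Mem e.1 (l, μ) → e.2 = wt x (l, μ) := by
  refine exists_computable_choice (p := fun x (c : StratCode) => ∀ l < n x, ∀ μ, Valid (k x) μ →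
    (∃ e : AutCode × List ℕ, e ∈ c ∧ AutCode.Mem e.1 (l, μ)) ∧
      ∀ e : AutCode × List ℕ, e ∈ c → AutCode.Mem e.1 (l, μ) → e.2 = wt x (l, μ)) ?_ ?_
  · refine computablePred_forall (α := α × StratCode) (n := fun y => n y.1) (k := fun y => k y.1)
      (cs := fun y => (y.2.map fun e => e.1) ++ cs y.1) (hn.comp Primrec.fst) (hk.comp Primrec.fst)
      (Primrec.list_append.comp (Primrec.list_map Primrec.snd (Primrec.fst.comp Primrec.snd).to₂)
        (hcs.comp Primrec.fst))
      (p := fun y s => (∃ e : AutCode × List ℕ, e ∈ y.2 ∧ AutCode.Mem e.1 s) ∧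
        ∀ e : AutCode × List ℕ, e ∈ y.2 → AutCode.Mem e.1 s → e.2 = wt y.1 s) ?_ ?_
    · have hm : PrimrecPred fun z : ((α × StratCode) × (ℕ × List ℕ)) × (AutCode × List ℕ) =>
          AutCode.Mem z.2.1 z.1.2 := AutCode.primrecPred_mem.comp
            ((Primrec.fst.comp Primrec.snd).pair (Primrec.snd.comp Primrec.fst))
      refine PrimrecPred.and ?_ ?_
      · exact PrimrecPred.exists_mem (f := fun z : (α × StratCode) × (ℕ × List ℕ) => z.1.2)
          (Primrec.snd.comp Primrec.fst) hm
      · refine PrimrecPred.forall_mem (f := fun z : (α × StratCode) × (ℕ × List ℕ) => z.1.2)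
          (Primrec.snd.comp Primrec.fst)
          (p := fun z => AutCode.Mem z.2.1 z.1.2 → z.2.2 = wt z.1.1.1 z.1.2) (hm.imp ?_)
        exact Primrec.eq.comp (Primrec.snd.comp Primrec.snd) (hwt.comp
          ((Primrec.fst.comp (Primrec.fst.comp Primrec.fst)).pair (Primrec.snd.comp Primrec.fst)))
    · intro y μ μ' hμ hμ' h l hl
      have h1 : ∀ e : AutCode × List ℕ, e ∈ y.2 →
          (AutCode.Mem e.1 (l, μ) ↔ AutCode.Mem e.1 (l, μ')) := fun e he =>
        h.mem _ (List.mem_append_left _ (List.mem_map.2 ⟨e, he, rfl⟩)) l hl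
      have h2 := hind y.1 μ μ' hμ hμ' (h.mono fun e he => List.mem_append_right _ he) l hl
      rw [h2]
      refine and_congr (exists_congr fun (e : AutCode × List ℕ) => and_congr_right fun he => h1 e he)
        (forall_congr' fun (e : AutCode × List ℕ) => forall_congr' fun he => ?_)
      rw [h1 e he]
  · intro x
    have hcode : ∀ w : List ℕ, ∃ e : AutCode, ∀ l < n x, ∀ μ : List ℕ, Valid (k x) μ →
        (AutCode.Mem e (l, μ) ↔ wt x (l, μ) = w) := fun w =>
      exists_autCode_of_feat (Z := fun s => wt x s = w) (ps := prefixed (cs x) (n x) (k x))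
        fun l hl μ μ' hμ hμ' h => by
          rw [hind x μ μ' hμ hμ' (indist_of_feat_eq h) l hl]
    choose e he using hcode
    -- One entry for each list of weights that occurs, with an automaton for the configurations
    -- where it occurs.
    refine ⟨(hfin x).toFinset.toList.map fun w => (e w, w), fun l hl μ hμ => ⟨?_, ?_⟩⟩
    · refine ⟨(e (wt x (l, μ)), wt x (l, μ)), List.mem_map.2 ⟨_, ?_, rfl⟩, (he _ l hl μ hμ).2 rfl⟩
      simp
    · intro y hy hmem
      obtain ⟨w, -, rfl⟩ := List.mem_map.1 hy
      exact ((he w l hl μ hμ).1 hmem).symm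

end decide

end LossyGame

/-! ### Inputs of the algorithm and the decoding of transitions -/

namespace LossyGame

theorem _root_.Primrec.list_filter' {α β : Type} [Primcodable α] [Primcodable β] {f : α → List β}
    (hf : Primrec f) {p : α → β → Prop} [∀ x, DecidablePred (p x)]
    (hp : PrimrecPred fun y : α × β => p y.1 y.2) :
    Primrec fun x => (f x).filter fun b => p x b := by
  refine (Primrec.list_flatMap (f := f) (g := fun x b => if p x b then [b] else []) hf
    (Primrec.ite hp (Primrec.list_cons.comp Primrec.snd (Primrec.const []))
      (Primrec.const []))).of_eq fun x => ?_
  generalize f x = l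
  induction l with
  | nil => rfl
  | cons t l ih =>
    rw [List.flatMap_cons, ih, List.filter_cons]
    split_ifs <;> simp_all

/-- The input of the algorithm: an arena, a player, and a set of target states. -/
abbrev Input := ArenaCode × Bool × AutCode

namespace Input

/-- The number of locations. -/
def numLoc (x : Input) : ℕ := x.1.1.1

/-- The number of messages. -/
def numMsg (x : Input) : ℕ := x.1.1.2.1

/-- The number of actions of the player. -/
def numAct (x : Input) : ℕ := cond x.2.1 x.1.1.2.2.2 x.1.1.2.2.1

/-- The number of actions of the opponent. -/
def numOpp (x : Input) : ℕ := cond x.2.1 x.1.1.2.2.1 x.1.1.2.2.2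

/-- The target. -/
def target (x : Input) : AutCode := x.2.2

/-- An entry of the table for a location and a pair of actions, of the player and the opponent. -/
def IsEntry (y : Input × ℕ × ℕ × ℕ) (t : ℕ × ℕ × ℕ × ℕ × Option (Bool × ℕ)) : Prop :=
  t.1 = y.2.1 ∧ t.2.1 = cond y.1.2.1 y.2.2.2 y.2.2.1 ∧ t.2.2.1 = cond y.1.2.1 y.2.2.1 y.2.2.2 ∧
    t.2.2.2.1 < y.1.numLoc ∧ ∀ z ∈ t.2.2.2.2.toList, z.2 < y.1.numMsg

instance (y : Input × ℕ × ℕ × ℕ) : DecidablePred (IsEntry y) := fun t => by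
  unfold IsEntry; infer_instance

/-- The outcomes for a location and a pair of actions, of the player and the opponent. -/
def ops (x : Input) (l a b : ℕ) : List (ℕ × Option (Bool × ℕ)) :=
  (x.1.2.1.filter fun t => IsEntry (x, l, a, b) t).map fun t => t.2.2.2

/-- The range conditions discard ill-formed table entries. The computed functions have to be total,
so the invariance under `Indist` is needed also for inputs that present no arena. -/
theorem mem_ops {x : Input} {l a b : ℕ} {o : ℕ × Option (Bool × ℕ)} :
    o ∈ x.ops l a b ↔ (l, cond x.2.1 b a, cond x.2.1 a b, o) ∈ x.1.2.1 ∧ o.1 < x.numLoc ∧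
      ∀ z ∈ o.2.toList, z.2 < x.numMsg := by
  simp only [ops, List.mem_map, List.mem_filter, decide_eq_true_eq]
  simp only [IsEntry]
  constructor
  · rintro ⟨⟨l', a', b', o'⟩, ⟨h, rfl, rfl, rfl, h1, h2⟩, rfl⟩
    exact ⟨h, h1, h2⟩
  · rintro ⟨h, h1, h2⟩
    exact ⟨_, ⟨h, rfl, rfl, rfl, h1, h2⟩, rfl⟩

end Input

/-- The effect of a channel operation. -/
def applyOp (f : Option (Bool × ℕ)) (μ : List ℕ) : Option (List ℕ) :=
  Option.casesOn f (some μ) fun z =>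
    cond z.1 (if μ.getLast? = some z.2 then some μ.dropLast else none) (some (z.2 :: μ))

section primrec

open Input

theorem primrec_numLoc : Primrec numLoc := Primrec.fst.comp (Primrec.fst.comp Primrec.fst)

theorem primrec_numMsg : Primrec numMsg :=
  Primrec.fst.comp (Primrec.snd.comp (Primrec.fst.comp Primrec.fst))

theorem primrec_numAct : Primrec numAct :=
  Primrec.cond (Primrec.fst.comp Primrec.snd)
    (Primrec.snd.comp (Primrec.snd.comp (Primrec.snd.comp (Primrec.fst.comp Primrec.fst))))
    (Primrec.fst.comp (Primrec.snd.comp (Primrec.snd.comp (Primrec.fst.comp Primrec.fst))))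

theorem primrec_numOpp : Primrec numOpp :=
  Primrec.cond (Primrec.fst.comp Primrec.snd)
    (Primrec.fst.comp (Primrec.snd.comp (Primrec.snd.comp (Primrec.fst.comp Primrec.fst))))
    (Primrec.snd.comp (Primrec.snd.comp (Primrec.snd.comp (Primrec.fst.comp Primrec.fst))))

theorem primrec_target : Primrec target := Primrec.snd.comp Primrec.snd

theorem primrecPred_isEntry : PrimrecPred fun y : (Input × ℕ × ℕ × ℕ) ×
    (ℕ × ℕ × ℕ × ℕ × Option (Bool × ℕ)) => IsEntry y.1 y.2 := by
  have hi : Primrec fun y : (Input × ℕ × ℕ × ℕ) × (ℕ × ℕ × ℕ × ℕ × Option (Bool × ℕ)) =>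
      y.1.1.2.1 :=
    Primrec.fst.comp (Primrec.snd.comp (Primrec.fst.comp Primrec.fst))
  have ha : Primrec fun y : (Input × ℕ × ℕ × ℕ) × (ℕ × ℕ × ℕ × ℕ × Option (Bool × ℕ)) =>
      y.1.2.2.1 := Primrec.fst.comp (Primrec.snd.comp (Primrec.snd.comp Primrec.fst))
  have hb : Primrec fun y : (Input × ℕ × ℕ × ℕ) × (ℕ × ℕ × ℕ × ℕ × Option (Bool × ℕ)) =>
      y.1.2.2.2 := Primrec.snd.comp (Primrec.snd.comp (Primrec.snd.comp Primrec.fst))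
  have ho : Primrec fun y : (Input × ℕ × ℕ × ℕ) × (ℕ × ℕ × ℕ × ℕ × Option (Bool × ℕ)) =>
      y.2.2.2.2 := Primrec.snd.comp (Primrec.snd.comp (Primrec.snd.comp Primrec.snd))
  refine (Primrec.eq.comp (Primrec.fst.comp Primrec.snd)
    (Primrec.fst.comp (Primrec.snd.comp Primrec.fst))).and ?_
  refine (Primrec.eq.comp (Primrec.fst.comp (Primrec.snd.comp Primrec.snd))
    (Primrec.cond hi hb ha)).and ?_
  refine (Primrec.eq.comp (Primrec.fst.comp (Primrec.snd.comp (Primrec.snd.comp Primrec.snd)))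
    (Primrec.cond hi ha hb)).and ?_
  refine (Primrec.nat_lt.comp (Primrec.fst.comp ho)
    (primrec_numLoc.comp (Primrec.fst.comp Primrec.fst))).and ?_
  exact PrimrecPred.forall_mem (Primrec.optionToList.comp (Primrec.snd.comp ho))
    (p := fun w => w.2.2 < w.1.1.1.numMsg)
    (Primrec.nat_lt.comp (Primrec.snd.comp Primrec.snd)
      (primrec_numMsg.comp (Primrec.fst.comp (Primrec.fst.comp Primrec.fst))))

theorem primrec_ops : Primrec fun y : Input × ℕ × ℕ × ℕ => y.1.ops y.2.1 y.2.2.1 y.2.2.2 := by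
  have h : Primrec fun y : Input × ℕ × ℕ × ℕ => y.1.1.2.1 :=
    Primrec.fst.comp (Primrec.snd.comp (Primrec.fst.comp Primrec.fst))
  exact Primrec.list_map (Primrec.list_filter' h primrecPred_isEntry)
    (Primrec.snd.comp (Primrec.snd.comp (Primrec.snd.comp Primrec.snd))).to₂

theorem primrec_applyOp : Primrec fun y : Option (Bool × ℕ) × List ℕ => applyOp y.1 y.2 := by
  have hz1 : Primrec fun y : (Option (Bool × ℕ) × List ℕ) × (Bool × ℕ) => y.2.1 :=
    Primrec.fst.comp Primrec.snd
  have hz2 : Primrec fun y : (Option (Bool × ℕ) × List ℕ) × (Bool × ℕ) => y.2.2 :=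
    Primrec.snd.comp Primrec.snd
  have hμ : Primrec fun y : (Option (Bool × ℕ) × List ℕ) × (Bool × ℕ) => y.1.2 :=
    Primrec.snd.comp Primrec.fst
  refine Primrec.option_casesOn (o := fun y : Option (Bool × ℕ) × List ℕ => y.1)
    (f := fun y => some y.2) (g := fun y z => cond z.1
      (if y.2.getLast? = some z.2 then some y.2.dropLast else none) (some (z.2 :: y.2)))
    Primrec.fst (Primrec.option_some.comp Primrec.snd) ?_
  exact Primrec.cond hz1 (Primrec.ite (Primrec.eq.comp (AutCode.primrec_getLast?.comp hμ)
    (Primrec.option_some.comp hz2)) (Primrec.option_some.comp (AutCode.primrec_dropLast.comp hμ))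
    (Primrec.const none)) (Primrec.option_some.comp (Primrec.list_cons.comp hz2 hμ))

end primrec

/-! ## Predicates on configurations that are evaluated by the algorithm -/

/-- The outcome can lead into a given set of configurations, after message losses. -/
def Hits (k : ℕ) (e : AutCode) (o : ℕ × Option (Bool × ℕ)) (μ : List ℕ) : Prop :=
  ∃ ν ∈ (applyOp o.2 μ).toList, AutCode.Mem (AutCode.up k e) (o.1, ν)

namespace Input

/-- The action of the player is allowed. -/
def Allowed (x : Input) (s : ℕ × List ℕ) (a : ℕ) : Prop :=
  ∀ b < x.numOpp, ∀ o ∈ x.ops s.1 a b, ¬ applyOp o.2 s.2 = none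

/-- The action of the opponent is allowed. -/
def AllowedOpp (x : Input) (s : ℕ × List ℕ) (b : ℕ) : Prop :=
  ∀ a < x.numAct, ∀ o ∈ x.ops s.1 a b, ¬ applyOp o.2 s.2 = none

/-- The action of the player is allowed and does not lead into the states of `N`. -/
def Keep (x : Input) (N : AutCode) (s : ℕ × List ℕ) (a : ℕ) : Prop :=
  x.Allowed s a ∧ ∀ b < x.numOpp, x.AllowedOpp s b → ∀ o ∈ x.ops s.1 a b, ¬ Hits x.numMsg N o s.2

/-- One step of the computation of the states from which the player can reach the target. -/
def ReachStep (x : Input) (N X : AutCode) (s : ℕ × List ℕ) : Prop :=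
  ¬ AutCode.Mem N s ∧ (AutCode.Mem x.target s ∨ ∀ b < x.numOpp, x.AllowedOpp s b →
    ∃ a < x.numAct, x.Keep N s a ∧ ∃ o ∈ x.ops s.1 a b, Hits x.numMsg X o s.2)

/-- One step of the computation of the states from which the opponent can reach `T`. -/
def AvoidStep (x : Input) (N T X : AutCode) (s : ℕ × List ℕ) : Prop :=
  ¬ AutCode.Mem N s ∧ (AutCode.Mem T s ∨ ¬ AutCode.Mem x.target s ∧
    ∀ a < x.numAct, x.Keep N s a →
      ∃ b < x.numOpp, x.AllowedOpp s b ∧ ∃ o ∈ x.ops s.1 a b, Hits x.numMsg X o s.2)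

/-- The actions of a uniform strategy of the player. -/
def Reach (x : Input) (N : AutCode) (s : ℕ × List ℕ) (a : ℕ) : Prop :=
  x.Allowed s a ∧ (¬ AutCode.Mem N s → ¬ AutCode.Mem x.target s → x.Keep N s a)

/-- The actions of a uniform strategy of the opponent, for a list of triples `(C, N, E)` where `E` is
the complement of `C`. -/
def Avoid (x : Input) (L : List (AutCode × AutCode × AutCode)) (s : ℕ × List ℕ) (b : ℕ) : Prop :=
  x.AllowedOpp s b ∧ ∀ z ∈ L, AutCode.Mem z.1 s → ∀ a < x.numAct, x.Keep z.2.1 s a →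
    ∀ o ∈ x.ops s.1 a b, ¬ Hits x.numMsg z.2.2 o s.2

end Input

section primrec

variable {α : Type} [Primcodable α]

theorem primrecPred_hits {k : α → ℕ} {e : α → AutCode} {o : α → ℕ × Option (Bool × ℕ)}
    {μ : α → List ℕ} (hk : Primrec k) (he : Primrec e) (ho : Primrec o) (hμ : Primrec μ) :
    PrimrecPred fun y => Hits (k y) (e y) (o y) (μ y) :=
  PrimrecPred.exists_mem (Primrec.optionToList.comp
      (primrec_applyOp.comp ((Primrec.snd.comp ho).pair hμ)))
    (p := fun z => AutCode.Mem (AutCode.up (k z.1) (e z.1)) ((o z.1).1, z.2))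
    (AutCode.primrecPred_mem.comp ((AutCode.primrec_up.comp
      ((hk.comp Primrec.fst).pair (he.comp Primrec.fst))).pair
      (((Primrec.fst.comp ho).comp Primrec.fst).pair Primrec.snd)))

theorem primrecPred_mem_comp {e : α → AutCode} {s : α → ℕ × List ℕ}
    (he : Primrec e) (hs : Primrec s) : PrimrecPred fun y => AutCode.Mem (e y) (s y) :=
  AutCode.primrecPred_mem.comp (he.pair hs)

variable {x : α → Input} {s : α → ℕ × List ℕ} {a b : α → ℕ} {N T X : α → AutCode}

theorem primrec_ops_comp (hx : Primrec x) (hs : Primrec s) (ha : Primrec a) (hb : Primrec b) :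
    Primrec fun y => (x y).ops (s y).1 (a y) (b y) :=
  primrec_ops.comp (hx.pair ((Primrec.fst.comp hs).pair (ha.pair hb)))

theorem primrecPred_allowed (hx : Primrec x) (hs : Primrec s) (ha : Primrec a) :
    PrimrecPred fun y => (x y).Allowed (s y) (a y) := by
  refine PrimrecPred.forall_lt' (primrec_numOpp.comp hx) (p := fun z => ∀ o ∈
    (x z.1).ops (s z.1).1 (a z.1) z.2, ¬ applyOp o.2 (s z.1).2 = none) ?_
  refine PrimrecPred.forall_mem (primrec_ops_comp (hx.comp Primrec.fst) (hs.comp Primrec.fst)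
    (ha.comp Primrec.fst) Primrec.snd) (p := fun w => ¬ applyOp w.2.2 (s w.1.1).2 = none) ?_
  exact (Primrec.eq.comp (primrec_applyOp.comp ((Primrec.snd.comp Primrec.snd).pair
    ((Primrec.snd.comp hs).comp (Primrec.fst.comp Primrec.fst)))) (Primrec.const none)).not

theorem primrecPred_allowedOpp (hx : Primrec x) (hs : Primrec s) (hb : Primrec b) :
    PrimrecPred fun y => (x y).AllowedOpp (s y) (b y) := by
  refine PrimrecPred.forall_lt' (primrec_numAct.comp hx) (p := fun z => ∀ o ∈
    (x z.1).ops (s z.1).1 z.2 (b z.1), ¬ applyOp o.2 (s z.1).2 = none) ?_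
  refine PrimrecPred.forall_mem (primrec_ops_comp (hx.comp Primrec.fst) (hs.comp Primrec.fst)
    Primrec.snd (hb.comp Primrec.fst)) (p := fun w => ¬ applyOp w.2.2 (s w.1.1).2 = none) ?_
  exact (Primrec.eq.comp (primrec_applyOp.comp ((Primrec.snd.comp Primrec.snd).pair
    ((Primrec.snd.comp hs).comp (Primrec.fst.comp Primrec.fst)))) (Primrec.const none)).not

theorem primrecPred_exists_hits (hx : Primrec x) (hs : Primrec s) (ha : Primrec a) (hb : Primrec b)
    (hX : Primrec X) :
    PrimrecPred fun y => ∃ o ∈ (x y).ops (s y).1 (a y) (b y), Hits (x y).numMsg (X y) o (s y).2 :=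
  PrimrecPred.exists_mem (primrec_ops_comp hx hs ha hb)
    (p := fun z => Hits (x z.1).numMsg (X z.1) z.2 (s z.1).2)
    (primrecPred_hits (primrec_numMsg.comp (hx.comp Primrec.fst)) (hX.comp Primrec.fst) Primrec.snd
      (Primrec.snd.comp (hs.comp Primrec.fst)))

theorem primrecPred_forall_not_hits (hx : Primrec x) (hs : Primrec s) (ha : Primrec a)
    (hb : Primrec b) (hX : Primrec X) :
    PrimrecPred fun y => ∀ o ∈ (x y).ops (s y).1 (a y) (b y),
      ¬ Hits (x y).numMsg (X y) o (s y).2 :=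
  PrimrecPred.of_eq (primrecPred_exists_hits hx hs ha hb hX).not fun y => by push Not; rfl

theorem primrecPred_keep (hx : Primrec x) (hN : Primrec N) (hs : Primrec s) (ha : Primrec a) :
    PrimrecPred fun y => (x y).Keep (N y) (s y) (a y) := by
  refine (primrecPred_allowed hx hs ha).and ?_
  refine PrimrecPred.forall_lt' (primrec_numOpp.comp hx) (p := fun z =>
    (x z.1).AllowedOpp (s z.1) z.2 → ∀ o ∈ (x z.1).ops (s z.1).1 (a z.1) z.2,
      ¬ Hits (x z.1).numMsg (N z.1) o (s z.1).2) ?_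
  exact (primrecPred_allowedOpp (hx.comp Primrec.fst) (hs.comp Primrec.fst) Primrec.snd).imp
    (primrecPred_forall_not_hits (hx.comp Primrec.fst) (hs.comp Primrec.fst) (ha.comp Primrec.fst)
      Primrec.snd (hN.comp Primrec.fst))

theorem primrecPred_reachStep (hx : Primrec x) (hN : Primrec N) (hX : Primrec X)
    (hs : Primrec s) : PrimrecPred fun y => (x y).ReachStep (N y) (X y) (s y) := by
  refine (primrecPred_mem_comp hN hs).not.and
    ((primrecPred_mem_comp (primrec_target.comp hx) hs).or ?_)
  refine PrimrecPred.forall_lt' (primrec_numOpp.comp hx) (p := fun z =>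
    (x z.1).AllowedOpp (s z.1) z.2 → ∃ a < (x z.1).numAct, (x z.1).Keep (N z.1) (s z.1) a ∧
      ∃ o ∈ (x z.1).ops (s z.1).1 a z.2, Hits (x z.1).numMsg (X z.1) o (s z.1).2) ?_
  refine (primrecPred_allowedOpp (hx.comp Primrec.fst) (hs.comp Primrec.fst) Primrec.snd).imp ?_
  refine PrimrecPred.exists_lt' (primrec_numAct.comp (hx.comp Primrec.fst)) (p := fun w =>
    (x w.1.1).Keep (N w.1.1) (s w.1.1) w.2 ∧ ∃ o ∈ (x w.1.1).ops (s w.1.1).1 w.2 w.1.2,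
      Hits (x w.1.1).numMsg (X w.1.1) o (s w.1.1).2) ?_
  have h1 : Primrec fun w : (α × ℕ) × ℕ => w.1.1 := Primrec.fst.comp Primrec.fst
  exact (primrecPred_keep (hx.comp h1) (hN.comp h1) (hs.comp h1) Primrec.snd).and
    (primrecPred_exists_hits (hx.comp h1) (hs.comp h1) Primrec.snd
      (Primrec.snd.comp Primrec.fst) (hX.comp h1))

theorem primrecPred_avoidStep (hx : Primrec x) (hN : Primrec N) (hT : Primrec T) (hX : Primrec X)
    (hs : Primrec s) : PrimrecPred fun y => (x y).AvoidStep (N y) (T y) (X y) (s y) := by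
  refine (primrecPred_mem_comp hN hs).not.and ((primrecPred_mem_comp hT hs).or
    ((primrecPred_mem_comp (primrec_target.comp hx) hs).not.and ?_))
  refine PrimrecPred.forall_lt' (primrec_numAct.comp hx) (p := fun z =>
    (x z.1).Keep (N z.1) (s z.1) z.2 → ∃ b < (x z.1).numOpp, (x z.1).AllowedOpp (s z.1) b ∧
      ∃ o ∈ (x z.1).ops (s z.1).1 z.2 b, Hits (x z.1).numMsg (X z.1) o (s z.1).2) ?_
  refine (primrecPred_keep (hx.comp Primrec.fst) (hN.comp Primrec.fst) (hs.comp Primrec.fst)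
    Primrec.snd).imp ?_
  refine PrimrecPred.exists_lt' (primrec_numOpp.comp (hx.comp Primrec.fst)) (p := fun w =>
    (x w.1.1).AllowedOpp (s w.1.1) w.2 ∧ ∃ o ∈ (x w.1.1).ops (s w.1.1).1 w.1.2 w.2,
      Hits (x w.1.1).numMsg (X w.1.1) o (s w.1.1).2) ?_
  have h1 : Primrec fun w : (α × ℕ) × ℕ => w.1.1 := Primrec.fst.comp Primrec.fst
  exact (primrecPred_allowedOpp (hx.comp h1) (hs.comp h1) Primrec.snd).and
    (primrecPred_exists_hits (hx.comp h1) (hs.comp h1) (Primrec.snd.comp Primrec.fst) Primrec.snd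
      (hX.comp h1))

theorem primrecPred_reach (hx : Primrec x) (hN : Primrec N) (hs : Primrec s) (ha : Primrec a) :
    PrimrecPred fun y => (x y).Reach (N y) (s y) (a y) :=
  (primrecPred_allowed hx hs ha).and ((primrecPred_mem_comp hN hs).not.imp
    ((primrecPred_mem_comp (primrec_target.comp hx) hs).not.imp (primrecPred_keep hx hN hs ha)))

theorem primrecPred_avoid {L : α → List (AutCode × AutCode × AutCode)} (hx : Primrec x)
    (hL : Primrec L) (hs : Primrec s) (hb : Primrec b) :
    PrimrecPred fun y => (x y).Avoid (L y) (s y) (b y) := by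
  refine (primrecPred_allowedOpp hx hs hb).and ?_
  refine PrimrecPred.forall_mem hL (p := fun z => AutCode.Mem z.2.1 (s z.1) →
    ∀ a < (x z.1).numAct, (x z.1).Keep z.2.2.1 (s z.1) a → ∀ o ∈ (x z.1).ops (s z.1).1 a (b z.1),
      ¬ Hits (x z.1).numMsg z.2.2.2 o (s z.1).2) ?_
  refine (primrecPred_mem_comp (Primrec.fst.comp Primrec.snd) (hs.comp Primrec.fst)).imp ?_
  refine PrimrecPred.forall_lt' (primrec_numAct.comp (hx.comp Primrec.fst)) 
    (p := fun w : (α × (AutCode × AutCode × AutCode)) × ℕ =>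
    (x w.1.1).Keep w.1.2.2.1 (s w.1.1) w.2 → ∀ o ∈ (x w.1.1).ops (s w.1.1).1 w.2 (b w.1.1),
      ¬ Hits (x w.1.1).numMsg w.1.2.2.2 o (s w.1.1).2) ?_
  have h1 : Primrec fun w : (α × (AutCode × AutCode × AutCode)) × ℕ => w.1.1 :=
    Primrec.fst.comp Primrec.fst
  have h2 : Primrec fun w : (α × (AutCode × AutCode × AutCode)) × ℕ => w.1.2 :=
    Primrec.snd.comp Primrec.fst
  exact (primrecPred_keep (hx.comp h1) (Primrec.fst.comp (Primrec.snd.comp h2)) (hs.comp h1)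
    Primrec.snd).imp (primrecPred_forall_not_hits (hx.comp h1) (hs.comp h1) Primrec.snd
      (hb.comp h1) (Primrec.snd.comp (Primrec.snd.comp h2)))

end primrec

/-! ## Invariance under indistinguishability -/

section indist

variable {x : Input} {cs : List AutCode} {l : ℕ} {μ μ' : List ℕ}

theorem Indist.applyOp_eq_none {n k : ℕ} (h : Indist cs n k μ μ') (f : Option (Bool × ℕ)) :
    applyOp f μ = none ↔ applyOp f μ' = none := by
  rcases f with _ | ⟨_ | _, m⟩
  · simp [applyOp]
  · simp [applyOp]
  · simp [applyOp, h.last]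

/-- The three kinds of operations correspond to the three membership conditions of `Indist`; losses
are already accounted for by the automaton `up`. -/
theorem Indist.hits (h : Indist cs x.numLoc x.numMsg μ μ') {X : AutCode}
    (hX : AutCode.up x.numMsg X ∈ cs) {l a b : ℕ} {o : ℕ × Option (Bool × ℕ)}
    (ho : o ∈ x.ops l a b) : Hits x.numMsg X o μ ↔ Hits x.numMsg X o μ' := by
  obtain ⟨-, h1, h2⟩ := Input.mem_ops.1 ho
  obtain ⟨l', f⟩ := o
  rcases f with _ | ⟨_ | _, m⟩
  · simpa [Hits, applyOp] using h.mem _ hX l' h1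
  · simpa [Hits, applyOp] using h.mem_cons _ hX l' h1 m (h2 (false, m) (by simp))
  · simp only [Hits, applyOp, cond_true, h.last]
    split_ifs
    · simpa using h.mem_dropLast _ hX l' h1
    · simp

theorem Indist.allowed (h : Indist cs x.numLoc x.numMsg μ μ') (a : ℕ) :
    x.Allowed (l, μ) a ↔ x.Allowed (l, μ') a :=
  forall₂_congr fun _ _ => forall₂_congr fun o _ => not_congr (h.applyOp_eq_none o.2)

theorem Indist.allowedOpp (h : Indist cs x.numLoc x.numMsg μ μ') (b : ℕ) :
    x.AllowedOpp (l, μ) b ↔ x.AllowedOpp (l, μ') b :=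
  forall₂_congr fun _ _ => forall₂_congr fun o _ => not_congr (h.applyOp_eq_none o.2)

theorem Indist.exists_hits (h : Indist cs x.numLoc x.numMsg μ μ') {X : AutCode}
    (hX : AutCode.up x.numMsg X ∈ cs) (l a b : ℕ) :
    (∃ o ∈ x.ops l a b, Hits x.numMsg X o μ) ↔ ∃ o ∈ x.ops l a b, Hits x.numMsg X o μ' :=
  exists_congr fun _ => and_congr_right fun ho => h.hits hX ho

theorem Indist.keep (h : Indist cs x.numLoc x.numMsg μ μ') {N : AutCode}
    (hN : AutCode.up x.numMsg N ∈ cs) (a : ℕ) : x.Keep N (l, μ) a ↔ x.Keep N (l, μ') a :=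
  and_congr (h.allowed a) (forall₂_congr fun b _ => imp_congr (h.allowedOpp b)
    (forall₂_congr fun _ ho => not_congr (h.hits hN ho)))

theorem Indist.reachStep (h : Indist cs x.numLoc x.numMsg μ μ') {N X : AutCode} (hN : N ∈ cs)
    (hN' : AutCode.up x.numMsg N ∈ cs) (hX : AutCode.up x.numMsg X ∈ cs) (hr : x.target ∈ cs)
    (hl : l < x.numLoc) : x.ReachStep N X (l, μ) ↔ x.ReachStep N X (l, μ') :=
  and_congr (not_congr (h.mem _ hN l hl)) (or_congr (h.mem _ hr l hl)
    (forall₂_congr fun b _ => imp_congr (h.allowedOpp b) (exists_congr fun a =>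
      and_congr_right fun _ => and_congr (h.keep hN' a) (h.exists_hits hX l a b))))

theorem Indist.avoidStep (h : Indist cs x.numLoc x.numMsg μ μ') {N T X : AutCode} (hN : N ∈ cs)
    (hN' : AutCode.up x.numMsg N ∈ cs) (hT : T ∈ cs) (hX : AutCode.up x.numMsg X ∈ cs)
    (hr : x.target ∈ cs) (hl : l < x.numLoc) :
    x.AvoidStep N T X (l, μ) ↔ x.AvoidStep N T X (l, μ') :=
  and_congr (not_congr (h.mem _ hN l hl)) (or_congr (h.mem _ hT l hl)
    (and_congr (not_congr (h.mem _ hr l hl)) (forall₂_congr fun a _ => imp_congr (h.keep hN' a)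
      (exists_congr fun b => and_congr_right fun _ => and_congr (h.allowedOpp b)
        (h.exists_hits hX l a b)))))

theorem Indist.reach (h : Indist cs x.numLoc x.numMsg μ μ') {N : AutCode} (hN : N ∈ cs)
    (hN' : AutCode.up x.numMsg N ∈ cs) (hr : x.target ∈ cs) (hl : l < x.numLoc) (a : ℕ) :
    x.Reach N (l, μ) a ↔ x.Reach N (l, μ') a :=
  and_congr (h.allowed a) (imp_congr (not_congr (h.mem _ hN l hl))
    (imp_congr (not_congr (h.mem _ hr l hl)) (h.keep hN' a)))

theorem Indist.avoid (h : Indist cs x.numLoc x.numMsg μ μ')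
    {L : List (AutCode × AutCode × AutCode)} (hL : ∀ z ∈ L, z.1 ∈ cs ∧
      AutCode.up x.numMsg z.2.1 ∈ cs ∧ AutCode.up x.numMsg z.2.2 ∈ cs) (hl : l < x.numLoc) (b : ℕ) :
    x.Avoid L (l, μ) b ↔ x.Avoid L (l, μ') b :=
  and_congr (h.allowedOpp b) (forall₂_congr fun z hz => imp_congr (h.mem _ (hL z hz).1 l hl)
    (forall₂_congr fun a _ => imp_congr (h.keep (hL z hz).2.1 a)
      (forall₂_congr fun _ ho => not_congr (h.hits (hL z hz).2.2 ho))))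

end indist

end LossyGame

namespace LossyGame

/-! ## Computation of least fixed points -/

/-- The upward closure of the first set of configurations is contained in that of the second. -/
def UpLe (n k : ℕ) (e e' : AutCode) : Prop :=
  ∀ l < n, ∀ μ, Valid k μ → AutCode.Mem (AutCode.up k e) (l, μ) →
    AutCode.Mem (AutCode.up k e') (l, μ)

theorem computablePred_upLe :
    ComputablePred fun y : (ℕ × ℕ) × AutCode × AutCode => UpLe y.1.1 y.1.2 y.2.1 y.2.2 := by
  have h1 : Primrec fun y : (ℕ × ℕ) × AutCode × AutCode => AutCode.up y.1.2 y.2.1 :=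
    AutCode.primrec_up.comp ((Primrec.snd.comp Primrec.fst).pair (Primrec.fst.comp Primrec.snd))
  have h2 : Primrec fun y : (ℕ × ℕ) × AutCode × AutCode => AutCode.up y.1.2 y.2.2 :=
    AutCode.primrec_up.comp ((Primrec.snd.comp Primrec.fst).pair (Primrec.snd.comp Primrec.snd))
  refine computablePred_forall (n := fun y : (ℕ × ℕ) × AutCode × AutCode => y.1.1)
    (k := fun y => y.1.2) (cs := fun y => [AutCode.up y.1.2 y.2.1, AutCode.up y.1.2 y.2.2])
    (Primrec.fst.comp Primrec.fst) (Primrec.snd.comp Primrec.fst)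
    (Primrec.list_cons.comp h1 (Primrec.list_cons.comp h2 (Primrec.const [])))
    (p := fun y s => AutCode.Mem (AutCode.up y.1.2 y.2.1) s → AutCode.Mem (AutCode.up y.1.2 y.2.2) s)
    ((primrecPred_mem_comp (h1.comp Primrec.fst) Primrec.snd).imp
      (primrecPred_mem_comp (h2.comp Primrec.fst) Primrec.snd)) ?_
  exact fun y μ μ' _ _ h l hl => imp_congr (h.mem _ (by simp) l hl) (h.mem _ (by simp) l hl)

theorem Valid.sublist {k : ℕ} {μ ν : List ℕ} (h : Valid k μ) (hν : ν.Sublist μ) : Valid k ν :=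
  fun m hm => h m (hν.subset hm)

/-- Higman's lemma: the upward closures of an increasing sequence of sets of configurations become
stable. -/
theorem exists_upLe {n k : ℕ} {Z : ℕ → AutCode} (hZ : ∀ m, ∀ l < n, ∀ μ, Valid k μ →
    AutCode.Mem (Z m) (l, μ) → AutCode.Mem (Z (m + 1)) (l, μ)) :
    ∃ m, UpLe n k (Z (m + 1)) (Z m) := by
  by_contra! hcon
  have hmono : ∀ m m', m ≤ m' → ∀ l < n, ∀ μ, Valid k μ →
      AutCode.Mem (Z m) (l, μ) → AutCode.Mem (Z m') (l, μ) := by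
    intro m m' h l hl μ hμ hm
    induction h with
    | refl => exact hm
    | step _ ih => exact hZ _ l hl μ hμ ih
  -- As long as the closures grow, each step has a new configuration above no earlier one. Two
  -- comparable members of this sequence give the contradiction.
  have hex : ∀ m, ∃ s : ℕ × List ℕ, s.1 < n ∧ Valid k s.2 ∧ AutCode.Mem (Z (m + 1)) s ∧
      ∀ ν, ν.Sublist s.2 → ¬ AutCode.Mem (Z m) (s.1, ν) := by
    intro m
    have h := hcon m
    simp only [UpLe, not_forall] at h
    obtain ⟨l, hl, μ, hμ, h1, h2⟩ := h
    rw [AutCode.mem_up_iff hμ] at h1 h2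
    obtain ⟨ν, hν, h1⟩ := h1
    exact ⟨(l, ν), hl, hμ.sublist hν, h1, fun ν' hν' h3 => h2 ⟨ν', hν'.trans hν, h3⟩⟩
  choose s h1 h2 h3 h4 using hex
  -- Finitely many locations, times words over a finite alphabet, for which Higman's lemma is
  -- invoked.
  have hpwo : {t : ℕ × List ℕ | t.1 < n ∧ Valid k t.2}.PartiallyWellOrderedOn
      fun t u => t.1 = u.1 ∧ List.SublistForall₂ Eq t.2 u.2 := by
    have hl : {l : ℕ | l < n}.PartiallyWellOrderedOn Eq := (Set.finite_lt_nat n).partiallyWellOrderedOn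
    have hw : {w : List ℕ | ∀ m ∈ w, m ∈ {m : ℕ | m < k}}.PartiallyWellOrderedOn
        (List.SublistForall₂ Eq) :=
      Set.PartiallyWellOrderedOn.partiallyWellOrderedOn_sublistForall₂ Eq
        (Set.finite_lt_nat k).partiallyWellOrderedOn
    exact hl.prod hw
  obtain ⟨m, m', hlt, heq, hsub⟩ := Set.partiallyWellOrderedOn_iff_exists_lt.1 hpwo s
    fun m => ⟨h1 m, h2 m⟩
  rw [List.sublistForall₂_iff] at hsub
  obtain ⟨ν, hν, hsub⟩ := hsub
  rw [List.forall₂_eq_eq_eq] at hν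
  subst hν
  refine h4 m' _ hsub ?_
  rw [← heq]
  exact hmono (m + 1) m' hlt _ (h1 m) _ (h2 m) (h3 m)

/-- The sequence of sets of configurations that arises by iteration from the empty set. -/
def iter {α : Type} (F : α × AutCode → AutCode) (x : α) (m : ℕ) : AutCode :=
  Nat.rec ([], [], []) (fun _ e => F (x, e)) m

theorem not_mem_iter_zero {α : Type} (F : α × AutCode → AutCode) (x : α) (s : ℕ × List ℕ) :
    ¬ AutCode.Mem (iter F x 0) s := by
  simp [iter, AutCode.mem_iff]

theorem primrec_up_comp {α : Type} [Primcodable α] {k : α → ℕ} {e : α → AutCode} (hk : Primrec k)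
    (he : Primrec e) : Primrec fun y => AutCode.up (k y) (e y) :=
  AutCode.primrec_up.comp (hk.pair he)

section lfp

variable {α : Type} [Primcodable α]

theorem computable_iter {F : α × AutCode → AutCode} (hF : Computable F) :
    Computable₂ fun (x : α) (m : ℕ) => iter F x m :=
  Computable.nat_rec (f := fun y : α × ℕ => y.2) (g := fun _ => (([], [], []) : AutCode))
    (h := fun y z => F (y.1, z.2)) Computable.snd (Computable.const _)
    (hF.comp ((Computable.fst.comp Computable.fst).pair (Computable.snd.comp Computable.snd)))

/-- Equality of the iterates need not be tested: comparing upward closures is decidable and succeeds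
eventually by `exists_upLe`. -/
theorem exists_computable_stable {F : α × AutCode → AutCode} (hF : Computable F) {n k : α → ℕ}
    (hn : Computable n) (hk : Computable k)
    (hmono : ∀ x e, ∀ l < n x, ∀ μ, Valid (k x) μ → AutCode.Mem e (l, μ) →
      AutCode.Mem (F (x, e)) (l, μ)) :
    ∃ M : α → ℕ, Computable M ∧ ∀ x, UpLe (n x) (k x) (iter F x (M x + 1)) (iter F x (M x)) := by
  refine exists_computable_choice (p := fun x m => UpLe (n x) (k x) (iter F x (m + 1)) (iter F x m))
    ?_ fun x => exists_upLe fun m => hmono x _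
  exact computablePred_upLe.comp (f := fun y : α × ℕ =>
      ((n y.1, k y.1), iter F y.1 (y.2 + 1), iter F y.1 y.2))
    (((hn.comp Computable.fst).pair (hk.comp Computable.fst)).pair
      (((computable_iter hF).comp Computable.fst (Computable.succ.comp Computable.snd)).pair
        ((computable_iter hF).comp Computable.fst Computable.snd)))

end lfp

namespace Input

/-- `e` accepts the least fixed point of `fun X => X ∪ p X`, which is reached by iteration. -/
def IsLfp (x : Input) (p : AutCode → ℕ × List ℕ → Prop) (e : AutCode) : Prop :=
  ∃ (Z : ℕ → AutCode) (m : ℕ), (∀ s, ¬ AutCode.Mem (Z 0) s) ∧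
    (∀ m, ∀ l < x.numLoc, ∀ μ, Valid x.numMsg μ → (AutCode.Mem (Z (m + 1)) (l, μ) ↔
      AutCode.Mem (Z m) (l, μ) ∨ p (Z m) (l, μ))) ∧
    UpLe x.numLoc x.numMsg (Z (m + 1)) (Z m) ∧ e = Z (m + 1)

/-- In `hind` the set `X` enters only through its upward closure. Keeping the old set in the union
makes the iterates increase for every input. -/
theorem exists_computable_lfp {α : Type} [Primcodable α] {x : α → Input} (hx : Primrec x)
    {p : α → AutCode → ℕ × List ℕ → Prop}
    (hp : PrimrecPred fun y : (α × AutCode) × (ℕ × List ℕ) => p y.1.1 y.1.2 y.2)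
    {cs : α → List AutCode} (hcs : Primrec cs)
    (hind : ∀ z X μ μ', Indist (AutCode.up (x z).numMsg X :: cs z) (x z).numLoc (x z).numMsg μ μ' →
      ∀ l < (x z).numLoc, p z X (l, μ) ↔ p z X (l, μ')) :
    ∃ L : α → AutCode, Computable L ∧ ∀ z, (x z).IsLfp (p z) (L z) := by
  have hx' : Primrec fun y : α × AutCode => x y.1 := hx.comp Primrec.fst
  obtain ⟨F, hF, hF'⟩ := exists_computable_autCode (α := α × AutCode) (n := fun y => (x y.1).numLoc)
    (k := fun y => (x y.1).numMsg) (cs := fun y => y.2 :: AutCode.up (x y.1).numMsg y.2 :: cs y.1)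
    (primrec_numLoc.comp hx') (primrec_numMsg.comp hx')
    (Primrec.list_cons.comp Primrec.snd (Primrec.list_cons.comp (primrec_up_comp
      (primrec_numMsg.comp hx') Primrec.snd) (hcs.comp Primrec.fst)))
    (p := fun y s => AutCode.Mem y.2 s ∨ p y.1 y.2 s)
    ((primrecPred_mem_comp (Primrec.snd.comp Primrec.fst) Primrec.snd).or hp)
    (fun y μ μ' _ _ h l hl => or_congr (h.mem _ (by simp) l hl)
      (hind y.1 y.2 μ μ' (h.mono fun e he => List.mem_cons_of_mem _ he) l hl))
  obtain ⟨M, hM, hM'⟩ := exists_computable_stable hF (primrec_numLoc.comp hx).to_comp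
    (primrec_numMsg.comp hx).to_comp fun z e l hl μ hμ h => (hF' (z, e) l hl μ hμ).2 (Or.inl h)
  refine ⟨fun z => iter F z (M z + 1), (computable_iter hF).comp Computable.id
    (Computable.succ.comp hM), fun z => ⟨iter F z, M z, not_mem_iter_zero F z, ?_, hM' z, rfl⟩⟩
  exact fun m l hl μ hμ => hF' (z, iter F z m) l hl μ hμ

theorem exists_computable_union : ∃ F : Input × AutCode × AutCode → AutCode, Computable F ∧
    ∀ x a b, ∀ l < numLoc x, ∀ μ, Valid x.numMsg μ →
      (AutCode.Mem (F (x, a, b)) (l, μ) ↔ AutCode.Mem a (l, μ) ∨ AutCode.Mem b (l, μ)) := by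
  have ha : Primrec fun y : Input × AutCode × AutCode => y.2.1 := Primrec.fst.comp Primrec.snd
  have hb : Primrec fun y : Input × AutCode × AutCode => y.2.2 := Primrec.snd.comp Primrec.snd
  obtain ⟨F, hF, hF'⟩ := exists_computable_autCode (α := Input × AutCode × AutCode)
    (n := fun y => y.1.numLoc) (k := fun y => y.1.numMsg) (cs := fun y => [y.2.1, y.2.2])
    (primrec_numLoc.comp Primrec.fst) (primrec_numMsg.comp Primrec.fst)
    (Primrec.list_cons.comp ha (Primrec.list_cons.comp hb (Primrec.const [])))
    (p := fun y s => AutCode.Mem y.2.1 s ∨ AutCode.Mem y.2.2 s)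
    ((primrecPred_mem_comp (ha.comp Primrec.fst) Primrec.snd).or
      (primrecPred_mem_comp (hb.comp Primrec.fst) Primrec.snd))
    (fun y μ μ' _ _ h l hl => or_congr (h.mem _ (by simp) l hl) (h.mem _ (by simp) l hl))
  exact ⟨F, hF, fun x a b => hF' (x, a, b)⟩

theorem exists_computable_neither : ∃ F : Input × AutCode × AutCode → AutCode, Computable F ∧
    ∀ x a b, ∀ l < numLoc x, ∀ μ, Valid x.numMsg μ →
      (AutCode.Mem (F (x, a, b)) (l, μ) ↔ ¬ AutCode.Mem a (l, μ) ∧ ¬ AutCode.Mem b (l, μ)) := by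
  have ha : Primrec fun y : Input × AutCode × AutCode => y.2.1 := Primrec.fst.comp Primrec.snd
  have hb : Primrec fun y : Input × AutCode × AutCode => y.2.2 := Primrec.snd.comp Primrec.snd
  obtain ⟨F, hF, hF'⟩ := exists_computable_autCode (α := Input × AutCode × AutCode)
    (n := fun y => y.1.numLoc) (k := fun y => y.1.numMsg) (cs := fun y => [y.2.1, y.2.2])
    (primrec_numLoc.comp Primrec.fst) (primrec_numMsg.comp Primrec.fst)
    (Primrec.list_cons.comp ha (Primrec.list_cons.comp hb (Primrec.const [])))
    (p := fun y s => ¬ AutCode.Mem y.2.1 s ∧ ¬ AutCode.Mem y.2.2 s)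
    ((primrecPred_mem_comp (ha.comp Primrec.fst) Primrec.snd).not.and
      (primrecPred_mem_comp (hb.comp Primrec.fst) Primrec.snd).not)
    (fun y μ μ' _ _ h l hl => and_congr (not_congr (h.mem _ (by simp) l hl))
      (not_congr (h.mem _ (by simp) l hl)))
  exact ⟨F, hF, fun x a b => hF' (x, a, b)⟩

theorem exists_computable_reach : ∃ L : Input × AutCode → AutCode, Computable L ∧
    ∀ (x : Input) N, x.IsLfp (x.ReachStep N) (L (x, N)) := by
  have hx : Primrec fun y : Input × AutCode => y.1 := Primrec.fst
  obtain ⟨L, hL, hL'⟩ := exists_computable_lfp (α := Input × AutCode) (x := fun y => y.1) hx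
    (p := fun y X s => y.1.ReachStep y.2 X s)
    (primrecPred_reachStep (x := fun y : ((Input × AutCode) × AutCode) × (ℕ × List ℕ) => y.1.1.1)
      (N := fun y => y.1.1.2) (X := fun y => y.1.2) (s := fun y => y.2)
      (Primrec.fst.comp (Primrec.fst.comp Primrec.fst))
      (Primrec.snd.comp (Primrec.fst.comp Primrec.fst)) (Primrec.snd.comp Primrec.fst) Primrec.snd)
    (cs := fun y => [y.2, AutCode.up y.1.numMsg y.2, y.1.target])
    (Primrec.list_cons.comp Primrec.snd (Primrec.list_cons.comp
      (primrec_up_comp (primrec_numMsg.comp hx) Primrec.snd)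
      (Primrec.list_cons.comp (primrec_target.comp hx) (Primrec.const []))))
    (fun z X μ μ' h l hl => h.reachStep (by simp) (by simp) (by simp) (by simp) hl)
  exact ⟨L, hL, fun x N => hL' (x, N)⟩

theorem exists_computable_avoid : ∃ L : Input × AutCode × AutCode → AutCode, Computable L ∧
    ∀ (x : Input) N T, x.IsLfp (x.AvoidStep N T) (L (x, N, T)) := by
  have hx : Primrec fun y : Input × AutCode × AutCode => y.1 := Primrec.fst
  have hN : Primrec fun y : Input × AutCode × AutCode => y.2.1 := Primrec.fst.comp Primrec.snd
  have hT : Primrec fun y : Input × AutCode × AutCode => y.2.2 := Primrec.snd.comp Primrec.snd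
  have h11 : Primrec fun y : ((Input × AutCode × AutCode) × AutCode) × (ℕ × List ℕ) => y.1.1 :=
    Primrec.fst.comp Primrec.fst
  obtain ⟨L, hL, hL'⟩ := exists_computable_lfp (α := Input × AutCode × AutCode)
    (x := fun y => y.1) hx (p := fun y X s => y.1.AvoidStep y.2.1 y.2.2 X s)
    (primrecPred_avoidStep (hx.comp h11) (hN.comp h11) (hT.comp h11)
      (Primrec.snd.comp Primrec.fst) Primrec.snd)
    (cs := fun y => [y.2.1, AutCode.up y.1.numMsg y.2.1, y.2.2, y.1.target])
    (Primrec.list_cons.comp hN (Primrec.list_cons.comp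
      (primrec_up_comp (primrec_numMsg.comp hx) hN)
      (Primrec.list_cons.comp hT
        (Primrec.list_cons.comp (primrec_target.comp hx) (Primrec.const [])))))
    (fun z X μ μ' h l hl => h.avoidStep (by simp) (by simp) (by simp) (by simp) (by simp) hl)
  exact ⟨L, hL, fun x N T => hL' (x, N, T)⟩

/-- Codes for the rounds of the algorithm: `N k` is the complement of `D k`, `E k` is the complement
of `C k`. The algorithm has terminated after round `K + 1`. -/
structure RoundCodes (x : Input) (N Y C D E : ℕ → AutCode) (K : ℕ) : Prop where
  zero : ∀ s, ¬ AutCode.Mem (N 0) s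
  reach : ∀ k, x.IsLfp (x.ReachStep (N k)) (Y k)
  mem_C : ∀ k, ∀ l < x.numLoc, ∀ μ, Valid x.numMsg μ → (AutCode.Mem (C k) (l, μ) ↔
    ¬ AutCode.Mem (N k) (l, μ) ∧ ¬ AutCode.Mem (Y k) (l, μ))
  succ : ∀ k, ∃ P, x.IsLfp (x.AvoidStep (N k) (C k)) P ∧ ∀ l < x.numLoc, ∀ μ, Valid x.numMsg μ →
    (AutCode.Mem (N (k + 1)) (l, μ) ↔ AutCode.Mem (N k) (l, μ) ∨ AutCode.Mem P (l, μ))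
  mem_D : ∀ k, ∀ l < x.numLoc, ∀ μ, Valid x.numMsg μ → (AutCode.Mem (D k) (l, μ) ↔
    ¬ AutCode.Mem (N k) (l, μ))
  mem_E : ∀ k, ∀ l < x.numLoc, ∀ μ, Valid x.numMsg μ → (AutCode.Mem (E k) (l, μ) ↔
    ¬ AutCode.Mem (C k) (l, μ))
  stable : UpLe x.numLoc x.numMsg (N (K + 1)) (N K)

/-- The iteration runs on the complements of the sets `D k`: these increase, as the stabilisation of
upward closures requires. -/
theorem exists_computable_roundCodes : ∃ (N Y C D E : Input → ℕ → AutCode) (K : Input → ℕ),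
    Computable₂ N ∧ Computable₂ Y ∧ Computable₂ C ∧ Computable₂ D ∧ Computable₂ E ∧ Computable K ∧
    ∀ x, RoundCodes x (N x) (Y x) (C x) (D x) (E x) (K x) := by
  obtain ⟨LY, hY, hY'⟩ := exists_computable_reach
  obtain ⟨LP, hP, hP'⟩ := exists_computable_avoid
  obtain ⟨U, hU, hU'⟩ := exists_computable_union
  obtain ⟨V, hV, hV'⟩ := exists_computable_neither
  let FC : Input × AutCode → AutCode := fun y => V (y.1, y.2, LY y)
  have hFC : Computable FC := hV.comp (Computable.fst.pair (Computable.snd.pair hY))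
  -- One round on complements: add the layers of the opponent with target `C`.
  let F : Input × AutCode → AutCode := fun y => U (y.1, y.2, LP (y.1, y.2, FC y))
  have hF : Computable F := hU.comp (Computable.fst.pair (Computable.snd.pair
    (hP.comp (Computable.fst.pair (Computable.snd.pair hFC)))))
  obtain ⟨K, hK, hK'⟩ := exists_computable_stable hF primrec_numLoc.to_comp primrec_numMsg.to_comp
    fun x e l hl μ hμ h => (hU' x e _ l hl μ hμ).2 (Or.inl h)
  have hN := computable_iter hF
  have hxN : Computable fun y : Input × ℕ => (y.1, iter F y.1 y.2) := Computable.fst.pair hN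
  have hC : Computable fun y : Input × ℕ => FC (y.1, iter F y.1 y.2) := hFC.comp hxN
  refine ⟨iter F, fun x k => LY (x, iter F x k), fun x k => FC (x, iter F x k),
    fun x k => V (x, iter F x k, iter F x k),
    fun x k => V (x, FC (x, iter F x k), FC (x, iter F x k)), K, hN, hY.comp hxN, hC,
    hV.comp (Computable.fst.pair (Computable.pair hN hN)),
    hV.comp (Computable.fst.pair (hC.pair hC)), hK, fun x => ⟨not_mem_iter_zero F x,
      fun k => hY' x _, fun k => hV' x _ _, fun k => ⟨_, hP' x _ _, hU' x _ _⟩,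
      fun k l hl μ hμ => ?_, fun k l hl μ hμ => ?_, hK' x⟩⟩
  · rw [hV' x _ _ l hl μ hμ, and_self]
  · rw [hV' x _ _ l hl μ hμ, and_self]

/-! ## Computation of strategies -/

open scoped Classical in
/-- A list of weights that are zero or one. -/
noncomputable def weights (n : ℕ) (p : ℕ → Prop) : List ℕ :=
  (List.range n).map fun a => if p a then 1 else 0

theorem primrec_weights {α : Type} [Primcodable α] {n : α → ℕ} (hn : Primrec n)
    {p : α → ℕ → Prop} (hp : PrimrecPred fun y : α × ℕ => p y.1 y.2) :
    Primrec fun y => weights (n y) (p y) := by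
  classical
  refine (Primrec.list_map (Primrec.list_range.comp hn) (g := fun y a => if p y a then 1 else 0)
    (Primrec.ite hp (Primrec.const 1) (Primrec.const 0))).of_eq fun y => ?_
  exact List.map_congr_left fun a _ => by congr

theorem weights_congr {n : ℕ} {p q : ℕ → Prop} (h : ∀ a < n, p a ↔ q a) :
    weights n p = weights n q := by
  classical
  refine List.map_congr_left fun a ha => ?_
  simp only [h a (List.mem_range.1 ha)]

theorem finite_range_weights {β : Type} (n : ℕ) (p : β → ℕ → Prop) :
    (Set.range fun s => weights n (p s)).Finite := by
  classical
  refine ((Finset.range n).powerset.finite_toSet.image fun S => weights n (· ∈ S)).subset ?_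
  rintro _ ⟨s, rfl⟩
  refine ⟨(Finset.range n).filter (p s),
    Finset.mem_coe.2 (Finset.mem_powerset.2 (Finset.filter_subset _ _)), weights_congr fun a ha => ?_⟩
  simp [ha]

theorem exists_computable_reachStrat : ∃ F : Input × AutCode → StratCode, Computable F ∧
    ∀ (x : Input) N, ∀ l < x.numLoc, ∀ μ, Valid x.numMsg μ →
      (∃ e : AutCode × List ℕ, e ∈ F (x, N) ∧ AutCode.Mem e.1 (l, μ)) ∧
      ∀ e : AutCode × List ℕ, e ∈ F (x, N) → AutCode.Mem e.1 (l, μ) →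
        e.2 = weights x.numAct (x.Reach N (l, μ)) := by
  have hx : Primrec fun y : Input × AutCode => y.1 := Primrec.fst
  have h11 : Primrec fun y : ((Input × AutCode) × (ℕ × List ℕ)) × ℕ => y.1.1 :=
    Primrec.fst.comp Primrec.fst
  obtain ⟨F, hF, hF'⟩ := exists_computable_stratCode (α := Input × AutCode)
    (n := fun y => y.1.numLoc) (k := fun y => y.1.numMsg) (primrec_numLoc.comp hx)
    (primrec_numMsg.comp hx) (cs := fun y => [y.2, AutCode.up y.1.numMsg y.2, y.1.target])
    (Primrec.list_cons.comp Primrec.snd (Primrec.list_cons.comp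
      (primrec_up_comp (primrec_numMsg.comp hx) Primrec.snd)
      (Primrec.list_cons.comp (primrec_target.comp hx) (Primrec.const []))))
    (wt := fun y s => weights y.1.numAct (y.1.Reach y.2 s))
    (primrec_weights (primrec_numAct.comp (hx.comp Primrec.fst))
      (p := fun y a => y.1.1.Reach y.1.2 y.2 a)
      (primrecPred_reach (hx.comp h11) (Primrec.snd.comp h11) (Primrec.snd.comp Primrec.fst)
        Primrec.snd))
    (fun y => finite_range_weights _ _)
    (fun y μ μ' _ _ h l hl => weights_congr fun a _ =>
      h.reach (by simp) (by simp) (by simp) hl a)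
  exact ⟨F, hF, fun x N => hF' (x, N)⟩

theorem exists_computable_avoidStrat_aux {α : Type} [Primcodable α] {x : α → Input}
    {L : α → List (AutCode × AutCode × AutCode)} (hx : Primrec x) (hL : Primrec L) :
    ∃ F : α → StratCode, Computable F ∧
    ∀ y, ∀ l < (x y).numLoc, ∀ μ, Valid (x y).numMsg μ →
      (∃ e : AutCode × List ℕ, e ∈ F y ∧ AutCode.Mem e.1 (l, μ)) ∧
      ∀ e : AutCode × List ℕ, e ∈ F y → AutCode.Mem e.1 (l, μ) →
        e.2 = weights (x y).numOpp ((x y).Avoid (L y) (l, μ)) := by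
  have h11 : Primrec fun y : (α × (ℕ × List ℕ)) × ℕ => y.1.1 := Primrec.fst.comp Primrec.fst
  have hz : Primrec fun y : α × (AutCode × AutCode × AutCode) => y.2 := Primrec.snd
  have hm : Primrec fun y : α × (AutCode × AutCode × AutCode) => (x y.1).numMsg :=
    primrec_numMsg.comp (hx.comp Primrec.fst)
  have hcs : Primrec fun y => (L y).flatMap fun z => [z.1, AutCode.up (x y).numMsg z.2.1,
      AutCode.up (x y).numMsg z.2.2] :=
    Primrec.list_flatMap hL (Primrec.list_cons.comp (Primrec.fst.comp hz)
      (Primrec.list_cons.comp (primrec_up_comp hm (Primrec.fst.comp (Primrec.snd.comp hz)))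
        (Primrec.list_cons.comp (primrec_up_comp hm (Primrec.snd.comp (Primrec.snd.comp hz)))
          (Primrec.const []))))
  have hwt : Primrec fun y : α × (ℕ × List ℕ) =>
      weights (x y.1).numOpp ((x y.1).Avoid (L y.1) y.2) :=
    primrec_weights (primrec_numOpp.comp (hx.comp Primrec.fst))
      (p := fun y a => (x y.1).Avoid (L y.1) y.2 a)
      (primrecPred_avoid (hx.comp h11) (hL.comp h11) (Primrec.snd.comp Primrec.fst) Primrec.snd)
  exact exists_computable_stratCode (primrec_numLoc.comp hx) (primrec_numMsg.comp hx) hcs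
    (wt := fun y s => weights (x y).numOpp ((x y).Avoid (L y) s)) hwt
    (fun y => finite_range_weights _ _)
    (fun y μ μ' _ _ h l hl => weights_congr fun a _ => h.avoid (fun z hz =>
      ⟨List.mem_flatMap.2 ⟨z, hz, by simp⟩, List.mem_flatMap.2 ⟨z, hz, by simp⟩,
        List.mem_flatMap.2 ⟨z, hz, by simp⟩⟩) hl a)

theorem exists_computable_avoidStrat :
    ∃ F : Input × List (AutCode × AutCode × AutCode) → StratCode, Computable F ∧
    ∀ (x : Input) L, ∀ l < x.numLoc, ∀ μ, Valid x.numMsg μ →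
      (∃ e : AutCode × List ℕ, e ∈ F (x, L) ∧ AutCode.Mem e.1 (l, μ)) ∧
      ∀ e : AutCode × List ℕ, e ∈ F (x, L) → AutCode.Mem e.1 (l, μ) →
        e.2 = weights x.numOpp (x.Avoid L (l, μ)) := by
  obtain ⟨F, hF, hF'⟩ := exists_computable_avoidStrat_aux
    (α := Input × List (AutCode × AutCode × AutCode)) Primrec.fst Primrec.snd
  exact ⟨F, hF, fun x L => hF' (x, L)⟩

/-- The list of the values of a function below a bound. -/
def listBelow {β : Type} (f : ℕ → β) (n : ℕ) : List β :=
  Nat.rec [] (fun j l => f j :: l) n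

theorem mem_listBelow {β : Type} {f : ℕ → β} {n : ℕ} {b : β} :
    b ∈ listBelow f n ↔ ∃ j < n, b = f j := by
  induction n with
  | zero => simp [listBelow]
  | succ n ih =>
    change b ∈ f n :: listBelow f n ↔ _
    rw [List.mem_cons, ih]
    constructor
    · rintro (h | ⟨j, hj, h⟩)
      · exact ⟨n, by lia, h⟩
      · exact ⟨j, by lia, h⟩
    · rintro ⟨j, hj, h⟩
      rcases Nat.lt_succ_iff_lt_or_eq.1 hj with h1 | rfl
      · exact Or.inr ⟨j, h1, h⟩
      · exact Or.inl h

theorem computable_listBelow {α β : Type} [Primcodable α] [Primcodable β] {f : α → ℕ → β}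
    (hf : Computable₂ f) {n : α → ℕ} (hn : Computable n) :
    Computable fun x => listBelow (f x) (n x) :=
  Computable.nat_rec (f := n) (g := fun _ => ([] : List β)) (h := fun x z => f x z.1 :: z.2) hn
    (Computable.const _) (Computable.list_cons.comp
      (hf.comp Computable.fst (Computable.fst.comp Computable.snd))
      (Computable.snd.comp Computable.snd))

end Input

end LossyGame

namespace LossyGame

/-! ## Arenas and their presentations -/

theorem forall_lt_iff_forall_fin {n : ℕ} {P : ℕ → Prop} : (∀ b < n, P b) ↔ ∀ b : Fin n, P b :=
  ⟨fun h b => h b b.2, fun h b hb => h ⟨b, hb⟩⟩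

theorem exists_lt_iff_exists_fin {n : ℕ} {P : ℕ → Prop} : (∃ b < n, P b) ↔ ∃ b : Fin n, P b :=
  ⟨fun ⟨b, hb, h⟩ => ⟨⟨b, hb⟩, h⟩, fun ⟨b, h⟩ => ⟨b, b.2, h⟩⟩

theorem ChanOp.code_lt {n : ℕ} (g : ChanOp (Fin n)) : ∀ z ∈ g.code.toList, z.2 < n := by
  cases g <;> simp [ChanOp.code]

theorem ChanOp.exists_code {n : ℕ} {f : Option (Bool × ℕ)} (hf : ∀ z ∈ f.toList, z.2 < n) :
    ∃ g : ChanOp (Fin n), g.code = f := by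
  rcases f with _ | ⟨_ | _, m⟩
  · exact ⟨.nop, rfl⟩
  · exact ⟨.send ⟨m, hf (false, m) (by simp)⟩, rfl⟩
  · exact ⟨.recv ⟨m, hf (true, m) (by simp)⟩, rfl⟩

theorem applyOp_code {n : ℕ} (g : ChanOp (Fin n)) (μ : List (Fin n)) :
    applyOp g.code (μ.map Fin.val) = (g.apply μ).map (List.map Fin.val) := by
  cases g with
  | nop => rfl
  | send m => rfl
  | recv m =>
    simp only [applyOp, ChanOp.code, ChanOp.apply, cond_true, List.getLast?_map,
      ← List.map_dropLast]
    have : Option.map Fin.val μ.getLast? = some (m : ℕ) ↔ μ.getLast? = some m := by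
      rw [Option.map_eq_some_iff]
      constructor
      · rintro ⟨a, ha, h⟩
        rw [ha, Fin.val_injective h]
      · exact fun h => ⟨m, h, rfl⟩
    simp only [this]
    split_ifs <;> rfl

namespace Arena

open Game

variable {A : Arena}

theorem valid_map_val {n : ℕ} (μ : List (Fin n)) : Valid n (μ.map Fin.val) := by
  intro m hm
  obtain ⟨x, _, rfl⟩ := List.mem_map.1 hm
  exact x.2

variable {c : ArenaCode} {i : Bool} {r : AutCode}

theorem numLoc_eq (hc : c.Presents A) : Input.numLoc (c, i, r) = A.numLoc := by
  simp [Input.numLoc, hc.1]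

theorem numMsg_eq (hc : c.Presents A) : Input.numMsg (c, i, r) = A.numMsg := by
  simp [Input.numMsg, hc.1]

theorem numAct_eq (hc : c.Presents A) : Input.numAct (c, i, r) = A.numAct i := by
  cases i <;> simp [Input.numAct, hc.1]

theorem numOpp_eq (hc : c.Presents A) : Input.numOpp (c, i, r) = A.numAct (!i) := by
  cases i <;> simp [Input.numOpp, hc.1]

theorem mem_ops_iff (hc : c.Presents A) {l : Fin A.numLoc} {a : A.Act i} {b : A.Act (!i)}
    {o : ℕ × Option (Bool × ℕ)} : o ∈ Input.ops (c, i, r) l a b ↔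
      ∃ o' ∈ (A.tab l (joint i a b)).support, o = ((o'.1 : ℕ), o'.2.code) := by
  have h1 : (joint i a b false : ℕ) = cond i (b : ℕ) a := by cases i <;> rfl
  have h2 : (joint i a b true : ℕ) = cond i (a : ℕ) b := by cases i <;> rfl
  rw [Input.mem_ops, numLoc_eq hc, numMsg_eq hc]
  simp only [hc.2.1, h1, h2]
  constructor
  · rintro ⟨h, ho1, ho2⟩
    obtain ⟨g, hg⟩ := ChanOp.exists_code ho2
    refine ⟨(⟨o.1, ho1⟩, g), ?_, by rw [hg]⟩
    rwa [hg]
  · rintro ⟨o', h, rfl⟩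
    exact ⟨h, o'.1.2, o'.2.code_lt⟩

theorem forall_mem_ops (hc : c.Presents A) {s : A.State} {a : A.Act i} {b : A.Act (!i)} :
    (∀ o ∈ Input.ops (c, i, r) (raw s).1 a b, ¬ applyOp o.2 (raw s).2 = none) ↔
      ∀ o ∈ (A.tab s.loc (joint i a b)).support, o.2.apply s.chan ≠ none := by
  simp only [raw, mem_ops_iff hc]
  constructor
  · intro h o ho h1
    refine h _ ⟨o, ho, rfl⟩ ?_
    rw [applyOp_code, h1]
    rfl
  · rintro h _ ⟨o, ho, rfl⟩ h1
    rw [applyOp_code, Option.map_eq_none_iff] at h1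
    exact h o ho h1

theorem allowed_iff [Nonempty (A.Act i)] (hc : c.Presents A) {s : A.State} {a : A.Act i} :
    Input.Allowed (c, i, r) (raw s) a ↔ a ∈ A.allowedAct i s := by
  rw [Input.Allowed, numOpp_eq hc, forall_lt_iff_forall_fin]
  constructor
  · intro h d
    rw [eq_joint (i := i) (a := a) (b := d (!i)) (c := Function.update d i a)
      (Function.update_self ..) (Function.update_of_ne (by simp) _ _)]
    exact (forall_mem_ops hc).1 (h (d (!i)))
  · intro h b
    rw [forall_mem_ops hc]
    have := h (joint i (Classical.arbitrary _) b)
    rwa [eq_joint (i := i) (a := a) (b := b) (c := Function.update _ i a)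
      (Function.update_self ..) ((Function.update_of_ne (by simp) _ _).trans (joint_not ..))] at this

theorem allowedOpp_iff [Nonempty (A.Act (!i))] (hc : c.Presents A) {s : A.State} {b : A.Act (!i)} :
    Input.AllowedOpp (c, i, r) (raw s) b ↔ b ∈ A.allowedAct (!i) s := by
  rw [Input.AllowedOpp, numAct_eq hc, forall_lt_iff_forall_fin]
  constructor
  · intro h d
    rw [eq_joint (i := i) (a := d i) (b := b) (c := Function.update d (!i) b)
      (Function.update_of_ne (by simp) _ _) (Function.update_self ..)]
    exact (forall_mem_ops hc).1 (h (d i))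
  · intro h a
    rw [forall_mem_ops hc]
    have := h (joint i a (Classical.arbitrary _))
    rwa [eq_joint (i := i) (a := a) (b := b) (c := Function.update _ (!i) b)
      ((Function.update_of_ne (by simp) _ _).trans (joint_self ..)) (Function.update_self ..)] at this

theorem mem_up_raw {e : AutCode} {l : Fin A.numLoc} {μ : List (Fin A.numMsg)} :
    AutCode.Mem (AutCode.up A.numMsg e) ((l : ℕ), μ.map Fin.val) ↔
      ∃ ν : List (Fin A.numMsg), ν.Sublist μ ∧ (⟨l, ν⟩ : A.State) ∈ e.states A := by
  rw [AutCode.mem_up_iff (valid_map_val μ)]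
  constructor
  · rintro ⟨ν, hν, h⟩
    obtain ⟨ν, hs, rfl⟩ := List.sublist_map_iff.1 hν
    exact ⟨ν, hs, mem_states_iff.2 h⟩
  · rintro ⟨ν, hν, h⟩
    exact ⟨_, hν.map _, mem_states_iff.1 h⟩

variable {p : ℝ≥0} {hp : p ≤ 1}

/-- An allowed action never triggers an impossible operation, so the default content in the
definition of `game` plays no role. Hitting a set after losses means that the content before losses
is in its upward closure. -/
theorem exists_hits_iff (hc : c.Presents A) (h0 : 0 < p) (h1 : p < 1) {s : A.State} {a : A.Act i}
    {b : A.Act (!i)} (ha : a ∈ A.allowedAct i s) {e : AutCode} :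
    (∃ o ∈ Input.ops (c, i, r) (raw s).1 a b, Hits (Input.numMsg (c, i, r)) e o (raw s).2) ↔
      ∃ t ∈ ((A.game p hp).trans s (joint i a b)).support, t ∈ e.states A := by
  simp only [mem_support_game_trans h0 h1, numMsg_eq hc, Hits]
  have hne : ∀ o ∈ (A.tab s.loc (joint i a b)).support, ∃ μ, o.2.apply s.chan = some μ := by
    intro o ho
    refine Option.ne_none_iff_exists'.1 ?_
    have := ha (joint i a b) o
    rw [eq_joint (i := i) (a := a) (b := b) (c := Function.update _ i a)
      (Function.update_self ..) ((Function.update_of_ne (by simp) _ _).trans (joint_not ..))] at this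
    exact this ho
  simp only [raw, mem_ops_iff hc]
  constructor
  · rintro ⟨_, ⟨o, ho, rfl⟩, ν, hν, hmem⟩
    obtain ⟨μ, hμ⟩ := hne o ho
    simp only [applyOp_code, hμ, Option.map_some, Option.toList_some, List.mem_singleton] at hν
    subst hν
    obtain ⟨ν, hν, hmem⟩ := mem_up_raw.1 hmem
    exact ⟨_, ⟨o, ho, rfl, by simpa [hμ] using hν⟩, hmem⟩
  · rintro ⟨⟨_, ν⟩, ⟨o, ho, rfl, hν⟩, hmem⟩
    obtain ⟨μ, hμ⟩ := hne o ho
    refine ⟨_, ⟨o, ho, rfl⟩, μ.map Fin.val, ?_, mem_up_raw.2 ⟨ν, by simpa [hμ] using hν, hmem⟩⟩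
    simp [applyOp_code, hμ]

theorem forall_not_hits_iff (hc : c.Presents A) (h0 : 0 < p) (h1 : p < 1) {s : A.State}
    {a : A.Act i} {b : A.Act (!i)} (ha : a ∈ A.allowedAct i s) {e : AutCode} :
    (∀ o ∈ Input.ops (c, i, r) (raw s).1 a b, ¬ Hits (Input.numMsg (c, i, r)) e o (raw s).2) ↔
      ∀ t ∈ ((A.game p hp).trans s (joint i a b)).support, t ∈ (e.states A)ᶜ := by
  have h := not_congr (exists_hits_iff (r := r) (hp := hp) (b := b) hc h0 h1 ha (e := e))
  push Not at h
  exact h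

section main

variable [∀ i, Nonempty (A.Act i)] (hc : c.Presents A) (h0 : 0 < p) (h1 : p < 1)

include hc h0 h1

theorem keep_iff {s : A.State} {a : A.Act i} {N : AutCode} :
    Input.Keep (c, i, r) N (raw s) a ↔ a ∈ (A.game p hp).keep i (N.states A)ᶜ s := by
  rw [mem_keep_iff, Input.Keep, allowed_iff hc, numOpp_eq hc, forall_lt_iff_forall_fin]
  refine and_congr_right fun ha => forall_congr' fun b => ?_
  rw [allowedOpp_iff hc, forall_not_hits_iff (hp := hp) hc h0 h1 ha]
  rfl

variable {R : Set A.State}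

theorem reachStep_iff (hr : r.states A = R) {s : A.State} {N X : AutCode} :
    Input.ReachStep (c, i, r) N X (raw s) ↔
      s ∈ (A.game p hp).layerStep i R (N.states A)ᶜ i R (X.states A) := by
  rw [mem_layerStep_self, Input.ReachStep, ← mem_states_iff, numOpp_eq hc, numAct_eq hc,
    forall_lt_iff_forall_fin]
  refine and_congr Iff.rfl ?_
  have h2 : AutCode.Mem (Input.target (c, i, r)) (raw s) ↔ s ∈ R := by
    rw [← hr, mem_states_iff]
    rfl
  have h3 : (∀ b : A.Act (!i), Input.AllowedOpp (c, i, r) (raw s) b → ∃ a < A.numAct i,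
      Input.Keep (c, i, r) N (raw s) a ∧ ∃ o ∈ Input.ops (c, i, r) (raw s).1 a b,
        Hits (Input.numMsg (c, i, r)) X o (raw s).2) ↔
      ∀ b ∈ (A.game p hp).allowed (!i) s, ∃ a ∈ (A.game p hp).keep i (N.states A)ᶜ s,
        ∃ t ∈ ((A.game p hp).trans s (joint i a b)).support, t ∈ X.states A := by
    refine forall_congr' fun b => imp_congr (allowedOpp_iff hc) ?_
    rw [exists_lt_iff_exists_fin]
    refine exists_congr fun a => ?_
    rw [keep_iff (hp := hp) hc h0 h1]
    exact and_congr_right fun ha => exists_hits_iff hc h0 h1 ha.1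
  rw [h2, h3]
  tauto

theorem avoidStep_iff (hr : r.states A = R) {s : A.State} {N T X : AutCode} :
    Input.AvoidStep (c, i, r) N T X (raw s) ↔
      s ∈ (A.game p hp).layerStep i R (N.states A)ᶜ (!i) (T.states A) (X.states A) := by
  rw [mem_layerStep_not, Input.AvoidStep, ← mem_states_iff, ← mem_states_iff, numOpp_eq hc,
    numAct_eq hc, forall_lt_iff_forall_fin]
  refine and_congr Iff.rfl (or_congr_right (and_congr ?_ ?_))
  · rw [← hr, mem_states_iff]
    rfl
  refine forall_congr' fun a => ?_
  rw [keep_iff (hp := hp) hc h0 h1]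
  refine forall_congr' fun ha => ?_
  rw [exists_lt_iff_exists_fin]
  refine exists_congr fun b => ?_
  rw [allowedOpp_iff hc]
  exact and_congr_right fun _ => exists_hits_iff hc h0 h1 ha.1

theorem reach_iff (hr : r.states A = R) {s : A.State} {N : AutCode} {a : A.Act i} :
    Input.Reach (c, i, r) N (raw s) a ↔ a ∈ reachActs (A.game p hp) i R (N.states A)ᶜ s := by
  have h2 : AutCode.Mem (Input.target (c, i, r)) (raw s) ↔ s ∈ R := by
    rw [← hr, mem_states_iff]
    rfl
  rw [Input.Reach, allowed_iff hc, ← mem_states_iff, h2, keep_iff (hp := hp) hc h0 h1]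
  rfl

theorem avoid_iff {L : List (AutCode × AutCode × AutCode)} {s : A.State} {b : A.Act (!i)} :
    Input.Avoid (c, i, r) L (raw s) b ↔ b ∈ A.allowedAct (!i) s ∧
      ∀ z ∈ L, s ∈ z.1.states A → ∀ a ∈ (A.game p hp).keep i (z.2.1.states A)ᶜ s,
        ∀ t ∈ ((A.game p hp).trans s (joint i a b)).support, t ∈ (z.2.2.states A)ᶜ := by
  rw [Input.Avoid, allowedOpp_iff hc]
  refine and_congr_right fun _ => forall₂_congr fun z _ => ?_
  rw [← mem_states_iff, numAct_eq hc, forall_lt_iff_forall_fin]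
  refine imp_congr Iff.rfl (forall_congr' fun a => ?_)
  rw [keep_iff (hp := hp) hc h0 h1]
  exact forall_congr' fun ha => forall_not_hits_iff hc h0 h1 ha.1

end main

end Arena

end LossyGame

/-! ### Termination by upward closures, and correctness of the computed rounds -/

namespace LossyGame

namespace Game

variable {S : Type} {Act : Bool → Type} {G : Game S Act} {i : Bool} {R : Set S}

/-- If the actions that stay in the next set of the algorithm are the same as before, then the next
round is the last. -/
theorem roundD_roundD_eq [∀ i, Nonempty (Act i)] {D : Set S}
    (h : ∀ s, G.keep i D s ⊆ G.keep i (G.roundD i R D) s) :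
    G.roundD i R (G.roundD i R D) = G.roundD i R D := by
  have hY : G.roundD i R D ⊆ G.roundY i R (G.roundD i R D) := by
    -- The staying actions have not changed, so the old layers, cut down to the new set, still lead
    -- to each other.
    have hlay : ∀ n, (G.layerStep i R D i R)^[n] ∅ ∩ G.roundD i R D ⊆
        (G.layerStep i R (G.roundD i R D) i R)^[n] ∅ := by
      intro n
      induction n with
      | zero => exact fun s hs => hs.1
      | succ n ih =>
        rintro s ⟨hs, hs'⟩
        rw [iterate_layerStep_succ, mem_layerStep_self] at hs ⊢
        refine ⟨hs', hs.2.imp_right fun h2 => ⟨h2.1, fun b hb => ?_⟩⟩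
        obtain ⟨a, ha, t, ht, htX⟩ := h2.2 b hb
        have ha' := h s ha
        exact ⟨a, ha', t, ht, ih ⟨htX, (mem_keep_iff.1 ha').2 b hb t ht⟩⟩
    intro s hs
    have hsY : s ∈ G.roundY i R D := by
      by_contra hsY
      exact hs.2 (inter_subset_layers ⟨hs.1, hs.1, hsY⟩)
    obtain ⟨n, hn⟩ := Set.mem_iUnion.1 hsY
    exact Set.mem_iUnion.2 ⟨n, hlay n ⟨hn, hs⟩⟩
  have hC : G.roundC i R (G.roundD i R D) = ∅ := Set.sdiff_eq_empty.2 hY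
  -- With an empty target, a state of the first layer has no staying action. It had none before
  -- either, so it would already have been removed.
  have hP : G.layers i R (G.roundD i R D) (!i) ∅ = ∅ := by
    refine Set.iUnion_eq_empty.2 fun n => ?_
    induction n with
    | zero => rfl
    | succ n ih =>
      rw [iterate_layerStep_succ, ih]
      refine Set.eq_empty_of_forall_notMem fun s hs => ?_
      rw [mem_layerStep_not] at hs
      obtain ⟨hs, hE | ⟨hR, hs'⟩⟩ := hs
      · exact hE
      refine hs.2 (Set.mem_iUnion.2 ⟨1, ?_⟩)
      rw [iterate_layerStep_succ, mem_layerStep_not]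
      refine ⟨hs.1, Or.inr ⟨hR, fun a ha => ?_⟩⟩
      obtain ⟨b, -, t, -, ht⟩ := hs' a (h s ha)
      exact ht.elim
  conv_lhs => rw [roundD, hC, hP, Set.sdiff_empty]

end Game

namespace Arena

open Game

variable {A : Arena}

/-- The upward closure of a set of configurations. -/
def upper (X : Set A.State) : Set A.State :=
  {s | ∃ ν : List (Fin A.numMsg), ν.Sublist s.chan ∧ (⟨s.loc, ν⟩ : A.State) ∈ X}

theorem subset_upper {X : Set A.State} : X ⊆ upper X := fun s hs => ⟨s.chan, List.Sublist.refl _, hs⟩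

theorem upper_mono {X X' : Set A.State} (h : X ⊆ X') : upper X ⊆ upper X' :=
  fun _ ⟨ν, h1, h2⟩ => ⟨ν, h1, h h2⟩

theorem upper_subset_of_upLe {e e' : AutCode} (h : UpLe A.numLoc A.numMsg e e') :
    upper (e.states A) ⊆ upper (e'.states A) := by
  intro s hs
  exact mem_up_raw.1 (h s.loc s.loc.2 _ (valid_map_val _) (mem_up_raw.2 hs))

variable {p : ℝ≥0} {hp : p ≤ 1}

/-- A successor can lose further messages within the same step, so hitting a set and hitting its
upward closure are equally possible. -/
theorem exists_mem_support_of_upper (h0 : 0 < p) (h1 : p < 1) {s : A.State}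
    {a : (i : Bool) → A.Act i} {X X' : Set A.State} (h : upper X ⊆ upper X')
    (hX : ∃ t ∈ ((A.game p hp).trans s a).support, t ∈ X) :
    ∃ t ∈ ((A.game p hp).trans s a).support, t ∈ X' := by
  obtain ⟨t, ht, htX⟩ := hX
  obtain ⟨ν, hν, hX'⟩ := h (subset_upper htX)
  rw [mem_support_game_trans h0 h1] at ht
  obtain ⟨o, ho, h2, h3⟩ := ht
  exact ⟨⟨t.loc, ν⟩, (mem_support_game_trans h0 h1).2 ⟨o, ho, h2, hν.trans h3⟩, hX'⟩

variable {i : Bool} {R : Set A.State}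

theorem layerStep_subset_of_upper (h0 : 0 < p) (h1 : p < 1) {D T X X' : Set A.State} {j : Bool}
    (h : upper X ⊆ upper X') :
    (A.game p hp).layerStep i R D j T X ⊆ (A.game p hp).layerStep i R D j T X' := by
  rintro s ⟨hs, hT⟩
  refine ⟨hs, hT.imp_right fun h2 => ⟨h2.1, fun c hc => ?_⟩⟩
  obtain ⟨a, ha, hX⟩ := h2.2 c hc
  exact ⟨a, ha, exists_mem_support_of_upper h0 h1 h hX⟩

theorem keep_subset_of_upper (h0 : 0 < p) (h1 : p < 1) {D D' : Set A.State}
    (h : upper D'ᶜ ⊆ upper Dᶜ) (s : A.State) :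
    (A.game p hp).keep i D s ⊆ (A.game p hp).keep i D' s := by
  refine fun a ha => ⟨ha.1, fun c hc hall t ht => ?_⟩
  by_contra htD
  obtain ⟨t', ht', htD'⟩ := exists_mem_support_of_upper h0 h1 h ⟨t, ht, htD⟩
  exact htD' (ha.2 c hc hall t' ht')

variable {c : ArenaCode} {r : AutCode}

/-- Stability of the upward closure is enough for a fixed point: by `hΨ`, the operator at stage `m +
1` yields nothing beyond stage `m`, and that is contained in stage `m + 1`. -/
theorem states_eq_of_isLfp (hc : c.Presents A) {q : AutCode → ℕ × List ℕ → Prop} {e : AutCode}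
    (he : Input.IsLfp (c, i, r) q e) {Ψ : Set A.State → Set A.State}
    (hΨ : ∀ X X', upper X ⊆ upper X' → Ψ X ⊆ Ψ X')
    (hq : ∀ Z s, q Z (raw s) ↔ s ∈ Ψ (AutCode.states Z A)) :
    e.states A = ⋃ n, Ψ^[n] ∅ := by
  obtain ⟨Z, m, hZ0, hZ, hm, rfl⟩ := he
  rw [numLoc_eq hc, numMsg_eq hc] at hZ hm
  have hmono : ∀ X X', X ⊆ X' → Ψ X ⊆ Ψ X' := fun X X' h => hΨ _ _ (upper_mono h)
  have hincr : ∀ n, Ψ^[n] ∅ ⊆ Ψ^[n + 1] ∅ := by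
    intro n
    induction n with
    | zero => exact Set.empty_subset _
    | succ n ih =>
      rw [Function.iterate_succ_apply', Function.iterate_succ_apply' (n := n + 1)]
      exact hmono _ _ ih
  have hsucc : ∀ n, (Z (n + 1)).states A = (Z n).states A ∪ Ψ ((Z n).states A) := by
    intro n
    ext s
    rw [Set.mem_union, mem_states_iff, mem_states_iff, ← hq]
    exact hZ n s.loc s.loc.2 _ (valid_map_val _)
  have hit : ∀ n, (Z n).states A = Ψ^[n] ∅ := by
    intro n
    induction n with
    | zero => exact Set.eq_empty_of_forall_notMem fun s hs => hZ0 _ (mem_states_iff.1 hs)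
    | succ n ih =>
      -- The iterates of `Ψ` increase, so the union with the previous stage adds nothing.
      rw [hsucc, ih, ← Function.iterate_succ_apply' Ψ]
      exact Set.union_eq_right.2 (hincr n)
  have hfix : Ψ ((Z (m + 1)).states A) ⊆ (Z (m + 1)).states A := by
    refine (hΨ _ _ (upper_subset_of_upLe hm)).trans ?_
    rw [hsucc m]
    exact Set.subset_union_right
  refine Set.Subset.antisymm ?_ (Set.iUnion_subset fun n => ?_)
  · rw [hit]
    exact Set.subset_iUnion (fun n => Ψ^[n] ∅) (m + 1)
  · induction n with
    | zero => exact Set.empty_subset _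
    | succ n ih =>
      rw [Function.iterate_succ_apply']
      exact (hmono _ _ ih).trans hfix

theorem states_E_compl (hc : c.Presents A) {N Y C D E : ℕ → AutCode} {K : ℕ}
    (hN : Input.RoundCodes (c, i, r) N Y C D E K) (k : ℕ) :
    ((E k).states A)ᶜ = (C k).states A := by
  ext s
  rw [Set.mem_compl_iff, mem_states_iff, mem_states_iff, not_iff_comm]
  exact (hN.mem_E k s.loc (by rw [numLoc_eq hc]; exact s.loc.2) (s.chan.map Fin.val)
    (by rw [numMsg_eq hc]; exact valid_map_val _)).symm

section rounds

variable [∀ i, Nonempty (A.Act i)] (hc : c.Presents A) (h0 : 0 < p) (h1 : p < 1)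
  (hr : r.states A = R) {N Y C D E : ℕ → AutCode} {K : ℕ}
  (hN : Input.RoundCodes (c, i, r) N Y C D E K)

include hc h0 h1 hr hN

theorem states_reach (k : ℕ) :
    (Y k).states A = (A.game p hp).roundY i R ((N k).states A)ᶜ :=
  states_eq_of_isLfp hc (hN.reach k) (fun _ _ => layerStep_subset_of_upper h0 h1)
    fun _ _ => reachStep_iff hc h0 h1 hr

theorem states_C_eq (k : ℕ) :
    (C k).states A = (A.game p hp).roundC i R ((N k).states A)ᶜ := by
  ext s
  rw [roundC, ← states_reach hc h0 h1 hr hN, mem_states_iff]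
  have := hN.mem_C k s.loc (by rw [numLoc_eq hc]; exact s.loc.2) (s.chan.map Fin.val)
    (by rw [numMsg_eq hc]; exact valid_map_val _)
  refine this.trans ?_
  rw [Set.mem_sdiff, Set.mem_compl_iff, mem_states_iff, mem_states_iff]
  rfl

theorem states_compl (k : ℕ) :
    ((N k).states A)ᶜ = ((A.game p hp).roundD i R)^[k] Set.univ := by
  induction k with
  | zero =>
    refine Set.eq_univ_of_forall fun s hs => hN.zero _ (mem_states_iff.1 hs)
  | succ k ih =>
    rw [Function.iterate_succ_apply', ← ih, roundD, ← states_C_eq hc h0 h1 hr hN]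
    obtain ⟨P, hP, hNP⟩ := hN.succ k
    have hP' : P.states A = (A.game p hp).layers i R ((N k).states A)ᶜ (!i) ((C k).states A) :=
      states_eq_of_isLfp hc hP (fun _ _ => layerStep_subset_of_upper h0 h1)
        fun _ _ => avoidStep_iff hc h0 h1 hr
    rw [← hP']
    ext s
    have := hNP s.loc (by rw [numLoc_eq hc]; exact s.loc.2) (s.chan.map Fin.val)
      (by rw [numMsg_eq hc]; exact valid_map_val _)
    rw [Set.mem_sdiff, Set.mem_compl_iff, Set.mem_compl_iff, mem_states_iff, mem_states_iff,
      mem_states_iff, ← not_or]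
    exact not_congr this

theorem states_D_eq (k : ℕ) : (D k).states A = ((A.game p hp).roundD i R)^[k] Set.univ := by
  rw [← states_compl hc h0 h1 hr hN]
  ext s
  rw [Set.mem_compl_iff, mem_states_iff, mem_states_iff]
  exact hN.mem_D k s.loc (by rw [numLoc_eq hc]; exact s.loc.2) (s.chan.map Fin.val)
    (by rw [numMsg_eq hc]; exact valid_map_val _)

/-- Stability of the upward closures between `K` and `K + 1` fixes the staying actions, although `D`
may still shrink in that step. Hence the fixed point is claimed for `K + 1`. -/
theorem iterate_roundD_stable : ((A.game p hp).roundD i R)^[K + 1] Set.univ =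
    ((A.game p hp).roundD i R)^[K + 1 + 1] Set.univ := by
  have hst := hN.stable
  rw [numLoc_eq hc, numMsg_eq hc] at hst
  have h2 := upper_subset_of_upLe hst
  have hD := fun k => compl_eq_comm.1 (states_compl (hp := hp) hc h0 h1 hr hN k)
  rw [← hD, ← hD, Function.iterate_succ_apply'] at h2
  rw [Function.iterate_succ_apply' (n := K + 1), Function.iterate_succ_apply' (n := K)]
  exact (roundD_roundD_eq fun s => keep_subset_of_upper h0 h1 h2 s).symm

end rounds

end Arena

end LossyGame

namespace LossyGame

/-! ## Presentations of strategies -/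

theorem unif_apply {B : Type} [Fintype B] [Nonempty B] {T : Set B} (hT : T.Nonempty)
    [DecidablePred (· ∈ T)] (a : B) :
    unif T a = (if a ∈ T then 1 else 0 : ℕ) / ((Finset.univ.filter (· ∈ T)).card : ℝ≥0∞) := by
  have h : T.toFinite.toFinset = Finset.univ.filter (· ∈ T) := by ext; simp
  have hm : a ∈ T.toFinite.toFinset ↔ a ∈ T := Set.Finite.mem_toFinset _
  rw [unif, dif_pos hT, PMF.uniformOfFinset_apply, h]
  by_cases ha : a ∈ T
  · rw [if_pos (h ▸ hm.2 ha), if_pos ha, Nat.cast_one, one_div]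
  · rw [if_neg (fun h' => ha (hm.1 (h ▸ h'))), if_neg ha, Nat.cast_zero, ENNReal.zero_div]

theorem Input.getD_weights {n : ℕ} {q : ℕ → Prop} [DecidablePred q] (a : Fin n) :
    (weights n q).getD a 0 = if q a then 1 else 0 := by
  classical
  simp only [weights, List.getD_eq_getElem?_getD]
  simp

theorem Input.sum_weights {n : ℕ} {T : Set (Fin n)} [DecidablePred (· ∈ T)] {q : ℕ → Prop}
    (hq : ∀ a : Fin n, q a ↔ a ∈ T) :
    (weights n q).sum = (Finset.univ.filter (· ∈ T)).card := by
  classical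
  have h : (weights n q).sum = ∑ a ∈ Finset.range n, if q a then 1 else 0 := by
    rw [weights]
    refine Eq.trans ?_ (Finset.sum_congr (s₁ := Finset.range n) (M := ℕ) rfl fun _ _ => rfl)
    simp only [Finset.sum, Finset.range_val, Multiset.range, Multiset.map_coe, Multiset.sum_coe]
  rw [h, Finset.card_filter, Finset.sum_range]
  simp only [hq]

theorem unif_apply_weights {n : ℕ} [Nonempty (Fin n)] {T : Set (Fin n)} (hT : T.Nonempty)
    {q : ℕ → Prop} (hq : ∀ a : Fin n, q a ↔ a ∈ T) (a : Fin n) :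
    unif T a = ((Input.weights n q).getD a 0 : ℝ≥0∞) / ((Input.weights n q).sum : ℝ≥0∞) := by
  classical
  rw [unif_apply hT, Input.getD_weights, Input.sum_weights hq]
  simp only [hq]

namespace Arena

open Game

variable {A : Arena} {i : Bool}

theorem represents_of_weights {f : A.State → Set (A.Act i)} [Nonempty (A.Act i)]
    (hf : ∀ s, (f s).Nonempty) {q : ℕ × List ℕ → ℕ → Prop}
    (hq : ∀ s (a : A.Act i), q (raw s) a ↔ a ∈ f s) {F : StratCode}
    (hF : ∀ l < A.numLoc, ∀ μ, Valid A.numMsg μ →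
      (∃ e : AutCode × List ℕ, e ∈ F ∧ AutCode.Mem e.1 (l, μ)) ∧
      ∀ e : AutCode × List ℕ, e ∈ F → AutCode.Mem e.1 (l, μ) →
        e.2 = Input.weights (A.numAct i) (q (l, μ))) :
    StratCode.Represents F (A := A) (i := i) fun _ s => unif (f s) := by
  have hF' := fun s : A.State => hF s.loc s.loc.2 _ (valid_map_val s.chan)
  constructor
  · intro s
    obtain ⟨e, he, hs⟩ := (hF' s).1
    exact ⟨e, he, mem_states_iff.2 hs⟩
  · intro e he h s hs a
    rw [(hF' s).2 e he (mem_states_iff.1 hs)]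
    exact unif_apply_weights (hf s) (hq s) a

/-! ### Regular sets of histories -/

/-- The last location letter marks where the last configuration begins. -/
theorem eq_of_append_cons_map_inr {α β : Type} {a b : List (α ⊕ β)} {l l' : α} {μ μ' : List β}
    (h : a ++ Sum.inl l :: μ.map Sum.inr = b ++ Sum.inl l' :: μ'.map Sum.inr) :
    a = b ∧ l = l' ∧ μ = μ' := by
  have key : ∀ {e : List (α ⊕ β)} {l l' : α} {μ μ' : List β},
      (Sum.inl l :: μ.map Sum.inr : List (α ⊕ β)) = e ++ Sum.inl l' :: μ'.map Sum.inr →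
      e = [] ∧ l = l' ∧ μ = μ' := by
    intro e l l' μ μ' h
    cases e with
    | nil =>
      simp only [List.nil_append, List.cons.injEq, Sum.inl.injEq] at h
      exact ⟨rfl, h.1, List.map_injective_iff.2 Sum.inr_injective h.2⟩
    | cons x e =>
      simp only [List.cons_append, List.cons.injEq] at h
      have : Sum.inl l' ∈ (μ.map Sum.inr : List (α ⊕ β)) := h.2 ▸ by simp
      simp at this
  rcases List.append_eq_append_iff.1 h with ⟨e, rfl, h1⟩ | ⟨e, rfl, h1⟩
  · obtain ⟨rfl, h2, h3⟩ := key h1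
    exact ⟨by simp, h2, h3⟩
  · obtain ⟨rfl, h2, h3⟩ := key h1
    exact ⟨by simp, h2.symm, h3.symm⟩

theorem exists_eq_append_flatMap_word (w : List A.Letter) :
    ∃ (μ : List (Fin A.numMsg)) (h : List A.State), w = μ.map Sum.inr ++ h.flatMap A.word := by
  induction w with
  | nil => exact ⟨[], [], rfl⟩
  | cons x w ih =>
    obtain ⟨μ, h, rfl⟩ := ih
    rcases x with l | m
    · exact ⟨[], ⟨l, μ⟩ :: h, by simp [word]⟩
    · exact ⟨m :: μ, h, by simp⟩

/-- Words that are empty or start with a location are encodings of histories. -/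
theorem exists_eq_flatMap_word {w : List A.Letter} (hw : ∀ m, w.head? ≠ some (Sum.inr m)) :
    ∃ h : List A.State, w = h.flatMap A.word := by
  obtain ⟨μ, h, rfl⟩ := exists_eq_append_flatMap_word w
  rcases μ with _ | ⟨m, μ⟩
  · exact ⟨h, rfl⟩
  · exact absurd rfl (hw m)

theorem head?_flatMap_word (h : List A.State) (m : Fin A.numMsg) :
    (h.flatMap A.word).head? ≠ some (Sum.inr m) := by
  cases h <;> simp [word]

/-- Again by finitely many left quotients, which depend on the last configuration read so far only
through its quotient in the language of `X`. -/
theorem isRegular_histories {X : Set A.State} (hX : A.RegularSet X) :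
    Language.IsRegular ({w | ∃ h, ∃ s ∈ X, w = (h ++ [s]).flatMap A.word} :
      Language A.Letter) := by
  set L : Language A.Letter := {w | ∃ h, ∃ s ∈ X, w = (h ++ [s]).flatMap A.word} with hL
  set LX : Language A.Letter := {w | ∃ s ∈ X, w = A.word s} with hLX
  let M : Language A.Letter := {w | ∃ d, ∃ s ∈ X, w = d ++ A.word s}
  have hmem : ∀ w, w ∈ L ↔ ∃ h : List A.State, ∃ s ∈ X, w = h.flatMap A.word ++ A.word s := by
    intro w
    refine exists_congr fun h => exists_congr fun s => and_congr_right fun _ => ?_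
    simp
  have hfin : (Set.range LX.leftQuotient).Finite := Language.IsRegular.finite_range_leftQuotient hX
  -- An accepted continuation either completes the current configuration to one in `X`, or ends with
  -- a fresh configuration in `X`. In the second case anything may come in between, as every word
  -- that starts with a location encodes a history.
  have key : ∀ h s, L.leftQuotient ((h ++ [s]).flatMap A.word) =
      LX.leftQuotient (A.word s) + M := by
    intro h s
    ext w
    rw [Language.mem_leftQuotient, hmem, Language.mem_add, Language.mem_leftQuotient]
    constructor
    · rintro ⟨h', t, ht, heq⟩
      simp only [List.flatMap_append, List.flatMap_singleton] at heq
      rcases List.append_eq_append_iff.1 heq with ⟨e, h1, h2⟩ | ⟨e, h1, h2⟩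
      · exact Or.inr ⟨e, t, ht, h2⟩
      · rcases e with _ | ⟨x, e⟩
        · exact Or.inr ⟨[], t, ht, by simpa using h2.symm⟩
        · simp only [word, List.cons_append, List.cons.injEq] at h2
          obtain ⟨rfl, h2⟩ := h2
          obtain ⟨μ₁, ν, hμ, rfl, h3⟩ := List.append_eq_map_iff.1 h2.symm
          obtain ⟨-, h4, rfl⟩ := eq_of_append_cons_map_inr h1
          refine Or.inl ⟨t, ht, ?_⟩
          rw [← h3, word, word, h4, hμ]
          simp
    · rintro (⟨t, ht, heq⟩ | ⟨d, t, ht, rfl⟩)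
      · refine ⟨h, t, ht, ?_⟩
        simp only [List.flatMap_append, List.flatMap_singleton, List.append_assoc, heq]
      · obtain ⟨h', hh'⟩ := exists_eq_flatMap_word (w := (h ++ [s]).flatMap A.word ++ d)
          fun m hm => by
            cases h <;> simp [word] at hm
        exact ⟨h', t, ht, by rw [← hh', List.append_assoc]⟩
  refine Language.IsRegular.of_finite_range_leftQuotient
    (((((hfin.image fun Q => Q + M)).insert ⊥).insert L).subset ?_)
  rintro _ ⟨x, rfl⟩
  by_cases hx : ∀ m, x.head? ≠ some (Sum.inr m)
  · obtain ⟨h, rfl⟩ := exists_eq_flatMap_word hx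
    rcases List.eq_nil_or_concat h with rfl | ⟨h, s, rfl⟩
    · exact Or.inl rfl
    · right; right
      rw [List.concat_eq_append]
      exact ⟨_, ⟨_, rfl⟩, (key h s).symm⟩
  · right; left
    push Not at hx
    obtain ⟨m, hm⟩ := hx
    ext w
    rw [Language.mem_leftQuotient, hmem]
    refine iff_of_false ?_ fun h => h
    rintro ⟨h, s, -, heq⟩
    rcases x with _ | ⟨y, x⟩
    · simp at hm
    · simp only [List.head?_cons, Option.some.injEq] at hm
      subst hm
      have h1 := congrArg List.head? heq
      have h2 : (h.flatMap A.word ++ A.word s) = (h ++ [s]).flatMap A.word := by simp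
      rw [h2] at h1
      exact head?_flatMap_word (h ++ [s]) m h1.symm

theorem regularSet_iUnion_states (F : List AutCode) :
    A.RegularSet {s | ∃ e ∈ F, s ∈ e.states A} := by
  induction F with
  | nil =>
    convert regularSet_states (A := A) ([], [], []) using 1
    ext s
    simp [mem_states_iff, AutCode.mem_iff]
  | cons e F ih =>
    refine Eq.subst (motive := Language.IsRegular) (Language.ext fun w => ?_)
      ((regularSet_states (A := A) e).add ih)
    refine (Language.mem_add _ _ _).trans ?_
    constructor
    · rintro (⟨s, hs, rfl⟩ | ⟨s, ⟨e', he', hs⟩, rfl⟩)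
      · exact ⟨s, ⟨e, List.mem_cons_self, hs⟩, rfl⟩
      · exact ⟨s, ⟨e', List.mem_cons_of_mem _ he', hs⟩, rfl⟩
    · rintro ⟨s, ⟨e', he', hs⟩, rfl⟩
      rcases List.mem_cons.1 he' with rfl | he'
      · exact Or.inl ⟨s, hs, rfl⟩
      · exact Or.inr ⟨s, ⟨e', he', hs⟩, rfl⟩

/-- Every distribution is among the finitely many listed ones, and the histories on which it is used
are determined by a finite union of the listed sets for the last state. -/
theorem isPFM_of_represents {F : StratCode} {f : A.State → PMF (A.Act i)}
    (hF : StratCode.Represents F (A := A) (i := i) fun _ s => f s) :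
    IsPFM (A := A) (i := i) fun _ s => f s := by
  classical
  have hex : ∀ s, ∃ e : AutCode × List ℕ, e ∈ F ∧ s ∈ AutCode.states e.1 A := hF.1
  have hval : ∀ e : AutCode × List ℕ, e ∈ F → ∀ s ∈ AutCode.states e.1 A, ∀ a : A.Act i,
      f s a = (e.2.getD a 0 : ℝ≥0∞) / (e.2.sum : ℝ≥0∞) := fun e he => hF.2 e he []
  refine ⟨fun _ _ _ => rfl, ?_, fun δ => ?_⟩
  · refine Set.Finite.of_finite_image (f := fun (δ : PMF (A.Act i)) a => δ a) ?_
      DFunLike.coe_injective.injOn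
    refine ((List.finite_toSet F).image fun (e : AutCode × List ℕ) (a : A.Act i) =>
      (e.2.getD a 0 : ℝ≥0∞) / (e.2.sum : ℝ≥0∞)).subset ?_
    rintro _ ⟨_, ⟨x, rfl⟩, rfl⟩
    obtain ⟨e, he, hs⟩ := hex x.2
    exact ⟨e, he, funext fun a => (hval e he x.2 hs a).symm⟩
  · have hreg := isRegular_histories (regularSet_iUnion_states (A := A)
      ((F.filter fun e : AutCode × List ℕ => ∀ a : A.Act i, δ a =
        (e.2.getD a 0 : ℝ≥0∞) / (e.2.sum : ℝ≥0∞)).map fun e => e.1))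
    have hset : {s | f s = δ} = {s | ∃ e ∈ ((F.filter fun e : AutCode × List ℕ =>
        ∀ a : A.Act i, δ a = (e.2.getD a 0 : ℝ≥0∞) / (e.2.sum : ℝ≥0∞)).map fun e => e.1),
          s ∈ AutCode.states e A} := by
      ext s
      simp only [Set.mem_ofPred_eq, List.mem_map, List.mem_filter, decide_eq_true_eq]
      constructor
      · rintro rfl
        obtain ⟨e, he, hs⟩ := hex s
        exact ⟨e.1, ⟨e, ⟨he, hval e he s hs⟩, rfl⟩, hs⟩
      · rintro ⟨_, ⟨e, ⟨he, hδ⟩, rfl⟩, hs⟩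
        exact PMF.ext fun a => (hval e he s hs a).trans (hδ a).symm
    rw [← hset] at hreg
    exact hreg

/-! ### Every arena has a presentation -/

theorem _root_.LossyGame.ChanOp.code_injective {n : ℕ} :
    Function.Injective (ChanOp.code (n := n)) := by
  rintro (_ | m | m) (_ | m' | m') h <;>
    simp_all [ChanOp.code, Fin.val_inj]

instance {n : ℕ} : Finite (ChanOp (Fin n)) :=
  Finite.of_surjective (α := Option (Bool × Fin n))
    (fun f => Option.casesOn f .nop fun z => cond z.1 (.recv z.2) (.send z.2)) (by
      rintro (_ | m | m)
      · exact ⟨none, rfl⟩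
      · exact ⟨some (false, m), rfl⟩
      · exact ⟨some (true, m), rfl⟩)

/-- Needed because termination and regularity, which do not mention codes, are obtained from the
computed rounds. -/
theorem exists_presents (A : Arena) : ∃ c : ArenaCode, c.Presents A := by
  let f : Fin A.numLoc × ((i : Bool) → A.Act i) × (Fin A.numLoc × ChanOp (Fin A.numMsg)) →
      ℕ × ℕ × ℕ × ℕ × Option (Bool × ℕ) :=
    fun x => (x.1, x.2.1 false, x.2.1 true, x.2.2.1, x.2.2.2.code)
  have hf : Function.Injective f := by
    rintro ⟨l, a, o, g⟩ ⟨l', a', o', g'⟩ h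
    simp only [f, Prod.mk.injEq, Fin.val_inj] at h
    obtain ⟨rfl, h1, h2, rfl, h3⟩ := h
    obtain rfl := ChanOp.code_injective h3
    obtain rfl : a = a' := funext fun k => by cases k <;> assumption
    rfl
  have hfin : (f '' {x | x.2.2 ∈ (A.tab x.1 x.2.1).support}).Finite := (Set.toFinite _).image f
  refine ⟨((A.numLoc, A.numMsg, A.numAct false, A.numAct true), hfin.toFinset.toList, A.init),
    rfl, fun l a o => ?_, rfl⟩
  rw [Finset.mem_toList, Set.Finite.mem_toFinset]
  constructor
  · exact fun h => ⟨(l, a, o), h, rfl⟩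
  · rintro ⟨x, hx, heq⟩
    obtain rfl : x = (l, a, o) := hf heq
    exact hx

end Arena

end LossyGame

/-! ### The avoiding strategies from codes, and the theorem -/

namespace LossyGame

namespace Arena

open Game

variable {A : Arena} {i : Bool} {R : Set A.State} {p : ℝ≥0} {hp : p ≤ 1}
  {H : Game A.State A.Act} {c : ArenaCode} {r : AutCode} {N Y C D E : ℕ → AutCode} {K : ℕ}

theorem avoid_nil_iff (hA : A.NonBlocking) (hc : c.Presents A) (h0 : 0 < p) (h1 : p < 1)
    (s : A.State) (b : A.Act (!i)) :
    Input.Avoid (c, i, r) [] (raw s) b ↔ b ∈ (A.game p hp).allowed (!i) s := by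
  have := hA.nonempty_act
  rw [avoid_iff (hp := hp) hc h0 h1]
  simp only [List.not_mem_nil, false_imp_iff, implies_true, and_true]
  rfl

/-- Only the rounds up to `K` impose conditions, since afterwards the sets `C` are empty; a finite
list therefore describes the whole strategy. -/
theorem avoid_listBelow_iff (hA : A.NonBlocking) (hc : c.Presents A) (h0 : 0 < p) (h1 : p < 1)
    (hr : r.states A = R) (hN : Input.RoundCodes (c, i, r) N Y C D E K) (s : A.State)
    (b : A.Act (!i)) :
    Input.Avoid (c, i, r) (Input.listBelow (fun j => (C j, N j, E j)) (K + 1)) (raw s) b ↔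
      b ∈ avoidActs (A.game p hp) i R s := by
  have := hA.nonempty_act
  have hDk := states_compl (hp := hp) hc h0 h1 hr hN
  have hCk := states_C_eq (hp := hp) hc h0 h1 hr hN
  -- From `K + 1` on the sets `D` are constant, and at a fixed point `C` is empty.
  have hempty : ∀ k, K + 1 ≤ k →
      (A.game p hp).roundC i R (((A.game p hp).roundD i R)^[k] Set.univ) = ∅ := by
    have hst := iterate_roundD_stable (hp := hp) hc h0 h1 hr hN
    have hk : ∀ k, K + 1 ≤ k → ((A.game p hp).roundD i R)^[k] Set.univ =
        ((A.game p hp).roundD i R)^[K + 1] Set.univ := by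
      intro k hk
      induction k, hk using Nat.le_induction with
      | base => rfl
      | succ k _ ih =>
        rw [Function.iterate_succ_apply', ih, ← Function.iterate_succ_apply' ((A.game p hp).roundD i R) (K + 1)]
        exact hst.symm
    intro k hKk
    rw [hk k hKk]
    rw [Function.iterate_succ_apply' (n := K + 1)] at hst
    exact Set.sdiff_eq_empty.2 (subset_roundY_of_eq hst.symm)
  rw [avoid_iff (hp := hp) hc h0 h1]
  refine and_congr_right fun _ => ?_
  simp only [Input.mem_listBelow]
  constructor
  · intro h k hk
    have hkK : k < K + 1 := by
      by_contra hkK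
      rw [hempty k (not_lt.1 hkK)] at hk
      exact hk
    have h2 := h _ ⟨k, hkK, rfl⟩
    simp only [states_E_compl hc hN, hCk, hDk] at h2
    exact h2 hk
  · rintro h _ ⟨k, -, rfl⟩
    simp only [states_E_compl hc hN, hCk, hDk]
    exact h k

end Arena

end LossyGame

theorem mainTheorem4 :
    ∃ (rounds : ArenaCode × Bool × AutCode → ℕ → AutCode × AutCode × AutCode)
      (solve : ArenaCode × Bool × AutCode → AutCode × StratCode × StratCode × StratCode),
      Computable₂ rounds ∧ Computable solve ∧
      ∀ (A : Arena), A.NonBlocking →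
      ∀ (p : ℝ≥0) (_ : 0 < p) (hp : p < 1) (i : Bool) (R : Set A.State), A.RegularSet R →
      -- `G` is the game, `H` is the game with the target made absorbing, `W` the winning region
      ∀ (G H : Game A.State A.Act), G = A.game p hp.le → H.IsAbsorbingVersion G R →
      ∀ W : Set A.State, W = G.winRegion i (AS (eventually R)) →
      -- the algorithm terminates, with output `W`
      (∃ k, H.asD i R k = H.asD i R (k + 1)) ∧
      (∀ k, H.asD i R k = H.asD i R (k + 1) → H.asD i R k = W) ∧
      -- `W` is regular, and so are the sets in all rounds of the algorithm
      A.RegularSet W ∧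
      (∀ k, A.RegularSet (H.asC i R k) ∧ A.RegularSet (H.asY i R k) ∧
        A.RegularSet (H.asD i R k)) ∧
      -- a strategy that plays uniformly over the `stay` actions on `W` is winning on `W`
      (∀ σ : Strat A.State (A.Act i), G.IsStrategy i σ →
        (∀ h, ∀ s ∈ W, IsUniformOn (σ h s) (H.stay i W s)) →
        ∀ s ∈ W, G.Wins i σ (AS (eventually R)) s) ∧
      -- everything can be computed from finite presentations of the arena and the target
      ∀ (c : ArenaCode) (r : AutCode), ArenaCode.Presents c A → AutCode.states r A = R →
        -- the rounds of the algorithm and the winning region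
        (∀ k, AutCode.states (rounds (c, i, r) k).1 A = H.asC i R k ∧
          AutCode.states (rounds (c, i, r) k).2.1 A = H.asY i R k ∧
          AutCode.states (rounds (c, i, r) k).2.2 A = H.asD i R k) ∧
        AutCode.states (solve (c, i, r)).1 A = W ∧
        -- a PFM winning strategy of player `i`
        (∃ σ : Strat A.State (A.Act i), G.IsStrategy i σ ∧ Arena.IsPFM σ ∧
          (∀ h, ∀ s ∈ W, IsUniformOn (σ h s) (H.stay i W s)) ∧
          (∀ s ∈ W, G.Wins i σ (AS (eventually R)) s) ∧
          StratCode.Represents (solve (c, i, r)).2.1 σ) ∧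
        -- a counting winning strategy of the opponent
        (∃ τ u v : Strat A.State (A.Act (!i)), G.IsStrategy (!i) τ ∧
          G.IsStrategy (!i) u ∧ Arena.IsPFM u ∧ G.IsStrategy (!i) v ∧ Arena.IsPFM v ∧
          Arena.IsCountingMix τ u v ∧
          (∀ s ∉ W, G.Wins (!i) τ (NZ (always Rᶜ)) s) ∧
          StratCode.Represents (solve (c, i, r)).2.2.1 u ∧
          StratCode.Represents (solve (c, i, r)).2.2.2 v) := by
  obtain ⟨N, Y, C, D, E, K, hN, hY, hC, hD, hE, hK, hcodes⟩ := Input.exists_computable_roundCodes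
  obtain ⟨Fσ, hFσ, hFσ'⟩ := Input.exists_computable_reachStrat
  obtain ⟨Fu, hFu, hFu'⟩ := Input.exists_computable_avoidStrat
  let L : Input → List (AutCode × AutCode × AutCode) := fun x =>
    Input.listBelow (fun j => (C x j, N x j, E x j)) (K x + 1)
  have hL : Computable L := Input.computable_listBelow (f := fun x j => (C x j, N x j, E x j))
    (hC.pair (hN.pair hE)) (Computable.succ.comp hK)
  have hK1 : Computable fun x => K x + 1 := Computable.succ.comp hK
  -- The output is taken at `K x + 1`, where the sets `D` are guaranteed to be constant. The empty
  -- list in the last component imposes no condition beyond being allowed, which gives the strategy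
  -- with full support.
  refine ⟨fun x k => (C x k, Y x k, D x k), fun x => (D x (K x + 1), Fσ (x, N x (K x + 1)),
    Fu (x, L x), Fu (x, [])), hC.pair (hY.pair hD), ?_, ?_⟩
  · exact (hD.comp Computable.id hK1).pair ((hFσ.comp (Computable.id.pair
      (hN.comp Computable.id hK1))).pair ((hFu.comp (Computable.id.pair hL)).pair
        (hFu.comp (Computable.id.pair (Computable.const [])))))
  intro A hA p h0 h1 i R hR G H hG hH W hW
  subst hG
  have := hA.nonempty_act
  have hround := Game.asD_eq_iterate_roundD (i := i) hA.proper rfl hH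
  -- An arbitrary presentation; it serves the claims that mention no codes.
  obtain ⟨c₀, hc₀⟩ := Arena.exists_presents A
  obtain ⟨r₀, hr₀⟩ := hR.exists_autCode
  have hN₀ := hcodes (c₀, i, r₀)
  have hlim : ∀ k, ((A.game p h1.le).roundD i R)^[k] Set.univ =
      ((A.game p h1.le).roundD i R)^[k + 1] Set.univ →
      ((A.game p h1.le).roundD i R)^[k] Set.univ = W := fun k hk =>
    (Arena.iterate_roundD_eq_winRegion hA h0 h1 hH hk).trans hW.symm
  have hst₀ := Arena.iterate_roundD_stable (hp := h1.le) hc₀ h0 h1 hr₀ hN₀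
  have hwins : ∀ σ : Strat A.State (A.Act i), (∀ h, ∀ s ∈ W, IsUniformOn (σ h s) (H.stay i W s)) →
      ∀ s ∈ W, (A.game p h1.le).Wins i σ (AS (eventually R)) s := by
    intro σ hσ s hs
    rw [← hlim _ hst₀] at hσ hs
    exact Arena.wins_AS_eventually hA h0 h1 hH hst₀ hσ hs
  refine ⟨⟨K (c₀, i, r₀) + 1, ?_⟩, fun k hk => ?_, ?_, fun k => ?_, fun σ _ hσ => hwins σ hσ, ?_⟩
  · rw [(hround _).1, (hround _).1]
    exact hst₀
  · rw [(hround _).1, (hround _).1] at hk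
    rw [(hround _).1]
    exact hlim k hk
  · rw [← hlim _ hst₀, ← Arena.states_D_eq hc₀ h0 h1 hr₀ hN₀]
    exact Arena.regularSet_states _
  · obtain ⟨h2, h3, h4⟩ := hround k
    rw [h2, h3, h4, ← Arena.states_compl (hp := h1.le) hc₀ h0 h1 hr₀ hN₀, ← Arena.states_C_eq (hp := h1.le) hc₀ h0 h1 hr₀ hN₀,
      ← Arena.states_reach (hp := h1.le) hc₀ h0 h1 hr₀ hN₀, Arena.states_compl (hp := h1.le) hc₀ h0 h1 hr₀ hN₀,
      ← Arena.states_D_eq (hp := h1.le) hc₀ h0 h1 hr₀ hN₀]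
    exact ⟨Arena.regularSet_states _, Arena.regularSet_states _, Arena.regularSet_states _⟩
  intro c r hc hr
  have hNx := hcodes (c, i, r)
  have hst := Arena.iterate_roundD_stable (hp := h1.le) hc h0 h1 hr hNx
  have hWk := hlim _ hst
  have hRW : R ⊆ W := hWk ▸ Game.subset_iterate_roundD _
  have hnum : ∀ {q : ℕ → List ℕ → Prop}, (∀ l < Input.numLoc (c, i, r), ∀ μ,
      Valid (Input.numMsg (c, i, r)) μ → q l μ) → ∀ l < A.numLoc, ∀ μ, Valid A.numMsg μ → q l μ := by
    intro q h
    rwa [Arena.numLoc_eq hc, Arena.numMsg_eq hc] at h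
  have hcompl : ((N (c, i, r) (K (c, i, r) + 1)).states A)ᶜ = W :=
    (Arena.states_compl hc h0 h1 hr hNx _).trans hWk
  have hne1 : ∀ s, (Arena.reachActs (A.game p h1.le) i R W s).Nonempty := fun s =>
    hWk ▸ Arena.reachActs_nonempty hA hst s
  have hne2 : ∀ s, (Arena.avoidActs (A.game p h1.le) i R s).Nonempty := Arena.avoidActs_nonempty hA hH
  have hne3 : ∀ s, ((A.game p h1.le).allowed (!i) s).Nonempty := hA (!i)
  have hrep1 : StratCode.Represents (Fσ ((c, i, r), N (c, i, r) (K (c, i, r) + 1))) (A := A) (i := i)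
      fun _ s => unif (Arena.reachActs (A.game p h1.le) i R W s) := by
    refine Arena.represents_of_weights hne1 (q := Input.Reach (c, i, r) (N (c, i, r) (K (c, i, r) + 1)))
      (fun s a => ?_) (hnum fun l hl μ hμ => Arena.numAct_eq hc ▸ hFσ' (c, i, r) _ l hl μ hμ)
    rw [← hcompl]
    exact Arena.reach_iff hc h0 h1 hr
  have hrep2 : StratCode.Represents (Fu ((c, i, r), L (c, i, r))) (A := A) (i := !i)
      fun _ s => unif (Arena.avoidActs (A.game p h1.le) i R s) :=
    Arena.represents_of_weights hne2 (q := Input.Avoid (c, i, r) (L (c, i, r)))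
      (Arena.avoid_listBelow_iff hA hc h0 h1 hr hNx)
      (hnum fun l hl μ hμ => Arena.numOpp_eq hc ▸ hFu' (c, i, r) _ l hl μ hμ)
  have hrep3 : StratCode.Represents (Fu ((c, i, r), [])) (A := A) (i := !i)
      fun _ s => unif ((A.game p h1.le).allowed (!i) s) :=
    Arena.represents_of_weights hne3 (q := Input.Avoid (c, i, r) []) (Arena.avoid_nil_iff hA hc h0 h1)
      (hnum fun l hl μ hμ => Arena.numOpp_eq hc ▸ hFu' (c, i, r) _ l hl μ hμ)
  have hunif : ∀ h : List A.State, ∀ s ∈ W, IsUniformOn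
      ((fun _ s => unif (Arena.reachActs (A.game p h1.le) i R W s) : Strat A.State (A.Act i)) h s)
      (H.stay i W s) := by
    intro h s hs
    rw [Arena.stay_eq_reachActs hA hH hRW hs]
    exact isUniformOn_unif (hne1 s)
  refine ⟨fun k => ?_, (Arena.states_D_eq hc h0 h1 hr hNx _).trans hWk,
    ⟨_, fun h s _ a ha => ((mem_support_unif (hne1 s)).1 ha).1, Arena.isPFM_of_represents hrep1, hunif,
      hwins _ hunif, hrep1⟩,
    ⟨Arena.countingMix (fun _ s => unif (Arena.avoidActs (A.game p h1.le) i R s))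
      (fun _ s => unif ((A.game p h1.le).allowed (!i) s)), _, _, fun h s _ b hb => ?_,
      fun h s _ b hb => ((mem_support_unif (hne2 s)).1 hb).1, Arena.isPFM_of_represents hrep2,
      fun h s _ b hb => (mem_support_unif (hne3 s)).1 hb, Arena.isPFM_of_represents hrep3,
      Arena.isCountingMix_countingMix _ _, fun s hs => ?_, hrep2, hrep3⟩⟩
  · obtain ⟨h2, h3, h4⟩ := hround k
    rw [h2, h3, h4]
    refine ⟨?_, ?_, Arena.states_D_eq hc h0 h1 hr hNx k⟩
    · rw [← Arena.states_compl hc h0 h1 hr hNx]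
      exact Arena.states_C_eq hc h0 h1 hr hNx k
    · rw [← Arena.states_compl hc h0 h1 hr hNx]
      exact Arena.states_reach hc h0 h1 hr hNx k
  · rcases Arena.mem_support_countingMix.1 hb with hb | hb
    · exact ((mem_support_unif (hne2 s)).1 hb).1
    · exact (mem_support_unif (hne3 s)).1 hb
  · rw [← hWk] at hs
    exact Arena.wins_NZ_always hA (fun h s b hb => (mem_support_unif (hne2 s)).1 hb)
      (fun h s b hb => (mem_support_unif (hne3 s)).2 hb) hs
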